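/- Let $k$ be a field and $d\in\mathbb Z$. A space means a simplicial set (a topological space enters through its singular simplicial set), and $C^*(X,k)$ denotes the complex of singular cochains. A \emph{local system} of complexes on $X$ is a functor $E$ from the category of simplices of $X$ to cochain complexes of $k$-vector spaces that sends every morphism to a quasi-isomorphism; it is \emph{perfect} if its values have finite-dimensional total cohomology. $\Gamma(X,E)$ is the complex of derived global sections of $E$ (cochains on $X$ with coefficients in $E$), and $E^\vee$ is the dual local system; for perfect $E$ it is represented by any system of complexes $E'$ with a natural pairing $E\otimes E'\to k$ that is fibrewise perfect, and the conditions below are required for all such $(E,E')$. The space $X$ is \emph{$\mathcal O$-compact} if $\Gamma(X,-)$ commutes, up to quasi-isomorphism, with direct sums of local systems and sends perfect local systems to perfect complexes. A \emph{fundamental class} of degree $d$ on $X$ is a morphism of complexes $[X]:C^*(X,k)\to k[-d]$. If $X$ is $\mathcal O$-compact, $[X]$ is a \emph{$d$-orientation}, and $X$ is called \emph{$d$-oriented}, if for every perfect $E$ the pairing $$\Gamma(X,E)\otimes\Gamma(X,E^\vee)\xrightarrow{\ \cup\ }C^*(X,k)\xrightarrow{\,[X]\,}k[-d]$$ is non-degenerate,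 i.e. induces a quasi-isomorphism $\Gamma(X,E^\vee)\to\Gamma(X,E)^\vee[-d]$. We write $\overline X$ for $X$ equipped with $-[X]$, and give a disjoint union the sum of the two fundamental classes. A \emph{boundary structure} on a map $f:U\to V$, where $U$ carries a fundamental class $[U]$, is a path from $f_*[U]$ to $0$ in $\mathrm{Map}(C^*(V,k),k[-d])$, i.e. a null-homotopy of $f_*[U]=[U]\circ f^*$. For $E$ perfect on $V$, let $\Gamma(V,E)^\perp$ be the homotopy fibre of the map $\Gamma(U,f^*E^\vee)\to\Gamma(V,E)^\vee[-d]$ induced by the pairing $$\Gamma(V,E)\otimes\Gamma(U,f^*E^\vee)\to\Gamma(U,f^*E)\otimes\Gamma(U,f^*E^\vee)\to C^*(U,k)\xrightarrow{[U]}k[-d].$$ The boundary structure induces a map $\Gamma(V,E^\vee)\to\Gamma(V,E)^\perp$ lifting the restriction $\Gamma(V,E^\vee)\to\Gamma(U,f^*E^\vee)$, and it is \emph{non-degenerate} if this map is a quasi-isomorphism for every perfect $E$ on $V$. A \emph{relative $d$-orientation} on $f$ is a $d$-orientation of $U$ together with a non-degenerate boundary structure on $f$. \textbf{Theorem.} Let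 $X,Y,Z$ be $d$-oriented spaces, and let $f:X\sqcup\overline Y\to F$ and $g:Y\sqcup\overline Z\to G$ be maps equipped with relative $d$-orientations. Let $T=F\sqcup^h_YG$ be the homotopy pushout (the double mapping cylinder), with its canonical maps $i:F\to T$, $j:G\to T$ and $h:Y\times\Delta^1\to T$, and let $t:X\sqcup\overline Z\to T$ be the induced map. Composing the path from $i_*f_*[X]$ to $i_*f_*[Y]$ given by the boundary structure on $f$, the path from $i_*f_*[Y]$ to $j_*g_*[Y]$ given by $h$, and the path from $j_*g_*[Y]$ to $j_*g_*[Z]$ given by the boundary structure on $g$, one obtains a boundary structure on $t$. This boundary structure is a relative $d$-orientation on $t:X\sqcup\overline Z\to T$. If moreover $F$ and $G$ are $\mathcal O$-compact, then so is $T$. -/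

import Mathlib

open CategoryTheory Limits Opposite MonoidalCategory

local notation "⦋" n "⦌" => SimplexCategory.mk n

universe u

noncomputable section

namespace OrientedCospan

/-- Cochain complexes of `k`-vector spaces. -/
abbrev Cpx (k : Type u) [Field k] := CochainComplex (ModuleCat.{u} k) ℤ

/-- The set of `p`-simplices of `X`. -/
abbrev Spx (X : SSet.{u}) (p : ℕ) : Type u := X.obj (op ⦋p⦌)

/-- A simplex of `X`, as an object of the category of simplices of `X`
(the opposite of the category of elements of `X`). -/
abbrev smp {X : SSet.{u}} {p : ℕ} (σ : Spx X p) : X.Elementsᵒᵖ := op (X.elementsMk (op ⦋p⦌) σ)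

/-- The morphism `τ ⟶ σ` in the category of simplices of `X` given by an operator `θ`
with `θ^* σ = τ`. -/
abbrev arrow {X : SSet.{u}} {m n : ℕ} (θ : ⦋m⦌ ⟶ ⦋n⦌) {σ : Spx X n} {τ : Spx X m}
    (h : X.map θ.op σ = τ) : smp τ ⟶ smp σ :=
  (CategoryOfElements.homMk (F := X) (X.elementsMk (op ⦋n⦌) σ) (X.elementsMk (op ⦋m⦌) τ) θ.op h).op

/-- A system of coefficients on `X`: a (covariant) functor from the category of simplices of `X`
to cochain complexes. -/
abbrev Coeff (k : Type u) [Field k] (X : SSet.{u}) := X.Elementsᵒᵖ ⥤ Cpx k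

namespace Coeff

variable {k : Type u} [Field k] {X Y : SSet.{u}}

/-- Pullback of coefficients along a map of spaces. -/
def pullback (f : X ⟶ Y) (E : Coeff k Y) : Coeff k X := (CategoryOfElements.map f).op ⋙ E

/-- Locally constant coefficients: all transition maps are quasi-isomorphisms. -/
def IsLocallyConstant (E : Coeff k X) : Prop :=
  ∀ ⦃σ τ : X.Elementsᵒᵖ⦄ (φ : σ ⟶ τ), QuasiIso (E.map φ)

end Coeff

/-- A complex over a field is perfect when its total cohomology is finite dimensional. -/
def IsPerfectCpx {k : Type u} [Field k] (A : Cpx k) : Prop :=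
  (∀ i : ℤ, Module.Finite k (A.homology i)) ∧ {i : ℤ | ¬ IsZero (A.homology i)}.Finite

/-- Perfect complexes on (the constant stack of) `X`: locally constant coefficients whose values
are perfect complexes. -/
def Coeff.IsPerfect {k : Type u} [Field k] {X : SSet.{u}} (E : Coeff k X) : Prop :=
  E.IsLocallyConstant ∧ ∀ σ, IsPerfectCpx (E.obj σ)

/-! ### Derived global sections -/

section Sections

/-- Bidegrees `(p, q)` with `p + q = n` and `p ≥ 0`. -/
structure Bideg (n : ℤ) where
  /-- the simplicial degree -/
  p : ℕ
  /-- the internal degree -/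
  q : ℤ
  hpq : (p : ℤ) + q = n

variable {k : Type u} [Field k] {X Y : SSet.{u}}

/-- Cochains of total degree `n` on `X` with coefficients in `E`:
the product over all `p + q = n` and all `p`-simplices `σ` of `E(σ)^q`. -/
abbrev Sec (E : Coeff k X) (n : ℤ) : Type u :=
  ∀ (t : Bideg n) (σ : Spx X t.p), ((E.obj (smp σ)).X t.q : Type u)

/-- The value of a cochain on the face `θ^* σ`, transported to `σ`. -/
def Sec.ev {E : Coeff k X} {n : ℤ} (α : Sec E n) {p N : ℕ} (q : ℤ) (h : (p : ℤ) + q = n)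
    (θ : ⦋p⦌ ⟶ ⦋N⦌) (σ : Spx X N) : ((E.obj (smp σ)).X q : Type u) :=
  ((E.map (arrow θ rfl)).f q).hom (α ⟨p, q, h⟩ (X.map θ.op σ))

/-- The differential of the total complex: the alternating sum of the cofaces, plus
`(-1)^p` times the internal differential. -/
def Sec.D {E : Coeff k X} {n n' : ℤ} (hn : n + 1 = n') (α : Sec E n) : Sec E n'
  | ⟨0, q, h⟩, σ => ((E.obj (smp σ)).d (q - 1) q).hom (α ⟨0, q - 1, by omega⟩ σ)
  | ⟨p + 1, q, h⟩, σ =>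
      ∑ i : Fin (p + 2), (-1 : ℤ) ^ (i : ℕ) • α.ev q (by push_cast at h; omega)
          (SimplexCategory.δ i) σ +
        (-1 : ℤ) ^ (p + 1) • ((E.obj (smp σ)).d (q - 1) q).hom
          (α ⟨p + 1, q - 1, by omega⟩ σ)

lemma Sec.ev_eq {E : Coeff k X} {n : ℤ} (α : Sec E n) {p N : ℕ} (q : ℤ) (h : (p : ℤ) + q = n)
    (θ : ⦋p⦌ ⟶ ⦋N⦌) (σ : Spx X N) (τ : Spx X p) (hτ : X.map θ.op σ = τ) :
    α.ev q h θ σ = ((E.map (arrow θ hτ)).f q).hom (α ⟨p, q, h⟩ τ) := by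
  subst hτ; rfl

lemma Sec.map_ev {E : Coeff k X} {n : ℤ} (α : Sec E n) {p M N : ℕ} (q : ℤ) (h : (p : ℤ) + q = n)
    (θ : ⦋p⦌ ⟶ ⦋M⦌) (ψ : ⦋M⦌ ⟶ ⦋N⦌) (σ : Spx X N) :
    ((E.map (arrow ψ rfl)).f q).hom (α.ev q h θ (X.map ψ.op σ)) = α.ev q h (θ ≫ ψ) σ := by
  have e : X.map (θ ≫ ψ).op σ = X.map θ.op (X.map ψ.op σ) := by
    simp
  rw [α.ev_eq q h (θ ≫ ψ) σ _ e]
  have : (arrow (θ ≫ ψ) e : smp _ ⟶ smp σ) = arrow θ rfl ≫ arrow ψ rfl := rfl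
  rw [this, E.map_comp]
  rfl

lemma Sec.ev_id {E : Coeff k X} {n : ℤ} (α : Sec E n) {p : ℕ} (q : ℤ) (h : (p : ℤ) + q = n)
    (σ : Spx X p) : α.ev q h (𝟙 _) σ = α ⟨p, q, h⟩ σ := by
  have e : X.map (𝟙 ⦋p⦌ : ⦋p⦌ ⟶ ⦋p⦌).op σ = σ := by simp
  rw [α.ev_eq q h _ σ _ e]
  have : (arrow (𝟙 _) e : smp σ ⟶ smp σ) = 𝟙 _ := rfl
  rw [this, E.map_id]
  rfl

/-- The alternating sum over pairs of successive faces vanishes. -/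
lemma altSum_faces {M : Type*} [AddCommGroup M] {n : ℕ} (G : (⦋n⦌ ⟶ ⦋n + 2⦌) → M) :
    ∑ j : Fin (n + 3), (-1 : ℤ) ^ (j : ℕ) •
      ∑ i : Fin (n + 2), (-1 : ℤ) ^ (i : ℕ) •
        G (SimplexCategory.δ i ≫ SimplexCategory.δ j) = 0 := by
  simp only [Finset.smul_sum, smul_smul, ← pow_add, ← Finset.sum_product']
  let P := Fin (n + 3) × Fin (n + 2)
  let S : Finset P := {ij : P | (ij.1 : ℕ) ≤ (ij.2 : ℕ)}
  rw [Finset.univ_product_univ, ← Finset.sum_add_sum_compl S, ← eq_neg_iff_add_eq_zero,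
    ← Finset.sum_neg_distrib]
  let φ : ∀ ij : P, ij ∈ S → P := fun ij hij =>
    (ij.2.succ, Fin.castLT ij.1 (lt_of_le_of_lt (Finset.mem_filter.mp hij).right ij.2.is_lt))
  apply Finset.sum_bij φ
  · intro ij hij
    simp_rw [S, φ, Finset.compl_filter, Finset.mem_filter_univ, Fin.val_succ,
      Fin.val_castLT] at hij ⊢
    omega
  · rintro ⟨i, j⟩ hij ⟨i', j'⟩ hij' h
    rw [Prod.mk_inj] at h ⊢
    have h₁ := congrArg Fin.val h.1
    have h₂ := congrArg Fin.val h.2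
    simp only [Fin.val_succ, Fin.val_castLT] at h₁ h₂
    exact ⟨Fin.ext h₂, Fin.ext (by omega)⟩
  · rintro ⟨i', j'⟩ hij'
    simp_rw [S, Finset.compl_filter, Finset.mem_filter_univ, not_le] at hij'
    refine ⟨(Fin.castSucc j', i'.pred <| ?_), ?_, ?_⟩
    · rintro rfl
      simp only [Fin.val_zero, not_lt_zero] at hij'
    · simpa [S] using Nat.le_sub_one_of_lt hij'
    · simp only [φ, Fin.castLT_castSucc, Fin.succ_pred]
  · rintro ⟨i, j⟩ hij
    have h' : (i : ℕ) ≤ j := (Finset.mem_filter.mp hij).2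
    dsimp [φ]
    rw [← SimplexCategory.δ_comp_δ'' (by simpa [Fin.le_def] using h'), ← neg_smul]
    congr 1
    rw [add_right_comm, pow_succ, add_comm]
    simp

lemma Sec.D_zero {E : Coeff k X} {n n' : ℤ} (hn : n + 1 = n') (α : Sec E n) (q q₁ : ℤ)
    (h : ((0 : ℕ) : ℤ) + q = n') (hq : q₁ + 1 = q) (σ : Spx X 0) :
    α.D hn ⟨0, q, h⟩ σ = ((E.obj (smp σ)).d q₁ q).hom (α ⟨0, q₁, by omega⟩ σ) := by
  obtain rfl : q₁ = q - 1 := by omega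
  rfl

lemma Sec.D_succ {E : Coeff k X} {n n' : ℤ} (hn : n + 1 = n') (α : Sec E n) (p : ℕ) (q q₁ : ℤ)
    (h : ((p + 1 : ℕ) : ℤ) + q = n') (hq : q₁ + 1 = q) (σ : Spx X (p + 1)) :
    α.D hn ⟨p + 1, q, h⟩ σ =
      ∑ i : Fin (p + 2), (-1 : ℤ) ^ (i : ℕ) • α.ev q (by push_cast at h; omega)
          (SimplexCategory.δ i) σ +
        (-1 : ℤ) ^ (p + 1) • ((E.obj (smp σ)).d q₁ q).hom (α ⟨p + 1, q₁, by omega⟩ σ) := by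
  obtain rfl : q₁ = q - 1 := by omega
  rfl

lemma Sec.d_ev {E : Coeff k X} {n : ℤ} (α : Sec E n) {p N : ℕ} (q q' : ℤ)
    (h : (p : ℤ) + q = n) (θ : ⦋p⦌ ⟶ ⦋N⦌) (σ : Spx X N) :
    ((E.obj (smp σ)).d q q').hom (α.ev q h θ σ) =
      ((E.map (arrow θ rfl)).f q').hom (((E.obj (smp _)).d q q').hom (α ⟨p, q, h⟩ (X.map θ.op σ))) := by
  have := (E.map (arrow θ (rfl : X.map θ.op σ = _))).comm q q'
  exact congrArg (fun f => f.hom (α ⟨p, q, h⟩ (X.map θ.op σ))) this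

lemma Sec.ev_D_zero {E : Coeff k X} {n n' : ℤ} (hn : n + 1 = n') (α : Sec E n) {N : ℕ} (q q₁ : ℤ)
    (h : ((0 : ℕ) : ℤ) + q = n') (hq : q₁ + 1 = q) (θ : ⦋0⦌ ⟶ ⦋N⦌) (σ : Spx X N) :
    (α.D hn).ev q h θ σ =
      ((E.obj (smp σ)).d q₁ q).hom (α.ev q₁ (by omega) θ σ) := by
  rw [Sec.d_ev, Sec.ev, Sec.D_zero hn α q q₁ h hq]

lemma Sec.ev_D_succ {E : Coeff k X} {n n' : ℤ} (hn : n + 1 = n') (α : Sec E n) {p N : ℕ}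
    (q q₁ : ℤ) (h : ((p + 1 : ℕ) : ℤ) + q = n') (hq : q₁ + 1 = q) (θ : ⦋p + 1⦌ ⟶ ⦋N⦌)
    (σ : Spx X N) :
    (α.D hn).ev q h θ σ =
      ∑ i : Fin (p + 2), (-1 : ℤ) ^ (i : ℕ) • α.ev q (by push_cast at h; omega)
          (SimplexCategory.δ i ≫ θ) σ +
        (-1 : ℤ) ^ (p + 1) • ((E.obj (smp σ)).d q₁ q).hom (α.ev q₁ (by omega) θ σ) := by
  rw [Sec.d_ev, Sec.ev, Sec.D_succ hn α p q q₁ h hq, map_add, map_sum]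
  simp only [map_zsmul, Sec.map_ev]

lemma Sec.D_D {E : Coeff k X} {n n' n'' : ℤ} (hn : n + 1 = n') (hn' : n' + 1 = n'')
    (α : Sec E n) : (α.D hn).D hn' = 0 := by
  have dd : ∀ {N : ℕ} (σ : Spx X N) (a b c : ℤ) (x : ((E.obj (smp σ)).X a : Type u)),
      ((E.obj (smp σ)).d b c).hom (((E.obj (smp σ)).d a b).hom x) = 0 := fun σ a b c x =>
    congrArg (fun f => f.hom x) ((E.obj (smp σ)).d_comp_d a b c)
  funext ⟨p, q, h⟩ σ
  match p with
  | 0 =>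
    rw [Sec.D_zero hn' _ q (q - 1) h (by omega),
      Sec.D_zero hn _ (q - 1) (q - 2) (by omega) (by omega), dd]
    rfl
  | 1 =>
    rw [Sec.D_succ hn' _ 0 q (q - 1) h (by omega),
      Sec.D_succ hn _ 0 (q - 1) (q - 2) (by omega) (by omega), map_add, map_zsmul, dd]
    simp only [Sec.ev_D_zero hn α q (q - 1) (by push_cast at h; omega) (by omega), map_sum,
      map_zsmul]
    simp
    abel
  | p + 2 =>
    rw [Sec.D_succ hn' _ (p + 1) q (q - 1) h (by omega),
      Sec.D_succ hn _ (p + 1) (q - 1) (q - 2) (by omega) (by omega), map_add, map_zsmul, dd]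
    simp only [Sec.ev_D_succ (p := p) hn α q (q - 1) (by push_cast at h ⊢; omega) (by omega),
      map_sum, map_zsmul, smul_add, Finset.sum_add_distrib]
    rw [altSum_faces (fun θ => α.ev q (by push_cast at h; omega) θ σ)]
    simp only [smul_zero, add_zero, zero_add, Finset.smul_sum, ← Finset.sum_add_distrib]
    refine Finset.sum_eq_zero fun i _ => ?_
    rw [smul_smul, smul_smul, ← add_smul]
    convert zero_smul ℤ _ using 2
    ring

/-- The differential as a linear map. -/
def Sec.dLin (E : Coeff k X) {n n' : ℤ} (hn : n + 1 = n') : Sec E n →ₗ[k] Sec E n' where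
  toFun α := α.D hn
  map_add' α β := by
    funext ⟨p, q, h⟩ σ
    cases p with
    | zero =>
      simp only [Pi.add_apply, Sec.D_zero hn _ q (q - 1) h (by omega), map_add]
    | succ p =>
      simp only [Pi.add_apply, Sec.D_succ hn _ p q (q - 1) h (by omega), map_add, Sec.ev,
        smul_add, Finset.sum_add_distrib]
      abel
  map_smul' c α := by
    funext ⟨p, q, h⟩ σ
    cases p with
    | zero =>
      simp only [Pi.smul_apply, Sec.D_zero hn _ q (q - 1) h (by omega), map_smul,
        RingHom.id_apply]
    | succ p =>
      simp only [Pi.smul_apply, Sec.D_succ hn _ p q (q - 1) h (by omega), map_smul, Sec.ev,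
        RingHom.id_apply, smul_add, Finset.smul_sum]
      simp only [smul_comm c]

/-- The complex `Γ(X, E)` of derived global sections of `E`. -/
def sections (E : Coeff k X) : Cpx k where
  X n := ModuleCat.of k (Sec E n)
  d n n' := if h : n + 1 = n' then ModuleCat.ofHom (Sec.dLin E h) else 0
  shape n n' h := dif_neg h
  d_comp_d' n n' n'' h h' := by
    rw [dif_pos (show n + 1 = n' from h), dif_pos (show n' + 1 = n'' from h')]
    ext α t σ
    exact congrFun (congrFun (Sec.D_D h h' α) t) σ

lemma sections_d (E : Coeff k X) {n n' : ℤ} (h : n + 1 = n') :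
    (sections E).d n n' = ModuleCat.ofHom (Sec.dLin E h) := dif_pos h

/-- The effect on sections of a morphism of coefficients. -/
def Sec.map {E E' : Coeff k X} (φ : E ⟶ E') {n : ℤ} (α : Sec E n) : Sec E' n :=
  fun t σ => ((φ.app (smp σ)).f t.q).hom (α t σ)

lemma Sec.map_coeff_ev {E E' : Coeff k X} (φ : E ⟶ E') {n : ℤ} (α : Sec E n) {p N : ℕ} (q : ℤ)
    (h : (p : ℤ) + q = n) (θ : ⦋p⦌ ⟶ ⦋N⦌) (σ : Spx X N) :
    (α.map φ).ev q h θ σ = ((φ.app (smp σ)).f q).hom (α.ev q h θ σ) :=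
  (congrArg (fun f => (f.f q).hom (α ⟨p, q, h⟩ (X.map θ.op σ)))
    (φ.naturality (arrow θ (σ := σ) rfl))).symm

lemma Sec.map_D {E E' : Coeff k X} (φ : E ⟶ E') {n n' : ℤ} (hn : n + 1 = n') (α : Sec E n) :
    (α.map φ).D hn = (α.D hn).map φ := by
  have hd : ∀ {N : ℕ} (σ : Spx X N) (a b : ℤ) (x : ((E.obj (smp σ)).X a : Type u)),
      ((E'.obj (smp σ)).d a b).hom (((φ.app (smp σ)).f a).hom x) =
        ((φ.app (smp σ)).f b).hom (((E.obj (smp σ)).d a b).hom x) := fun σ a b x =>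
    congrArg (fun f => f.hom x) ((φ.app (smp σ)).comm a b)
  funext ⟨p, q, hq⟩ σ
  cases p with
  | zero =>
    simp only [Sec.map, Sec.D_zero hn _ q (q - 1) hq (by omega), hd]
  | succ p =>
    simp only [Sec.D_succ hn _ p q (q - 1) hq (by omega), Sec.map_coeff_ev]
    simp only [Sec.map, Sec.D_succ hn _ p q (q - 1) hq (by omega), map_add, map_sum, map_zsmul,
      hd]

/-- Functoriality of derived global sections in the coefficients. -/
def sectionsMap {E E' : Coeff k X} (φ : E ⟶ E') : sections E ⟶ sections E' where
  f n := ModuleCat.ofHom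
    { toFun := fun α : Sec E n => α.map φ
      map_add' := fun α β => by funext t σ; simp [Sec.map]
      map_smul' := fun c α => by funext t σ; simp [Sec.map] }
  comm' n n' h := by
    have h' : n + 1 = n' := h
    rw [sections_d E h', sections_d E' h']
    ext α
    exact Sec.map_D φ h' α

/-- The functor `Γ(X, -)`. -/
def sectionsFunctor (k : Type u) [Field k] (X : SSet.{u}) : Coeff k X ⥤ Cpx k where
  obj E := sections E
  map φ := sectionsMap φ
  map_id _ := by rfl
  map_comp _ _ := by rfl

/-- Pullback of sections along a map of spaces. -/
def Sec.pull (f : X ⟶ Y) {E : Coeff k Y} {n : ℤ} (α : Sec E n) : Sec (E.pullback f) n :=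
  fun t σ => α t (f.app _ σ)

lemma Sec.pull_ev (f : X ⟶ Y) {E : Coeff k Y} {n : ℤ} (α : Sec E n) {p N : ℕ} (q : ℤ)
    (h : (p : ℤ) + q = n) (θ : ⦋p⦌ ⟶ ⦋N⦌) (σ : Spx X N) :
    (α.pull f).ev q h θ σ = α.ev q h θ (f.app _ σ) :=
  (α.ev_eq q h θ (f.app _ σ) (f.app _ (X.map θ.op σ))
    (NatTrans.naturality_apply f θ.op σ).symm).symm

lemma Sec.pull_D (f : X ⟶ Y) {E : Coeff k Y} {n n' : ℤ} (hn : n + 1 = n') (α : Sec E n) :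
    (α.pull f).D hn = (α.D hn).pull f := by
  funext ⟨p, q, hq⟩ σ
  cases p with
  | zero => rfl
  | succ p =>
    simp only [Sec.D_succ hn _ p q (q - 1) hq (by omega), Sec.pull_ev]
    simp only [Sec.pull, Sec.D_succ hn _ p q (q - 1) hq (by omega)]
    rfl

/-- The map `Γ(Y, E) ⟶ Γ(X, f^* E)`. -/
def sectionsPullback (f : X ⟶ Y) (E : Coeff k Y) : sections E ⟶ sections (E.pullback f) where
  f n := ModuleCat.ofHom
    { toFun := fun α : Sec E n => α.pull f
      map_add' := fun _ _ => rfl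
      map_smul' := fun _ _ => rfl }
  comm' n n' h := by
    have h' : n + 1 = n' := h
    rw [sections_d _ h', sections_d _ h']
    ext α
    exact Sec.pull_D f h' α

/-! ### Singular cochains and fundamental classes -/

/-- Singular cochains of `X` with values in `k`, in degree `n : ℤ` (zero when `n < 0`). -/
abbrev Coch (k : Type u) (X : SSet.{u}) (n : ℤ) : Type u :=
  ∀ t : {p : ℕ // (p : ℤ) = n}, Spx X t.1 → k

/-- The singular coboundary, i.e. the alternating sum of the faces. -/
def Coch.D {n n' : ℤ} (hn : n + 1 = n') (c : Coch k X n) : Coch k X n'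
  | ⟨0, _⟩, _ => 0
  | ⟨p + 1, h⟩, σ =>
      ∑ i : Fin (p + 2), (-1 : k) ^ (i : ℕ) *
        c ⟨p, by push_cast at h; omega⟩ (X.map (SimplexCategory.δ i).op σ)

/-- Pullback of singular cochains. -/
def Coch.pull (f : X ⟶ Y) {n : ℤ} (c : Coch k Y n) : Coch k X n := fun t σ => c t (f.app _ σ)

lemma Coch.pull_D (f : X ⟶ Y) {n n' : ℤ} (hn : n + 1 = n') (c : Coch k Y n) :
    (c.D hn).pull f = (c.pull f).D hn := by
  funext ⟨p, h⟩ σ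
  cases p with
  | zero => rfl
  | succ p =>
    simp only [Coch.pull, Coch.D, NatTrans.naturality_apply f]

/-- A fundamental class of degree `d` on `X`: a morphism of complexes `C^*(X, k) ⟶ k[-d]`,
that is, a linear functional on the cochains of degree `d` which vanishes on coboundaries. -/
structure FundClass (k : Type u) [Field k] (X : SSet.{u}) (d : ℤ) where
  /-- evaluation on the fundamental class -/
  ev : Coch k X d →ₗ[k] k
  ev_D : ∀ (n : ℤ) (hn : n + 1 = d) (c : Coch k X n), ev (c.D hn) = 0

/-- The linear map underlying pullback of cochains. -/
def Coch.pullLin (k : Type u) [Field k] {X Y : SSet.{u}} (f : X ⟶ Y) (n : ℤ) :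
    Coch k Y n →ₗ[k] Coch k X n where
  toFun c := c.pull f
  map_add' _ _ := rfl
  map_smul' _ _ := rfl

namespace FundClass

variable {d : ℤ}

/-- The opposite fundamental class. -/
def neg (η : FundClass k X d) : FundClass k X d where
  ev := -η.ev
  ev_D n hn c := by simp [η.ev_D n hn c]

/-- The push-forward of a fundamental class along a map. -/
def push (f : X ⟶ Y) (η : FundClass k X d) : FundClass k Y d where
  ev := η.ev ∘ₗ Coch.pullLin k f d
  ev_D n hn c := (congrArg η.ev (Coch.pull_D f hn c)).trans (η.ev_D n hn _)

/-- The sum of two fundamental classes. -/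
def add (η θ : FundClass k X d) : FundClass k X d where
  ev := η.ev + θ.ev
  ev_D n hn c := by simp [η.ev_D n hn c, θ.ev_D n hn c]

/-- The fundamental class of a disjoint union. -/
def disjUnion (η : FundClass k X d) (θ : FundClass k Y d) :
    FundClass k (X ⨿ Y) d :=
  (η.push coprod.inl).add (θ.push coprod.inr)

end FundClass

/-! ### Pairings of complexes and shifted duals -/

/-- The sign `(-1)^n` as an element of `k`. -/
def sgn (k : Type u) [Field k] (n : ℤ) : k := ((n.negOnePow : ℤˣ) : ℤ)

lemma sgn_add (m n : ℤ) : sgn k (m + n) = sgn k m * sgn k n := by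
  simp [sgn, Int.negOnePow_add]

lemma sgn_succ (n : ℤ) : sgn k (n + 1) = -sgn k n := by
  simp [sgn, Int.negOnePow_succ]

lemma sgn_mul_self (n : ℤ) : sgn k n * sgn k n = 1 := by
  rw [← sgn_add, sgn, Int.negOnePow_even _ ⟨n, rfl⟩]; simp

lemma sgn_natCast (n : ℕ) : sgn k n = (-1) ^ n := by
  induction n with
  | zero => simp [sgn]
  | succ n ih => push_cast; rw [sgn_succ, ih, pow_succ]; ring

/-- A pairing `A ⊗ B ⟶ k[-d]`. -/
structure Pairing (A B : Cpx k) (d : ℤ) where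
  /-- the bilinear maps -/
  toFun : ∀ i j : ℤ, i + j = d → (A.X i →ₗ[k] B.X j →ₗ[k] k)
  leibniz : ∀ (i i' j j' : ℤ) (hi : i + 1 = i') (hj : j + 1 = j') (h : i' + j = d)
    (a : A.X i) (b : B.X j),
    toFun i' j h ((A.d i i').hom a) b + sgn k i * toFun i j' (by omega) a ((B.d j j').hom b) = 0

/-- The shifted dual complex `A^∨[-d]`, given in degree `n` by the dual of `A^{d-n}`. -/
def dualShift (A : Cpx k) (d : ℤ) : Cpx k where
  X n := ModuleCat.of k (A.X (d - n) →ₗ[k] k)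
  d n n' := ModuleCat.ofHom (sgn k (d - n) • LinearMap.lcomp k k (A.d (d - n') (d - n)).hom)
  shape n n' h := by
    have : A.d (d - n') (d - n) = 0 := A.shape _ _ fun h' => h (by
      simp only [ComplexShape.up_Rel] at h' ⊢; omega)
    ext φ x
    simp [this]
  d_comp_d' n n' n'' _ _ := by
    have : ∀ x, (A.d (d - n') (d - n)).hom ((A.d (d - n'') (d - n')).hom x) = 0 := fun x =>
      congrArg (fun f : A.X (d - n'') ⟶ A.X (d - n) => f.hom x)
        (A.d_comp_d (d - n'') (d - n') (d - n))
    ext φ x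
    simp [this]

/-- The morphism `B ⟶ A^∨[-d]` induced by a pairing `A ⊗ B ⟶ k[-d]`. -/
def Pairing.toDual {A B : Cpx k} {d : ℤ} (R : Pairing A B d) : B ⟶ dualShift A d where
  f n := ModuleCat.ofHom (R.toFun (d - n) n (by omega)).flip
  comm' n n' h := by
    have h' : n + 1 = n' := h
    ext b
    refine LinearMap.ext fun a => ?_
    have key := R.leibniz (d - n') (d - n) n n' (by omega) h' (by omega) a b
    change sgn k (d - n) * R.toFun (d - n) n _ ((A.d (d - n') (d - n)).hom a) b =
      R.toFun (d - n') n' _ a ((B.d n n').hom b)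
    have e : sgn k (d - n) = -sgn k (d - n') := by
      rw [← sgn_succ]; congr 1; omega
    have e2 := sgn_mul_self (k := k) (d - n')
    rw [e]
    linear_combination (-sgn k (d - n')) * key + R.toFun (d - n') n' _ a ((B.d n n').hom b) * e2

/-- Restriction of a pairing along a morphism in the first variable. -/
def Pairing.comapLeft {A A' B : Cpx k} {d : ℤ} (φ : A' ⟶ A) (R : Pairing A B d) :
    Pairing A' B d where
  toFun i j h := R.toFun i j h ∘ₗ (φ.f i).hom
  leibniz i i' j j' hi hj h a b := by
    have e : (φ.f i').hom ((A'.d i i').hom a) = (A.d i i').hom ((φ.f i).hom a) :=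
      (congrArg (fun f => f.hom a) (φ.comm i i')).symm
    have := R.leibniz i i' j j' hi hj h ((φ.f i).hom a) b
    simpa only [LinearMap.comp_apply, e] using this

/-- A pairing of coefficient systems `E ⊗ E' ⟶ k` with values in the constant system. -/
structure CoeffPairing (E E' : Coeff k X) where
  /-- the pairing over each simplex -/
  pair : ∀ σ : X.Elementsᵒᵖ, Pairing (E.obj σ) (E'.obj σ) 0
  natural : ∀ {σ τ : X.Elementsᵒᵖ} (φ : σ ⟶ τ) (i j : ℤ) (h : i + j = 0)
    (a : (E.obj σ).X i) (b : (E'.obj σ).X j),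
    (pair τ).toFun i j h (((E.map φ).f i).hom a) (((E'.map φ).f j).hom b) =
      (pair σ).toFun i j h a b

namespace CoeffPairing

/-- The pairing exhibits `E'` as the dual of the perfect complex `E`:
fibrewise, `E' ⟶ E^∨` is a quasi-isomorphism. -/
def IsDual {E E' : Coeff k X} (P : CoeffPairing E E') : Prop :=
  E.IsPerfect ∧ ∀ σ, QuasiIso (P.pair σ).toDual

/-- Pullback of a pairing of coefficients along a map of spaces. -/
def pullback (f : X ⟶ Y) {E E' : Coeff k Y} (P : CoeffPairing E E') :
    CoeffPairing (E.pullback f) (E'.pullback f) where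
  pair σ := P.pair ((CategoryOfElements.map f).op.obj σ)
  natural φ i j h a b := P.natural ((CategoryOfElements.map f).op.map φ) i j h a b

end CoeffPairing

/-! ### The cup product -/

/-- The inclusion of the first `p + 1` vertices. -/
def front {p N : ℕ} (h : p ≤ N) : ⦋p⦌ ⟶ ⦋N⦌ :=
  SimplexCategory.mkHom ⟨fun i => ⟨i, by omega⟩, fun i j hij => by simpa using hij⟩

/-- The inclusion of the last `r + 1` vertices. -/
def back {r N : ℕ} (h : r ≤ N) : ⦋r⦌ ⟶ ⦋N⦌ :=
  SimplexCategory.mkHom ⟨fun i => ⟨N - r + i, by omega⟩, fun i j hij => by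
    simpa using hij⟩

lemma cup_faces {M : Type*} [AddCommGroup M] {p r N : ℕ} (h : p + r = N)
    (W : (⦋p⦌ ⟶ ⦋N + 1⦌) → (⦋r⦌ ⟶ ⦋N + 1⦌) → M) :
    ∑ i : Fin (N + 2), (-1 : ℤ) ^ (i : ℕ) •
        W (front (by omega : p ≤ N) ≫ SimplexCategory.δ i)
          (back (by omega : r ≤ N) ≫ SimplexCategory.δ i) =
      ∑ i : Fin (p + 2), (-1 : ℤ) ^ (i : ℕ) •
        W (SimplexCategory.δ i ≫ front (by omega : p + 1 ≤ N + 1))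
          (back (by omega : r ≤ N + 1)) +
      (-1 : ℤ) ^ p • ∑ i : Fin (r + 2), (-1 : ℤ) ^ (i : ℕ) •
        W (front (by omega : p ≤ N + 1))
          (SimplexCategory.δ i ≫ back (by omega : r + 1 ≤ N + 1)) := by
  let dl (n i : ℕ) : ⦋n⦌ ⟶ ⦋n + 1⦌ := SimplexCategory.mkHom
    ⟨fun j => ⟨if (j : ℕ) < i then j else j + 1, by split_ifs <;> omega⟩, fun a b hab => by
      have : (a : ℕ) ≤ b := hab
      simp only [Fin.mk_le_mk]; split_ifs <;> omega⟩
  have hdl : ∀ (n : ℕ) (i : Fin (n + 2)), SimplexCategory.δ i = dl n i := by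
    intro n i
    ext j
    simp only [SimplexCategory.δ, dl]
    change ((i.succAbove j : Fin (n + 2)) : ℕ) = if (j : ℕ) < i then (j : ℕ) else j + 1
    simp only [Fin.succAbove, Fin.lt_def, Fin.val_castSucc]
    split_ifs <;> simp
  simp only [hdl]
  rw [← Finset.sum_range (fun i => (-1 : ℤ) ^ i • W (front _ ≫ dl N i) (back _ ≫ dl N i)),
    ← Finset.sum_range (fun i => (-1 : ℤ) ^ i • W (dl p i ≫ front _) (back _)),
    ← Finset.sum_range (fun i => (-1 : ℤ) ^ i • W (front _) (dl r i ≫ back _))]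
  have f1 : ∀ i ≤ p, front (by omega : p ≤ N) ≫ dl N i =
      dl p i ≫ front (by omega : p + 1 ≤ N + 1) := fun i hi => by ext j; rfl
  have f2 : ∀ i, p < i → front (by omega : p ≤ N) ≫ dl N i = front (by omega : p ≤ N + 1) :=
    fun i hi => by
      ext j
      have : (j : ℕ) < i := by have := j.2; simp at this; omega
      exact if_pos this
  have f3 : dl p (p + 1) ≫ front (by omega : p + 1 ≤ N + 1) = front (by omega : p ≤ N + 1) := by
    ext j
    exact if_pos j.2
  have b1 : ∀ i ≤ p, back (by omega : r ≤ N) ≫ dl N i = back (by omega : r ≤ N + 1) :=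
    fun i hi => by
      ext j
      change (if N - r + (j : ℕ) < i then N - r + (j : ℕ) else N - r + (j : ℕ) + 1) =
        N + 1 - r + (j : ℕ)
      rw [if_neg (by omega)]; omega
  have b2 : ∀ i, back (by omega : r ≤ N) ≫ dl N (p + 1 + i) =
      dl r (i + 1) ≫ back (by omega : r + 1 ≤ N + 1) := fun i => by
    ext j
    change (if N - r + (j : ℕ) < p + 1 + i then N - r + (j : ℕ) else N - r + (j : ℕ) + 1) =
        N + 1 - (r + 1) + (if (j : ℕ) < i + 1 then (j : ℕ) else (j : ℕ) + 1)
    split_ifs <;> omega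
  have b3 : dl r 0 ≫ back (by omega : r + 1 ≤ N + 1) = back (by omega : r ≤ N + 1) := by
    ext j
    change N + 1 - (r + 1) + (if (j : ℕ) < 0 then (j : ℕ) else (j : ℕ) + 1) =
      N + 1 - r + (j : ℕ)
    rw [if_neg (by omega)]; omega
  rw [show N + 2 = (p + 1) + (r + 1) by omega, Finset.sum_range_add,
    Finset.sum_range_succ _ (p + 1), Finset.sum_range_succ' _ (r + 1), f3, b3]
  have e1 : ∑ x ∈ Finset.range (p + 1), (-1 : ℤ) ^ x •
      W (front (by omega : p ≤ N) ≫ dl N x) (back (by omega : r ≤ N) ≫ dl N x) =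
      ∑ x ∈ Finset.range (p + 1), (-1 : ℤ) ^ x •
        W (dl p x ≫ front (by omega : p + 1 ≤ N + 1)) (back (by omega : r ≤ N + 1)) :=
    Finset.sum_congr rfl fun i hi => by
      have : i ≤ p := by simpa [Nat.lt_succ_iff] using hi
      rw [f1 i this, b1 i this]
  rw [e1, smul_add, Finset.smul_sum]
  have e2 : ∑ x ∈ Finset.range (r + 1), (-1 : ℤ) ^ (p + 1 + x) •
      W (front (by omega : p ≤ N) ≫ dl N (p + 1 + x))
        (back (by omega : r ≤ N) ≫ dl N (p + 1 + x)) =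
      ∑ x ∈ Finset.range (r + 1), (-1 : ℤ) ^ p • (-1 : ℤ) ^ (x + 1) •
        W (front (by omega : p ≤ N + 1)) (dl r (x + 1) ≫ back (by omega : r + 1 ≤ N + 1)) :=
    Finset.sum_congr rfl fun i hi => by
      rw [f2 (p + 1 + i) (by omega), b2 i, smul_smul, ← pow_add]
      congr 2; omega
  rw [e2, pow_zero, one_smul, pow_succ, mul_neg, mul_one, neg_smul]
  abel

lemma Sec.ev_add {E : Coeff k X} {n : ℤ} (α β : Sec E n) {p N : ℕ} (q : ℤ) (h : (p : ℤ) + q = n)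
    (θ : ⦋p⦌ ⟶ ⦋N⦌) (σ : Spx X N) : (α + β).ev q h θ σ = α.ev q h θ σ + β.ev q h θ σ :=
  map_add _ _ _

lemma Sec.ev_smul {E : Coeff k X} {n : ℤ} (c : k) (α : Sec E n) {p N : ℕ} (q : ℤ)
    (h : (p : ℤ) + q = n) (θ : ⦋p⦌ ⟶ ⦋N⦌) (σ : Spx X N) :
    (c • α).ev q h θ σ = c • α.ev q h θ σ :=
  map_smul _ _ _

/-- The contribution of simplicial bidegree `(p, r)` and internal bidegree `(q, s)` to the
cup product. -/
def cupTerm {E E' : Coeff k X} (P : CoeffPairing E E') {m n : ℤ} (a : Sec E m) (b : Sec E' n)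
    {N : ℕ} (σ : Spx X N) (p : ℕ) (q : ℤ) (r : ℕ) (s : ℤ) (hp : (p : ℤ) + q = m)
    (hr : (r : ℤ) + s = n) (h : p + r = N) (hN : (N : ℤ) = m + n) : k :=
  sgn k (q * r) * (P.pair (smp σ)).toFun q s (by omega)
    (a.ev q hp (front (by omega)) σ) (b.ev s hr (back (by omega)) σ)

/-- The cup product `Γ(X, E) ⊗ Γ(X, E') ⟶ C^*(X, k)` induced by a pairing `E ⊗ E' ⟶ k`. -/
def cup {E E' : Coeff k X} (P : CoeffPairing E E') {m n l : ℤ} (h : m + n = l)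
    (a : Sec E m) (b : Sec E' n) : Coch k X l := fun t σ =>
  ∑ i : Fin (t.1 + 1), cupTerm P a b σ i (m - i) (t.1 - i : ℕ) (n - (t.1 - i : ℕ))
    (by omega) (by omega) (by omega) (by rw [t.2, h])

/-- The cup product as a bilinear map. -/
def cupLin {E E' : Coeff k X} (P : CoeffPairing E E') {m n l : ℤ} (h : m + n = l) :
    Sec E m →ₗ[k] Sec E' n →ₗ[k] Coch k X l :=
  LinearMap.mk₂ k (cup P h)
    (fun a a' b => by
      funext t σ
      rw [Pi.add_apply, Pi.add_apply]
      simp only [cup, cupTerm, Sec.ev_add, map_add, LinearMap.add_apply, mul_add,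
        Finset.sum_add_distrib])
    (fun c a b => by
      funext t σ
      rw [Pi.smul_apply, Pi.smul_apply]
      simp only [cup, cupTerm, Sec.ev_smul, map_smul, LinearMap.smul_apply, smul_eq_mul,
        Finset.mul_sum, mul_left_comm])
    (fun a b b' => by
      funext t σ
      rw [Pi.add_apply, Pi.add_apply]
      simp only [cup, cupTerm, Sec.ev_add, map_add, mul_add, Finset.sum_add_distrib])
    (fun c a b => by
      funext t σ
      rw [Pi.smul_apply, Pi.smul_apply]
      simp only [cup, cupTerm, Sec.ev_smul, map_smul, smul_eq_mul, Finset.mul_sum,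
        mul_left_comm])

lemma cup_pull (f : X ⟶ Y) {E E' : Coeff k Y} (P : CoeffPairing E E') {m n l : ℤ}
    (h : m + n = l) (a : Sec E m) (b : Sec E' n) :
    cup (P.pullback f) h (a.pull f) (b.pull f) = (cup P h a b).pull f := by
  funext t σ
  refine Finset.sum_congr rfl fun i _ => ?_
  simp only [cupTerm, Sec.pull_ev]
  rfl

/-- The simplicial part of the differential of a cochain, evaluated on a face. -/
def Sec.hev {E : Coeff k X} {n n' : ℤ} (hn : n + 1 = n') (α : Sec E n) {N : ℕ} :
    ∀ (p : ℕ) (q : ℤ) (_ : (p : ℤ) + q = n') (_ : ⦋p⦌ ⟶ ⦋N⦌) (σ : Spx X N),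
      ((E.obj (smp σ)).X q : Type u)
  | 0, _, _, _, _ => 0
  | p + 1, q, h, θ, σ => ∑ i : Fin (p + 2), (-1 : ℤ) ^ (i : ℕ) •
      α.ev q (by push_cast at h; omega) (SimplexCategory.δ i ≫ θ) σ

lemma Sec.ev_D {E : Coeff k X} {n n' : ℤ} (hn : n + 1 = n') (α : Sec E n) {p N : ℕ}
    (q q₁ : ℤ) (h : (p : ℤ) + q = n') (hq : q₁ + 1 = q) (θ : ⦋p⦌ ⟶ ⦋N⦌) (σ : Spx X N) :
    (α.D hn).ev q h θ σ = α.hev hn p q h θ σ +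
      (-1 : ℤ) ^ p • ((E.obj (smp σ)).d q₁ q).hom (α.ev q₁ (by omega) θ σ) := by
  cases p with
  | zero => rw [Sec.ev_D_zero hn α q q₁ h hq, Sec.hev, zero_add, pow_zero, one_smul]
  | succ p => rw [Sec.ev_D_succ hn α q q₁ h hq, Sec.hev]

section Leibniz

variable {E E' : Coeff k X} (P : CoeffPairing E E') {m m' n n' : ℤ}

/-- Simplicial contribution of the differential of the first factor. -/
def cupH₁ (hm : m + 1 = m') (a : Sec E m) (b : Sec E' n)
    {N : ℕ} (σ : Spx X N) (p : ℕ) (q : ℤ) (r : ℕ) (s : ℤ) (hp : (p : ℤ) + q = m')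
    (hr : (r : ℤ) + s = n) (h : p + r = N) (hN : (N : ℤ) = m' + n) : k :=
  sgn k (q * r) * (P.pair (smp σ)).toFun q s (by omega)
    (a.hev hm p q hp (front (by omega)) σ) (b.ev s hr (back (by omega)) σ)

/-- Simplicial contribution of the differential of the second factor. -/
def cupH₂ (hn : n + 1 = n') (a : Sec E m) (b : Sec E' n)
    {N : ℕ} (σ : Spx X N) (p : ℕ) (q : ℤ) (r : ℕ) (s : ℤ) (hp : (p : ℤ) + q = m)
    (hr : (r : ℤ) + s = n') (h : p + r = N) (hN : (N : ℤ) = m + n') : k :=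
  sgn k (q * r) * (P.pair (smp σ)).toFun q s (by omega)
    (a.ev q hp (front (by omega)) σ) (b.hev hn r s hr (back (by omega)) σ)

lemma cupH₁_congr (hm : m + 1 = m') (a : Sec E m) (b : Sec E' n)
    {N : ℕ} (σ : Spx X N) {p p₁ : ℕ} {q q₁ : ℤ} {r r₁ : ℕ} {s s₁ : ℤ}
    (ep : p = p₁) (eq : q = q₁) (er : r = r₁) (es : s = s₁) (hp : (p : ℤ) + q = m')
    (hr : (r : ℤ) + s = n) (h : p + r = N) (hN : (N : ℤ) = m' + n) :
    cupH₁ P hm a b σ p q r s hp hr h hN =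
      cupH₁ P hm a b σ p₁ q₁ r₁ s₁ (by omega) (by omega) (by omega) hN := by
  subst ep eq er es; rfl

lemma cupH₂_congr (hn : n + 1 = n') (a : Sec E m) (b : Sec E' n)
    {N : ℕ} (σ : Spx X N) {p p₁ : ℕ} {q q₁ : ℤ} {r r₁ : ℕ} {s s₁ : ℤ}
    (ep : p = p₁) (eq : q = q₁) (er : r = r₁) (es : s = s₁) (hp : (p : ℤ) + q = m)
    (hr : (r : ℤ) + s = n') (h : p + r = N) (hN : (N : ℤ) = m + n') :
    cupH₂ P hn a b σ p q r s hp hr h hN =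
      cupH₂ P hn a b σ p₁ q₁ r₁ s₁ (by omega) (by omega) (by omega) hN := by
  subst ep eq er es; rfl

lemma cupH₁_eq_zero (hm : m + 1 = m') (a : Sec E m) (b : Sec E' n) {N : ℕ} (σ : Spx X N) {p : ℕ}
    {q : ℤ} {r : ℕ} {s : ℤ} (ep : p = 0) (hp : (p : ℤ) + q = m')
    (hr : (r : ℤ) + s = n) (h : p + r = N) (hN : (N : ℤ) = m' + n) :
    cupH₁ P hm a b σ p q r s hp hr h hN = 0 := by
  subst ep; simp [cupH₁, Sec.hev]

lemma cupH₂_eq_zero (hn : n + 1 = n') (a : Sec E m) (b : Sec E' n) {N : ℕ} (σ : Spx X N) {p : ℕ}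
    {q : ℤ} {r : ℕ} {s : ℤ} (er : r = 0) (hp : (p : ℤ) + q = m)
    (hr : (r : ℤ) + s = n') (h : p + r = N) (hN : (N : ℤ) = m + n') :
    cupH₂ P hn a b σ p q r s hp hr h hN = 0 := by
  subst er; simp [cupH₂, Sec.hev]

lemma cup_vert (hm : m + 1 = m') (hn : n + 1 = n') (a : Sec E m) (b : Sec E' n)
    {N : ℕ} (σ : Spx X N) (p : ℕ) (q' : ℤ) (q : ℤ) (r : ℕ) (s s' : ℤ)
    (hp : (p : ℤ) + q' = m') (hr : (r : ℤ) + s = n) (hp' : (p : ℤ) + q = m)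
    (hr' : (r : ℤ) + s' = n') (h : p + r = N) (hN : (N : ℤ) = m' + n) :
    cupTerm P (a.D hm) b σ p q' r s hp hr h hN +
      sgn k m * cupTerm P a (b.D hn) σ p q r s' hp' hr' h (by omega) =
    cupH₁ P hm a b σ p q' r s hp hr h hN +
      sgn k m * cupH₂ P hn a b σ p q r s' hp' hr' h (by omega) := by
  have key := (P.pair (smp σ)).leibniz q q' s s' (by omega) (by omega) (by omega)
    (a.ev q hp' (front (by omega)) σ) (b.ev s hr (back (by omega)) σ)
  have e1 : sgn k (q' * r) = sgn k (q * r) * (-1) ^ r := by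
    rw [show q' = q + 1 by omega, add_mul, one_mul, sgn_add, sgn_natCast]
  have e2 : sgn k m = (-1) ^ p * sgn k q := by
    rw [← hp', sgn_add, sgn_natCast]
  simp only [cupTerm, cupH₁, cupH₂]
  rw [a.ev_D hm q' q hp (by omega), b.ev_D hn s' s hr' (by omega)]
  simp only [map_add, map_zsmul, LinearMap.add_apply, LinearMap.smul_apply, zsmul_eq_mul]
  rw [e1, e2]
  push_cast
  linear_combination (sgn k (q * r) * (-1) ^ r * (-1) ^ p) * key

lemma cup_hor (hm : m + 1 = m') (hn : n + 1 = n') (a : Sec E m) (b : Sec E' n)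
    {N : ℕ} (σ : Spx X (N + 1)) (p : ℕ) (q : ℤ) (r : ℕ) (s : ℤ)
    (hp : (p : ℤ) + q = m) (hr : (r : ℤ) + s = n) (h : p + r = N) (hN : (N : ℤ) = m + n) :
    ∑ i : Fin (N + 2), (-1 : k) ^ (i : ℕ) *
      cupTerm P a b (X.map (SimplexCategory.δ i).op σ : Spx X N) p q r s hp hr h hN =
    cupH₁ P hm a b σ (p + 1) q r s (by push_cast; omega) hr (by omega) (by push_cast; omega) +
      sgn k m * cupH₂ P hn a b σ p q (r + 1) s hp (by push_cast; omega) (by omega)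
        (by push_cast; omega) := by
  have key := cup_faces h (fun θ ψ => (P.pair (smp σ)).toFun q s (by omega)
    (a.ev q hp θ σ) (b.ev s hr ψ σ))
  have e1 : ∀ i : Fin (N + 2),
      cupTerm P a b (X.map (SimplexCategory.δ i).op σ : Spx X N) p q r s hp hr h hN =
        sgn k (q * r) * (P.pair (smp σ)).toFun q s (by omega)
          (a.ev q hp (front (by omega) ≫ SimplexCategory.δ i) σ)
          (b.ev s hr (back (by omega) ≫ SimplexCategory.δ i) σ) := fun i => by
    rw [cupTerm, ← P.natural (arrow (SimplexCategory.δ i) (σ := σ) rfl), Sec.map_ev, Sec.map_ev]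
  have e2 : sgn k m * sgn k (q * (r + 1 : ℕ)) = sgn k (q * r) * (-1) ^ p := by
    rw [← hp, sgn_add, sgn_natCast, Nat.cast_succ, mul_add, mul_one, sgn_add]
    linear_combination ((-1) ^ p * sgn k (q * r)) * sgn_mul_self (k := k) q
  simp only [e1, cupH₁, cupH₂, Sec.hev, map_sum, map_zsmul, LinearMap.sum_apply,
    LinearMap.smul_apply]
  rw [← mul_assoc, e2]
  simp only [zsmul_eq_mul] at key ⊢
  push_cast at key ⊢
  rw [mul_assoc, ← mul_add, ← key, Finset.mul_sum]
  exact Finset.sum_congr rfl fun i _ => by ring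

/-- The Leibniz rule for the cup product. -/
lemma cup_D (hm : m + 1 = m') (hn : n + 1 = n') (a : Sec E m) (b : Sec E' n)
    {l l' : ℤ} (h : m + n = l) (hl : l + 1 = l') :
    (cup P h a b).D hl =
      cup P (by omega) (a.D hm) b + sgn k m • cup P (by omega) a (b.D hn) := by
  refine funext fun ⟨N, hN⟩ => funext fun (σ : Spx X N) => ?_
  change (cup P h a b).D hl ⟨N, hN⟩ σ = cup P _ (a.D hm) b ⟨N, hN⟩ σ +
    sgn k m * cup P _ a (b.D hn) ⟨N, hN⟩ σ
  have e : cup P (by omega) (a.D hm) b ⟨N, hN⟩ σ +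
      sgn k m * cup P (by omega) a (b.D hn) ⟨N, hN⟩ σ =
      ∑ i : Fin (N + 1), cupH₁ P hm a b σ i (m' - i) (N - i : ℕ) (n - (N - i : ℕ))
        (by omega) (by omega) (by omega) (by omega) +
      sgn k m * ∑ i : Fin (N + 1), cupH₂ P hn a b σ i (m - i) (N - i : ℕ) (n' - (N - i : ℕ))
        (by omega) (by omega) (by omega) (by omega) := by
    simp only [cup]
    rw [Finset.mul_sum, Finset.mul_sum, ← Finset.sum_add_distrib, ← Finset.sum_add_distrib]
    exact Finset.sum_congr rfl fun i _ => cup_vert P hm hn a b σ i _ _ _ _ _ _ _ _ _ _ _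
  rw [e]
  cases N with
  | zero =>
    rw [Fin.sum_univ_one, Fin.sum_univ_one]
    rw [cupH₁_eq_zero P hm a b σ (p := ((0 : Fin (0 + 1)) : ℕ)) rfl,
      cupH₂_eq_zero P hn a b σ (p := ((0 : Fin (0 + 1)) : ℕ)) (by simp), mul_zero, add_zero]
    rfl
  | succ N =>
    rw [Fin.sum_univ_succ, Fin.sum_univ_castSucc (n := N + 1)]
    rw [cupH₁_eq_zero P hm a b σ (p := ((0 : Fin (N + 1 + 1)) : ℕ)) rfl,
      cupH₂_eq_zero P hn a b σ (p := Fin.last (N + 1)) (by simp),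
      zero_add, add_zero, Finset.mul_sum, ← Finset.sum_add_distrib]
    have hN' : (N : ℤ) = m + n := by push_cast at hN; omega
    have e3 : (cup P h a b).D hl ⟨N + 1, hN⟩ σ = ∑ j : Fin (N + 1), ∑ i : Fin (N + 2),
        (-1 : k) ^ (i : ℕ) * cupTerm P a b (X.map (SimplexCategory.δ i).op σ : Spx X N)
          j (m - j) (N - j : ℕ) (n - (N - j : ℕ)) (by omega) (by omega) (by omega) hN' := by
      rw [Finset.sum_comm]
      refine Finset.sum_congr rfl fun i _ => ?_
      rw [← Finset.mul_sum]
      rfl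
    rw [e3]
    refine Finset.sum_congr rfl fun j _ => ?_
    rw [cup_hor P hm hn a b σ j (m - j) (N - j : ℕ) (n - (N - j : ℕ)) (by omega) (by omega)
      (by omega) hN']
    congr 1
    · exact cupH₁_congr P hm a b σ rfl (by simp; omega) (by simp) (by simp) _ _ _ _
    · congr 1
      exact cupH₂_congr P hn a b σ rfl rfl (by simp; omega) (by simp; omega) _ _ _ _

end Leibniz


/-! ### Orientations -/

/-- The pairing `Γ(X, E) ⊗ Γ(X, E') ⟶ C^*(X, k) ⟶ k[-d]` defined by a fundamental class. -/
def FundClass.pairing {d : ℤ} (η : FundClass k X d) {E E' : Coeff k X} (P : CoeffPairing E E') :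
    Pairing (sections E) (sections E') d where
  toFun i j h := (cupLin P h).compr₂ η.ev
  leibniz i i' j j' hi hj h a b := by
    rw [sections_d E hi, sections_d E' hj]
    have key := η.ev_D (i + j) (by omega) (cup P rfl a b)
    rw [cup_D P hi hj a b rfl (by omega), map_add, map_smul] at key
    exact key

/-- `X` is `𝒪`-compact: derived global sections commute with direct sums of locally constant
coefficients (that is, the unit is a compact object) and preserve perfect complexes. -/
def IsOCompact (k : Type u) [Field k] (X : SSet.{u}) : Prop :=
  (∀ (ι : Type u) (E : ι → Coeff k X), (∀ i, (E i).IsLocallyConstant) →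
    QuasiIso (Sigma.desc fun i => (sectionsFunctor k X).map (Sigma.ι E i))) ∧
  ∀ E : Coeff k X, E.IsPerfect → IsPerfectCpx (sections E)

/-- A fundamental class of degree `d` on `X` is a `d`-orientation when `X` is `𝒪`-compact and, for
every perfect `E` with dual `E'`, the pairing `Γ(X, E) ⊗ Γ(X, E') ⟶ k[-d]` is non-degenerate,
i.e. the induced map `Γ(X, E') ⟶ Γ(X, E)^∨[-d]` is a quasi-isomorphism. -/
def FundClass.IsOrientation {d : ℤ} (η : FundClass k X d) : Prop :=
  IsOCompact k X ∧ ∀ (E E' : Coeff k X) (P : CoeffPairing E E'), P.IsDual →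
    QuasiIso (η.pairing P).toDual

/-- A boundary structure on `f : X ⟶ Y`: a path from `f_* η` to `0` in the mapping space
`Map(C^*(Y, k), k[-d])`, that is, a null-homotopy of the morphism of complexes `f_* η`. -/
structure BoundaryStructure {d : ℤ} (f : X ⟶ Y) (η : FundClass k X d) where
  /-- the null-homotopy -/
  path : Coch k Y (d + 1) →ₗ[k] k
  path_D : ∀ c : Coch k Y d, path (c.D rfl) = (η.push f).ev c

/-- The pairing `Γ(Y, E) ⊗ Γ(X, f^* E') ⟶ k[-d]` given by restricting the first factor to `X`. -/
def FundClass.relPairing {d : ℤ} (η : FundClass k X d) (f : X ⟶ Y) {E E' : Coeff k Y}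
    (P : CoeffPairing E E') : Pairing (sections E) (sections (E'.pullback f)) d :=
  (η.pairing (P.pullback f)).comapLeft (sectionsPullback f E)

/-- `Γ(Y, E)^⊥`, the homotopy fibre of `Γ(X, f^* E') ⟶ Γ(Y, E)^∨[-d]`. -/
def FundClass.perp {d : ℤ} (η : FundClass k X d) (f : X ⟶ Y) {E E' : Coeff k Y}
    (P : CoeffPairing E E') : Cpx k :=
  CochainComplex.mappingCocone (η.relPairing f P).toDual

namespace BoundaryStructure

open CochainComplex.HomComplex

variable {d : ℤ} {f : X ⟶ Y} {η : FundClass k X d} (γ : BoundaryStructure f η)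

/-- The null-homotopy of `Γ(Y, E') ⟶ Γ(X, f^* E') ⟶ Γ(Y, E)^∨[-d]` induced by a boundary
structure: up to sign, it sends `b` to `a ↦ γ (a ∪ b)`. -/
def nullHomotopy {E E' : Coeff k Y} (P : CoeffPairing E E') :
    Cochain (sections E') (dualShift (sections E) d) (-1) :=
  Cochain.mk fun p q hpq => ModuleCat.ofHom
    (sgn k (d - p) • ((cupLin P (by omega : (d - q) + p = d + 1)).compr₂ γ.path).flip)

lemma δ_nullHomotopy {E E' : Coeff k Y} (P : CoeffPairing E E') :
    δ (-1) 0 (γ.nullHomotopy P) +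
      Cochain.ofHom (sectionsPullback f E' ≫ (η.relPairing f P).toDual) = 0 := by
  refine Cochain.ext₀ _ _ fun p => ModuleCat.hom_ext (LinearMap.ext fun (b : Sec E' p) =>
    LinearMap.ext fun (a : Sec E (d - p)) => ?_)
  rw [Cochain.add_v, δ_v (-1) 0 (by omega) _ p p _ (p - 1) (p + 1) rfl rfl]
  have hp : p + 1 = p + 1 := rfl
  have key := γ.path_D (cup P (by omega : (d - p) + p = d) a b)
  rw [cup_D P (by omega : (d - p) + 1 = d - (p - 1)) hp a b (by omega) rfl, map_add, map_smul]
    at key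
  have key2 : (η.push f).ev (cup P (by omega : (d - p) + p = d) a b) =
      η.ev (cup (P.pullback f) (by omega : (d - p) + p = d) (Sec.pull f a) (Sec.pull f b)) := by
    rw [cup_pull]; rfl
  rw [key2] at key
  let ap : (dualShift (sections E) d).X p → k := fun φ => (show Sec E (d - p) →ₗ[k] k from φ) a
  have t1 : ap (((γ.nullHomotopy P).v p (p - 1) (by omega) ≫
      (dualShift (sections E) d).d (p - 1) p).hom b) =
      sgn k (d - (p - 1)) * (sgn k (d - p) *
        γ.path (cup P (by omega) (Sec.D (by omega : (d - p) + 1 = d - (p - 1)) a) b)) := by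
    change sgn k (d - (p - 1)) * (sgn k (d - p) *
      γ.path (cup P (by omega) (((sections E).d (d - p) (d - (p - 1))).hom a) b)) = _
    rw [sections_d E (by omega)]
    rfl
  have t2 : ap (((sections E').d p (p + 1) ≫ (γ.nullHomotopy P).v (p + 1) p (by omega)).hom b) =
      sgn k (d - (p + 1)) * γ.path (cup P (by omega) a (Sec.D hp b)) := by
    change sgn k (d - (p + 1)) * γ.path (cup P (by omega) a (((sections E').d p (p + 1)).hom b)) = _
    rw [sections_d E' rfl]
    rfl
  simp only [Int.negOnePow_zero, one_smul]
  change ap (((γ.nullHomotopy P).v p (p - 1) (by omega) ≫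
      (dualShift (sections E) d).d (p - 1) p).hom b) +
    ap (((sections E').d p (p + 1) ≫ (γ.nullHomotopy P).v (p + 1) p (by omega)).hom b) +
      η.ev (cup (P.pullback f) (by omega : (d - p) + p = d) (Sec.pull f a) (Sec.pull f b)) = 0
  rw [t1, t2, ← key, smul_eq_mul]
  have e1 : sgn k (d - (p - 1)) = - sgn k (d - p) := by rw [← sgn_succ]; congr 1; omega
  have e2 : sgn k (d - p) = - sgn k (d - (p + 1)) := by rw [← sgn_succ]; congr 1; omega
  have e3 := sgn_mul_self (k := k) (d - p)
  rw [e1, show sgn k (d - (p + 1)) = - sgn k (d - p) by rw [e2, neg_neg]]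
  linear_combination (-γ.path (cup P (by omega)
    (Sec.D (by omega : (d - p) + 1 = d - (p - 1)) a) b)) * e3

/-- The morphism `Γ(Y, E') ⟶ Γ(Y, E)^⊥` induced by a boundary structure. -/
def toPerp {E E' : Coeff k Y} (P : CoeffPairing E E') : sections E' ⟶ η.perp f P :=
  CochainComplex.mappingCocone.lift _ (sectionsPullback f E') (γ.nullHomotopy P)
    (γ.δ_nullHomotopy P)

/-- A boundary structure on `f : X ⟶ Y` is non-degenerate when `Γ(Y, E') ⟶ Γ(Y, E)^⊥` is a
quasi-isomorphism for every perfect `E` on `Y` with dual `E'`. -/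
def IsNondegenerate : Prop :=
  ∀ (E E' : Coeff k Y) (P : CoeffPairing E E'), P.IsDual → QuasiIso (γ.toPerp P)

/-- A relative `d`-orientation on `f : X ⟶ Y`: the fundamental class of `X` is a
`d`-orientation and the boundary structure is non-degenerate. -/
def IsRelativeOrientation : Prop :=
  η.IsOrientation ∧ γ.IsNondegenerate

end BoundaryStructure

/-! ### Homotopy pushouts and the glued boundary structure -/

/-- The cylinder `Y × Δ¹`. -/
abbrev cyl (Y : SSet.{u}) : SSet.{u} := Y ⊗ SSet.stdSimplex.obj ⦋1⦌

/-- The tautological homotopy between the two ends of the cylinder. -/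
def cylHomotopy (Y : SSet.{u}) : SSet.Homotopy (SSet.ι₀ : Y ⟶ cyl Y) SSet.ι₁ where
  h := 𝟙 _
  rel := by
    ext n ⟨⟨x, hx⟩, t⟩ <;> exact hx.elim

/-- The homotopy pushout `F ⊔ʰ_Y G` (double mapping cylinder). -/
def hPushout {Y F G : SSet.{u}} (u : Y ⟶ F) (v : Y ⟶ G) : SSet.{u} :=
  pushout (coprod.map u v) (coprod.desc (SSet.ι₀ : Y ⟶ cyl Y) SSet.ι₁)

/-- The prism operator `C^{n+1}(Y × Δ¹, k) ⟶ C^n(Y, k)`. -/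
def prism {Y : SSet.{u}} {n n' : ℤ} (hn : n + 1 = n') (c : Coch k (cyl Y) n') : Coch k Y n :=
  fun t y => ∑ i : Fin (t.1 + 1), (-1 : k) ^ (i : ℕ) *
    c ⟨t.1 + 1, by have := t.2; push_cast; omega⟩
      ((cylHomotopy Y).toSimplicialObjectHomotopy.h i y)

/-- Evaluation of the linear extension of `c` at the image of the simplex `y`. -/
def evalHom {A B : Type u} (c : B → k) (y : A) :
    ((ModuleCat.free k).obj A ⟶ (ModuleCat.free k).obj B) →+ k where
  toFun φ := Finsupp.linearCombination k c (φ.hom (Finsupp.single y (1 : k)))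
  map_zero' := map_zero (Finsupp.linearCombination k c)
  map_add' φ ψ := map_add (Finsupp.linearCombination k c) (φ.hom (Finsupp.single y (1 : k)))
    (ψ.hom (Finsupp.single y (1 : k)))

lemma evalHom_map {A B : Type u} (c : B → k) (y : A) (θ : A ⟶ B) :
    evalHom c y ((ModuleCat.free k).map θ) = c (θ y) := by
  change Finsupp.linearCombination k c (Finsupp.mapDomain θ (Finsupp.single y (1 : k))) = _
  rw [Finsupp.mapDomain_single, Finsupp.linearCombination_single, one_smul]

lemma evalHom_comp {A B C : Type u} (c : C → k) (y : A) (θ : A ⟶ B) (θ' : B ⟶ C) (m n : ℤ) :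
    evalHom c y ((m • (ModuleCat.free k).map θ) ≫ (n • (ModuleCat.free k).map θ')) =
      m * (n * c (θ' (θ y))) := by
  rw [Preadditive.zsmul_comp, Preadditive.comp_zsmul, ← Functor.map_comp, map_zsmul, map_zsmul,
    evalHom_map, zsmul_eq_mul, zsmul_eq_mul]
  rfl

/-- The prism identity in positive degrees. -/
lemma prism_succ {Z W : SSet.{u}} {f g : Z ⟶ W} (H : SimplicialObject.Homotopy f g) (N : ℕ)
    (c : Spx W (N + 1) → k) (y : Spx Z (N + 1)) :
    c (f.app _ y) - c (g.app _ y) =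
      -(∑ x : Fin (N + 1), ∑ j : Fin (N + 2), (-1 : k) ^ (j : ℕ) * ((-1 : k) ^ (x : ℕ) *
          c (H.h x (Z.map (SimplexCategory.δ j).op y)))) -
        ∑ x : Fin (N + 3), ∑ j : Fin (N + 2), (-1 : k) ^ (j : ℕ) * ((-1 : k) ^ (x : ℕ) *
          c (W.map (SimplexCategory.δ x).op (H.h j y))) := by
  have key := (H.whiskerRight (ModuleCat.free k)).toChainHomotopy.comm (N + 1)
  rw [dNext_eq (i' := N) (w := by simp), prevD_eq (j' := N + 2) (w := by simp)] at key
  simp [SimplicialObject.Homotopy.toChainHomotopy,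
    AlgebraicTopology.AlternatingFaceMapComplex.objD, Preadditive.sum_comp,
    Preadditive.comp_sum] at key
  have key1 : (ModuleCat.free k).map (f.app (op ⦋N + 1⦌)) =
      -(∑ x : Fin (N + 1), ∑ j : Fin (N + 2), ((-1 : ℤ) ^ (j : ℕ) • (ModuleCat.free k).map (Z.δ j)) ≫
        ((-1 : ℤ) ^ (x : ℕ) • (ModuleCat.free k).map (H.h x))) +
      -(∑ x : Fin (N + 3), ∑ j : Fin (N + 2), ((-1 : ℤ) ^ (j : ℕ) • (ModuleCat.free k).map (H.h j)) ≫
        ((-1 : ℤ) ^ (x : ℕ) • (ModuleCat.free k).map (W.δ x))) +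
      (ModuleCat.free k).map (g.app (op ⦋N + 1⦌)) := key
  have key2 := congrArg (evalHom (k := k) c y) key1
  simp only [map_add, map_neg, map_sum, evalHom_comp, evalHom_map] at key2
  rw [key2]
  change _ = -(∑ x : Fin (N + 1), ∑ j : Fin (N + 2), (-1 : k) ^ (j : ℕ) * ((-1 : k) ^ (x : ℕ) *
      c (H.h x (Z.δ j y)))) - ∑ x : Fin (N + 3), ∑ j : Fin (N + 2), (-1 : k) ^ (j : ℕ) *
        ((-1 : k) ^ (x : ℕ) * c (W.δ x (H.h j y)))
  rw [add_sub_cancel_right, sub_eq_add_neg]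
  push_cast
  rfl

/-- The prism identity in degree zero. -/
lemma prism_zero {Z W : SSet.{u}} {f g : Z ⟶ W} (H : SimplicialObject.Homotopy f g)
    (c : Spx W 0 → k) (y : Spx Z 0) :
    c (f.app _ y) - c (g.app _ y) =
      -∑ x : Fin 2, (-1 : k) ^ (x : ℕ) * c (W.map (SimplexCategory.δ x).op (H.h 0 y)) := by
  have h0 := congrArg (fun φ : Z.obj (op ⦋0⦌) ⟶ W.obj (op ⦋0⦌) => φ y) (H.h_zero_comp_δ_zero 0)
  have h1 := congrArg (fun φ : Z.obj (op ⦋0⦌) ⟶ W.obj (op ⦋0⦌) => φ y) (H.h_last_comp_δ_last 0)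
  have h0' : W.map (SimplexCategory.δ 0).op (H.h 0 y) = g.app _ y := h0
  have h1' : W.map (SimplexCategory.δ 1).op (H.h 0 y) = f.app _ y := h1
  rw [Fin.sum_univ_two, h0', h1']
  simp [sub_eq_add_neg]

/-- The prism operator is a homotopy between the restrictions to the two ends of the cylinder. -/
lemma prism_homotopy {Y : SSet.{u}} {n n' m : ℤ} (hn : n + 1 = n') (hm : m + 1 = n)
    (c : Coch k (cyl Y) n) :
    c.pull SSet.ι₀ - c.pull SSet.ι₁ =
      -(prism hm c).D hm - prism hn (c.D hn) := by
  refine funext fun ⟨N, hN⟩ => funext fun (y : Spx Y N) => ?_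
  cases N with
  | zero =>
    have key := prism_zero (cylHomotopy Y).toSimplicialObjectHomotopy (c ⟨0, hN⟩) y
    refine key.trans ?_
    change _ = -(0 : k) - ∑ i : Fin (0 + 1), (-1 : k) ^ (i : ℕ) *
      ∑ x : Fin 2, (-1 : k) ^ (x : ℕ) * c ⟨0, hN⟩ _
    simp
  | succ N =>
    have key := prism_succ (cylHomotopy Y).toSimplicialObjectHomotopy N (c ⟨N + 1, hN⟩) y
    refine key.trans ?_
    change _ = -(∑ j : Fin (N + 2), (-1 : k) ^ (j : ℕ) *
        ∑ x : Fin (N + 1), (-1 : k) ^ (x : ℕ) * c ⟨N + 1, hN⟩ _) -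
      ∑ j : Fin (N + 1 + 1), (-1 : k) ^ (j : ℕ) *
        ∑ x : Fin (N + 3), (-1 : k) ^ (x : ℕ) * c ⟨N + 1, hN⟩ _
    simp only [Finset.mul_sum]
    congr 1
    · rw [Finset.sum_comm]
    · rw [Finset.sum_comm]

lemma FundClass.ev_prism {d d' m : ℤ} (η : FundClass k Y d) (hd : d + 1 = d') (hm : m + 1 = d)
    (c : Coch k (cyl Y) d) :
    η.ev (prism hd (c.D hd)) = η.ev (c.pull SSet.ι₁) - η.ev (c.pull SSet.ι₀) := by
  have key := congrArg η.ev (prism_homotopy hd hm c)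
  simp only [map_sub, map_neg, η.ev_D m hm] at key
  linear_combination key

/-- The prism operator as a linear map. -/
def prismLin (k : Type u) [Field k] (Y : SSet.{u}) {n n' : ℤ} (hn : n + 1 = n') :
    Coch k (cyl Y) n' →ₗ[k] Coch k Y n where
  toFun c := prism hn c
  map_add' c c' := by
    funext t y
    exact (Finset.sum_congr rfl fun i _ => mul_add _ _ _).trans Finset.sum_add_distrib
  map_smul' a c := by
    funext t y
    exact (Finset.sum_congr rfl fun i _ => mul_left_comm _ _ _).trans (Finset.mul_sum ..).symm

section Glue

variable {F G Z : SSet.{u}} (f : X ⨿ Y ⟶ F) (g : Y ⨿ Z ⟶ G)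

/-- The homotopy pushout `T = F ⊔ʰ_Y G` of two cospans `X ⟶ F ⟵ Y` and `Y ⟶ G ⟵ Z`. -/
abbrev cospanComp : SSet.{u} := hPushout (coprod.inr ≫ f) (coprod.inl ≫ g)

/-- The canonical map `F ⟶ T`. -/
def toCompLeft : F ⟶ cospanComp f g := coprod.inl ≫ pushout.inl _ _

/-- The canonical map `G ⟶ T`. -/
def toCompRight : G ⟶ cospanComp f g := coprod.inr ≫ pushout.inl _ _

/-- The canonical homotopy `Y × Δ¹ ⟶ T`. -/
def cylToComp : cyl Y ⟶ cospanComp f g := pushout.inr _ _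

lemma ι₀_cylToComp : SSet.ι₀ ≫ cylToComp f g = coprod.inr ≫ f ≫ toCompLeft f g := by
  have h := congrArg (fun φ => coprod.inl ≫ φ)
    (pushout.condition (f := coprod.map (coprod.inr ≫ f) (coprod.inl ≫ g))
      (g := coprod.desc (SSet.ι₀ : Y ⟶ cyl Y) SSet.ι₁))
  simp only [coprod.inl_map_assoc, coprod.inl_desc_assoc, Category.assoc] at h
  exact h.symm

lemma ι₁_cylToComp : SSet.ι₁ ≫ cylToComp f g = coprod.inl ≫ g ≫ toCompRight f g := by
  have h := congrArg (fun φ => coprod.inr ≫ φ)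
    (pushout.condition (f := coprod.map (coprod.inr ≫ f) (coprod.inl ≫ g))
      (g := coprod.desc (SSet.ι₀ : Y ⟶ cyl Y) SSet.ι₁))
  simp only [coprod.inr_map_assoc, coprod.inr_desc_assoc, Category.assoc] at h
  exact h.symm

/-- The map `t : X ⊔ Z ⟶ T`. -/
def compMap : X ⨿ Z ⟶ cospanComp f g :=
  coprod.desc (coprod.inl ≫ f ≫ toCompLeft f g) (coprod.inr ≫ g ≫ toCompRight f g)

variable {f g} {d : ℤ} {ηX : FundClass k X d} {ηY : FundClass k Y d} {ηZ : FundClass k Z d}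

lemma Coch.pull_pull {U V W : SSet.{u}} (f : U ⟶ V) (g : V ⟶ W) {n : ℤ} (c : Coch k W n) :
    (c.pull g).pull f = c.pull (f ≫ g) := rfl

lemma FundClass.disjUnion_neg_ev {U V W : SSet.{u}} (θ : FundClass k U d) (θ' : FundClass k V d)
    (h : U ⨿ V ⟶ W) (c : Coch k W d) :
    ((θ.disjUnion θ'.neg).push h).ev c =
      θ.ev (c.pull (coprod.inl ≫ h)) - θ'.ev (c.pull (coprod.inr ≫ h)) :=
  (sub_eq_add_neg _ _).symm

/-- The boundary structure on `t : X ⊔ Z̄ ⟶ T` obtained by composing the path from `[X]` to `[Y]`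
in `F`, the tautological path between the two images of `[Y]` along the cylinder, and the path
from `[Y]` to `[Z]` in `G`. -/
def BoundaryStructure.glue (φ : BoundaryStructure f (ηX.disjUnion ηY.neg))
    (ψ : BoundaryStructure g (ηY.disjUnion ηZ.neg)) :
    BoundaryStructure (compMap f g) (ηX.disjUnion ηZ.neg) where
  path := φ.path ∘ₗ Coch.pullLin k (toCompLeft f g) (d + 1) +
    ψ.path ∘ₗ Coch.pullLin k (toCompRight f g) (d + 1) -
      ηY.ev ∘ₗ prismLin k Y rfl ∘ₗ Coch.pullLin k (cylToComp f g) (d + 1)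
  path_D c := by
    change φ.path ((c.D rfl).pull (toCompLeft f g)) + ψ.path ((c.D rfl).pull (toCompRight f g)) -
      ηY.ev (prism rfl ((c.D rfl).pull (cylToComp f g))) = _
    rw [Coch.pull_D, Coch.pull_D, Coch.pull_D, φ.path_D, ψ.path_D,
      ηY.ev_prism rfl (sub_add_cancel d 1)]
    simp only [FundClass.disjUnion_neg_ev, Coch.pull_pull, ι₀_cylToComp, ι₁_cylToComp,
      Category.assoc, compMap, coprod.inl_desc, coprod.inr_desc]
    ring

end Glue


end Sections

end OrientedCospan

end

/-! For a perfect `E` with dual `E'`, a boundary structure on `U → V` is non-degenerate exactly when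
the total complex of `Γ(V, E') → Γ(U, E') → Γ(V, E)^∨[-d]` is acyclic; the null-homotopy is what
makes this a complex up to homotopy. Everything is done with this acyclicity, written in elements as
`RelDatum.IsExact`; `BoundaryStructure.quasiIso_toPerp_iff` makes the translation. When the boundary
is a disjoint union, the middle term is a product and its pairing a difference of two pairings.

The double mapping cylinder `T` is cut into `F`, `G` and `C = Y × Δ¹`. Cochains on `T` are the
strict fibre product of the cochains on the three pieces over the two copies of `Y`, and restriction
from `C` to its two ends is surjective. So there is a Mayer–Vietoris sequence, and
`RelDatum.IsExact.glue` turns exactness for the three pieces into exactness for `T`: the perfect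
pairings on the two copies of `Y` cancel the interface terms against their duals. The pieces `F` and
`G` are exact by hypothesis.

The cylinder is exact (`isExact_cylinder`) because restriction to either end is surjective with
acyclic kernel: `E` is compared with one end and `E'` with the other, and what remains is duality on
`Y`. Acyclicity of these kernels is homotopy invariance of cochains in a local system of complexes
(`Deformation.exists_primitive`). It is proved by the filtration by simplicial degree: the
cohomology of the coefficients is a local system of vector spaces, for which the prism operator
gives a contraction, and the successive corrections can be summed because total cochains are
products over bidegrees.

For 𝒪-compactness, perfectness of `Γ(T, E)` follows from the Mayer–Vietoris short exact sequence.
Commutation with direct sums is first rewritten as a statement about locally finite families of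
cochains (`AlmostExact`), which is then glued by the same argument. The same two facts for a
disjoint union give the orientation of `X ⊔ Z̄`. -/

noncomputable section

namespace OrientedCospan

/-! ### Cohomology classes and quasi-isomorphisms in terms of elements. -/

section HomologyClasses

variable {k : Type u} [Field k]

lemma hom_apply_eq {M N : ModuleCat.{u} k} {f g : M ⟶ N} (h : f = g) (x : M) :
    f.hom x = g.hom x := by rw [h]

lemma comm_apply {A B : Cpx k} (φ : A ⟶ B) (i j : ℤ) (x : A.X i) :
    (B.d i j).hom ((φ.f i).hom x) = (φ.f j).hom ((A.d i j).hom x) :=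
  hom_apply_eq (φ.comm i j) x

lemma d_d_apply (A : Cpx k) (i j l : ℤ) (x : A.X i) : (A.d j l).hom ((A.d i j).hom x) = 0 :=
  hom_apply_eq (A.d_comp_d i j l) x

/-- The inclusion of the submodule of cocycles, as a morphism to the object of cycles. -/
def toCyclesObj (A : Cpx k) {n n₁ : ℤ} (h : n + 1 = n₁) :
    ModuleCat.of k (LinearMap.ker (A.d n n₁).hom) ⟶ A.cycles n :=
  A.liftCycles (ModuleCat.ofHom (LinearMap.ker (A.d n n₁).hom).subtype) n₁
    ((CochainComplex.next ℤ n).trans h) (ModuleCat.hom_ext (LinearMap.ext fun x => x.2))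

lemma iCycles_toCyclesObj (A : Cpx k) {n n₁ : ℤ} (h : n + 1 = n₁)
    (x : LinearMap.ker (A.d n n₁).hom) : (A.iCycles n).hom ((toCyclesObj A h).hom x) = x :=
  hom_apply_eq (A.liftCycles_i (ModuleCat.ofHom (LinearMap.ker (A.d n n₁).hom).subtype) n₁
    ((CochainComplex.next ℤ n).trans h) (ModuleCat.hom_ext (LinearMap.ext fun x => x.2))) x

lemma iCycles_injective (A : Cpx k) (n : ℤ) : Function.Injective (A.iCycles n).hom :=
  (ModuleCat.mono_iff_injective (A.iCycles n)).1 inferInstance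

/-- The class in cohomology of a cocycle. -/
def cls (A : Cpx k) {n n₁ : ℤ} (h : n + 1 = n₁) :
    LinearMap.ker (A.d n n₁).hom →ₗ[k] A.homology n :=
  (toCyclesObj A h ≫ A.homologyπ n).hom

lemma cls_surjective (A : Cpx k) {n n₁ : ℤ} (h : n + 1 = n₁) :
    Function.Surjective (cls A h) := by
  intro y
  obtain ⟨z, rfl⟩ := (ModuleCat.epi_iff_surjective (A.homologyπ n)).1 inferInstance y
  have hz : (A.d n n₁).hom ((A.iCycles n).hom z) = 0 := hom_apply_eq (A.iCycles_d n n₁) z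
  exact ⟨⟨_, hz⟩, congrArg (A.homologyπ n).hom
    (iCycles_injective A n (iCycles_toCyclesObj A h ⟨_, hz⟩))⟩

lemma cls_eq_zero_iff (A : Cpx k) {n₀ n n₁ : ℤ} (h₀ : n₀ + 1 = n) (h : n + 1 = n₁)
    (x : LinearMap.ker (A.d n n₁).hom) :
    cls A h x = 0 ↔ ∃ y, (A.d n₀ n).hom y = (x : A.X n) := by
  have hex : (ShortComplex.mk (A.toCycles n₀ n) (A.homologyπ n) (by simp)).Exact :=
    ShortComplex.exact_of_g_is_cokernel _
      (A.homologyIsCokernel n₀ n ((CochainComplex.prev ℤ n).trans (by omega)))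
  rw [ShortComplex.moduleCat_exact_iff] at hex
  have ht : ∀ y, (A.iCycles n).hom ((A.toCycles n₀ n).hom y) = (A.d n₀ n).hom y := fun y =>
    hom_apply_eq (A.toCycles_i n₀ n) y
  constructor
  · intro hx
    obtain ⟨y, hy⟩ := hex _ hx
    exact ⟨y, by rw [← ht, ← iCycles_toCyclesObj A h x]; exact congrArg _ hy⟩
  · rintro ⟨y, hy⟩
    have : (toCyclesObj A h).hom x = (A.toCycles n₀ n).hom y :=
      iCycles_injective A n ((iCycles_toCyclesObj A h x).trans (hy.symm.trans (ht y).symm))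
    exact (congrArg (A.homologyπ n).hom this).trans
      (hom_apply_eq (A.toCycles_comp_homologyπ n₀ n) y)

/-- The image of a cocycle under a morphism of complexes. -/
def mapKer {A B : Cpx k} (φ : A ⟶ B) {n n₁ : ℤ}
    (x : LinearMap.ker (A.d n n₁).hom) : LinearMap.ker (B.d n n₁).hom :=
  ⟨(φ.f n).hom x, (comm_apply φ n n₁ x).trans
    ((congrArg (φ.f n₁).hom x.2).trans (map_zero _))⟩

lemma homologyMap_cls {A B : Cpx k} (φ : A ⟶ B) {n n₁ : ℤ} (h : n + 1 = n₁)
    (x : LinearMap.ker (A.d n n₁).hom) :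
    (HomologicalComplex.homologyMap φ n).hom (cls A h x) = cls B h (mapKer φ x) := by
  refine (hom_apply_eq (HomologicalComplex.homologyπ_naturality φ n) _).trans ?_
  refine congrArg (B.homologyπ n).hom (iCycles_injective B n ?_)
  refine Eq.trans ?_ (iCycles_toCyclesObj B h (mapKer φ x)).symm
  refine (hom_apply_eq (HomologicalComplex.cyclesMap_i φ n) _).trans ?_
  exact congrArg (φ.f n).hom (iCycles_toCyclesObj A h x)

/-- Elementwise form of the acyclicity of the mapping cone. -/
def ElemQuasiIso {A K : Cpx k} (φ : A ⟶ K) : Prop :=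
  ∀ (n₀ n n₁ : ℤ), n₀ + 1 = n → n + 1 = n₁ → ∀ (a : A.X n₁) (x : K.X n),
    (∀ n₂, (A.d n₁ n₂).hom a = 0) → (φ.f n₁).hom a = (K.d n n₁).hom x →
    ∃ (a' : A.X n) (x' : K.X n₀), (A.d n n₁).hom a' = a ∧
      (K.d n₀ n).hom x' = (φ.f n).hom a' - x

/-- With `a = 0` the condition is surjectivity on cohomology, and the existence of `a'` alone is
injectivity. Conversely injectivity gives a primitive of `a`, and surjectivity gives the cocycle by
which this primitive must be corrected to match `x`. -/
lemma quasiIso_iff_elem {A K : Cpx k} (φ : A ⟶ K) : QuasiIso φ ↔ ElemQuasiIso φ := by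
  constructor
  · intro hφ n₀ n n₁ h₀ h₁ a x ha hx
    have bij : ∀ n, Function.Bijective (HomologicalComplex.homologyMap φ n).hom := fun n =>
      (ConcreteCategory.isIso_iff_bijective _).1 inferInstance
    let az : LinearMap.ker (A.d n₁ (n₁ + 1)).hom := ⟨a, ha _⟩
    have h1 : cls A rfl az = 0 := by
      apply (bij n₁).1
      rw [homologyMap_cls, map_zero, cls_eq_zero_iff K h₁ rfl]
      exact ⟨x, hx.symm⟩
    obtain ⟨a₁, ha₁⟩ := (cls_eq_zero_iff A h₁ rfl az).1 h1
    have hcl : (K.d n n₁).hom ((φ.f n).hom a₁ - x) = 0 := by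
      rw [map_sub, ← hx, ← show (A.d n n₁).hom a₁ = a from ha₁, sub_eq_zero]
      exact congrArg (fun f => f.hom a₁) (φ.comm n n₁)
    obtain ⟨y, hy⟩ := (bij n).2 (cls K h₁ ⟨_, hcl⟩)
    obtain ⟨a₂, rfl⟩ := cls_surjective A h₁ y
    rw [homologyMap_cls, ← sub_eq_zero, ← map_sub, cls_eq_zero_iff K h₀ h₁] at hy
    obtain ⟨x', hx'⟩ := hy
    refine ⟨a₁ - a₂, -x', ?_, ?_⟩
    · rw [map_sub, show (A.d n n₁).hom (a₂ : A.X n) = 0 from a₂.2, sub_zero]; exact ha₁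
    · rw [map_neg, hx', map_sub]
      change -((φ.f n).hom (a₂ : A.X n) - ((φ.f n).hom a₁ - x)) = _
      abel
  · intro H
    rw [quasiIso_iff]
    intro n
    rw [quasiIsoAt_iff_isIso_homologyMap, ConcreteCategory.isIso_iff_bijective]
    constructor
    · refine (injective_iff_map_eq_zero (HomologicalComplex.homologyMap φ n).hom).2 fun y hy => ?_
      obtain ⟨a, rfl⟩ := cls_surjective A rfl y
      rw [homologyMap_cls, cls_eq_zero_iff K (sub_add_cancel n 1) rfl] at hy
      obtain ⟨x, hx⟩ := hy
      obtain ⟨a', -, ha', -⟩ := H (n - 1 - 1) (n - 1) n (by omega) (by omega) a x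
        (fun n₂ => by
          by_cases h : n + 1 = n₂
          · subst h; exact a.2
          · rw [A.shape _ _ h]; rfl) hx.symm
      exact (cls_eq_zero_iff A (sub_add_cancel n 1) rfl a).2 ⟨a', ha'⟩
    · intro y
      obtain ⟨x, rfl⟩ := cls_surjective K rfl y
      obtain ⟨a', x', ha', hx'⟩ := H (n - 1) n (n + 1) (by omega) rfl 0 x (by simp)
        (by rw [map_zero]; exact x.2.symm)
      refine ⟨cls A rfl ⟨a', ha'⟩, ?_⟩
      refine (homologyMap_cls φ rfl ⟨a', ha'⟩).trans ?_
      rw [← sub_eq_zero, ← map_sub, cls_eq_zero_iff K (sub_add_cancel n 1) rfl]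
      exact ⟨x', hx'⟩

end HomologyClasses

/-! ### Pairings, shifted duals and their exactness. -/

section Duality

variable {k : Type u} [Field k]

/-- Over a field a functional on the range of `f` extends to `W`. Exactness of dualising enters the
later arguments in this form. -/
lemma exists_factor {V W : Type*} [AddCommGroup V] [Module k V] [AddCommGroup W] [Module k W]
    (f : V →ₗ[k] W) (c : V →ₗ[k] k) (h : ∀ v, f v = 0 → c v = 0) :
    ∃ c' : W →ₗ[k] k, ∀ v, c v = c' (f v) := by
  have : c ∈ LinearMap.range f.dualMap := by
    rw [LinearMap.range_dualMap_eq_dualAnnihilator_ker, Submodule.mem_dualAnnihilator]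
    exact h
  obtain ⟨c', rfl⟩ := this
  exact ⟨c', fun _ => rfl⟩

/-- The product of two complexes, with explicit components. -/
def prodCpx (A B : Cpx k) : Cpx k where
  X n := ModuleCat.of k (A.X n × B.X n)
  d n n' := ModuleCat.ofHom (LinearMap.prodMap (A.d n n').hom (B.d n n').hom)
  shape n n' h := by rw [A.shape n n' h, B.shape n n' h]; rfl
  d_comp_d' i j l _ _ := ModuleCat.hom_ext (LinearMap.ext fun (x : A.X i × B.X i) =>
    Prod.ext (d_d_apply A i j l x.1) (d_d_apply B i j l x.2))

/-- The morphism to a product with given components. -/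
def prodLift {A B C : Cpx k} (φ : C ⟶ A) (ψ : C ⟶ B) : C ⟶ prodCpx A B where
  f n := ModuleCat.ofHom (LinearMap.prod (φ.f n).hom (ψ.f n).hom)
  comm' i j _ := ModuleCat.hom_ext (LinearMap.ext fun x =>
    Prod.ext (comm_apply φ i j x) (comm_apply ψ i j x))

/-- The difference of two pairings, on a product. -/
def Pairing.prodSub {A A' B B' : Cpx k} {d : ℤ} (R : Pairing A A' d) (S : Pairing B B' d) :
    Pairing (prodCpx A B) (prodCpx A' B') d where
  toFun i j h := (R.toFun i j h).compl₁₂ (LinearMap.fst k (A.X i) (B.X i))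
      (LinearMap.fst k (A'.X j) (B'.X j)) -
    (S.toFun i j h).compl₁₂ (LinearMap.snd k (A.X i) (B.X i)) (LinearMap.snd k (A'.X j) (B'.X j))
  leibniz i i' j j' hi hj h a b := by
    have h1 := R.leibniz i i' j j' hi hj h a.1 b.1
    have h2 := S.leibniz i i' j j' hi hj h a.2 b.2
    change (R.toFun i' j h ((A.d i i').hom a.1) b.1 - S.toFun i' j h ((B.d i i').hom a.2) b.2) +
      sgn k i * (R.toFun i j' _ a.1 ((A'.d j j').hom b.1) -
        S.toFun i j' _ a.2 ((B'.d j j').hom b.2)) = 0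
    linear_combination h1 - h2

/-- Elementwise form of the non-degeneracy of a pairing. -/
def Pairing.IsPerfect {A B : Cpx k} {d : ℤ} (R : Pairing A B d) : Prop :=
  ∀ (n₀ n m m₁ m₂ : ℤ) (_ : n₀ + 1 = n) (_ : m + 1 = m₁) (_ : m₁ + 1 = m₂) (h : m + n = d)
    (b : B.X n) (c : A.X m₁ →ₗ[k] k), (∀ l, (B.d n l).hom b = 0) →
    (∀ e : A.X m, c ((A.d m m₁).hom e) = R.toFun m n h e b) →
    ∃ (b' : B.X n₀) (c' : A.X m₂ →ₗ[k] k), (B.d n₀ n).hom b' = b ∧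
      ∀ e : A.X m₁, c e = c' ((A.d m₁ m₂).hom e) - sgn k m * R.toFun m₁ n₀ (by omega) e b'

/-- An element of degree `n₀` of the shifted dual is a functional on `A.X (d - n₀)`, so this is
`quasiIso_iff_elem` reindexed. Multiplying the functional by a sign absorbs the sign in the
differential of `dualShift`. -/
lemma Pairing.isPerfect_iff {A B : Cpx k} {d : ℤ} (R : Pairing A B d) :
    R.IsPerfect ↔ QuasiIso R.toDual := by
  rw [quasiIso_iff_elem]
  have key : ∀ (n₀ n : ℤ), n₀ + 1 = n → sgn k (d - n₀) = - sgn k (d - n) := fun n₀ n h => by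
    rw [← sgn_succ]; congr 1; omega
  constructor
  · intro H n₀ n n₁ h₀ h₁ b (c : A.X (d - n) →ₗ[k] k) hb hc
    have hc' : ∀ e : A.X (d - n₁), R.toFun (d - n₁) n₁ (by omega) e b =
        sgn k (d - n) * c ((A.d (d - n₁) (d - n)).hom e) := fun e =>
      LinearMap.congr_fun (f := (R.toDual.f n₁).hom b)
        (g := ((dualShift A d).d n n₁).hom c) hc e
    obtain ⟨b', c', hb', hc''⟩ := H n n₁ (d - n₁) (d - n) (d - n₀) h₁ (by omega) (by omega)
      (by omega) b (sgn k (d - n) • c) hb (fun e => by rw [hc' e]; rfl)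
    refine ⟨b', c', hb', ?_⟩
    refine LinearMap.ext fun (e : A.X (d - n)) => ?_
    have h2 : sgn k (d - n) * c e = c' ((A.d (d - n) (d - n₀)).hom e) -
      sgn k (d - n₁) * R.toFun (d - n) n (by omega) e b' := hc'' e
    change sgn k (d - n₀) * c' ((A.d (d - n) (d - n₀)).hom e) =
      R.toFun (d - n) n _ e b' - c e
    rw [key n₀ n h₀]
    have e1 := key n n₁ h₁
    rw [← neg_eq_iff_eq_neg] at e1
    rw [← e1] at h2
    linear_combination (sgn k (d - n)) * h2 -
      (c e - R.toFun (d - n) n (by omega) e b') * sgn_mul_self (k := k) (d - n)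
  · intro H n₀ n m m₁ m₂ h₀ g₁ g₂ h b c hb hc
    obtain rfl : m₂ = d - (n₀ - 1) := by omega
    obtain rfl : m₁ = d - n₀ := by omega
    obtain rfl : m = d - n := by omega
    have e1 := key n₀ n h₀
    have e2 := key (n₀ - 1) n₀ (by omega)
    obtain ⟨b', (c' : A.X (d - (n₀ - 1)) →ₗ[k] k), hb', hc''⟩ := H (n₀ - 1) n₀ n (by omega) h₀ b
      (sgn k (d - n₀) • c : A.X (d - n₀) →ₗ[k] k) hb (by
        refine LinearMap.ext fun (e : A.X (d - n)) => ?_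
        change R.toFun (d - n) n h e b =
          sgn k (d - n₀) * (sgn k (d - n₀) * c ((A.d (d - n) (d - n₀)).hom e))
        rw [hc e, ← mul_assoc, sgn_mul_self, one_mul])
    refine ⟨b', c', hb', fun e => ?_⟩
    have h2 : sgn k (d - (n₀ - 1)) *
          c' ((A.d (d - n₀) (d - (n₀ - 1))).hom e) =
        R.toFun (d - n₀) n₀ _ e b' - sgn k (d - n₀) * c e :=
      LinearMap.congr_fun (f := ((dualShift A d).d (n₀ - 1) n₀).hom c')
        (g := (R.toFun (d - n₀) n₀ (by omega)).flip b' - sgn k (d - n₀) • c) hc'' e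
    change c e = c' _ - _
    rw [e2] at h2
    rw [e1] at h2
    have e3 := sgn_mul_self (k := k) (d - n)
    linear_combination (-sgn k (d - n)) * h2 + (- c e +
      c' ((A.d (d - n₀) (d - (n₀ - 1))).hom e)) * e3

/-- The dual of a quasi-isomorphism is a quasi-isomorphism, in elementwise form. -/
lemma ElemQuasiIso.dual {A B : Cpx k} {φ : A ⟶ B} (hφ : ElemQuasiIso φ) {n₀ n n₁ n₂ : ℤ}
    (h₀ : n₀ + 1 = n) (h₁ : n + 1 = n₁) (h₂ : n₁ + 1 = n₂) (ω : B.X n →ₗ[k] k)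
    (c : A.X n₁ →ₗ[k] k) (hω : ∀ b : B.X n₀, ω ((B.d n₀ n).hom b) = 0)
    (hc : ∀ a : A.X n, ω ((φ.f n).hom a) = c ((A.d n n₁).hom a)) :
    ∃ (ω' : B.X n₁ →ₗ[k] k) (c' : A.X n₂ →ₗ[k] k), (∀ b, ω b = ω' ((B.d n n₁).hom b)) ∧
      ∀ a, c a = ω' ((φ.f n₁).hom a) - c' ((A.d n₁ n₂).hom a) := by
  -- The map `(b, a) ↦ (d b + φ a, -d a)` is the differential of the mapping cone. Its kernel
  -- consists of boundaries by `hφ`, and `(ω, c)` vanishes on boundaries by `hω` and `hc`, so `(ω,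
  -- c)` factors through it.
  obtain ⟨Λ, hΛ⟩ := exists_factor (k := k)
    (LinearMap.coprod ((LinearMap.inl k (B.X n₁) (A.X n₂)) ∘ₗ (B.d n n₁).hom)
      (LinearMap.prod (φ.f n₁).hom (-(A.d n₁ n₂).hom)))
    (LinearMap.coprod ω c) (by
      rintro ⟨b, a⟩ h
      have h1 : (B.d n n₁).hom b + (φ.f n₁).hom a = 0 := congrArg Prod.fst h
      have h2 : (A.d n₁ n₂).hom a = 0 := by
        have : 0 + -(A.d n₁ n₂).hom a = 0 := congrArg Prod.snd h
        simpa using this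
      obtain ⟨a', x', ha', hx'⟩ := hφ n₀ n n₁ h₀ h₁ a (-b) (fun l => by
        by_cases hl : n₁ + 1 = l
        · obtain rfl : n₂ = l := by omega
          exact h2
        · rw [A.shape _ _ hl]; rfl) (by rw [map_neg]; exact eq_neg_of_add_eq_zero_right h1)
      have h3 := hω x'
      rw [hx', map_sub, map_neg, hc, ha'] at h3
      change ω b + c a = 0
      linear_combination h3)
  refine ⟨Λ ∘ₗ LinearMap.inl k _ _, Λ ∘ₗ LinearMap.inr k _ _, fun b => ?_, fun a => ?_⟩
  · have h : ω b + c 0 = Λ ((B.d n n₁).hom b + (φ.f n₁).hom 0, 0 + -(A.d n₁ n₂).hom 0) := hΛ (b, 0)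
    simpa using h
  · have h : ω 0 + c a = Λ ((B.d n n₁).hom 0 + (φ.f n₁).hom a, 0 + -(A.d n₁ n₂).hom a) := hΛ (0, a)
    rw [map_zero, map_zero, zero_add, zero_add, zero_add] at h
    rw [h, LinearMap.comp_apply, LinearMap.comp_apply, ← map_sub]
    congr 1
    simp

/-- The morphism of shifted duals induced by a morphism of complexes. -/
def dualShiftMap {A B : Cpx k} (φ : A ⟶ B) (d : ℤ) : dualShift B d ⟶ dualShift A d where
  f n := ModuleCat.ofHom (LinearMap.lcomp k k (φ.f (d - n)).hom)
  comm' i j _ := by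
    refine ModuleCat.hom_ext (LinearMap.ext fun (ω : B.X (d - i) →ₗ[k] k) =>
      LinearMap.ext fun (a : A.X (d - j)) => ?_)
    change sgn k (d - i) * ω ((φ.f (d - i)).hom ((A.d (d - j) (d - i)).hom a)) =
      sgn k (d - i) * ω ((B.d (d - j) (d - i)).hom ((φ.f (d - j)).hom a))
    rw [comm_apply]

lemma quasiIso_dualShiftMap {A B : Cpx k} (φ : A ⟶ B) [hφ : QuasiIso φ] (d : ℤ) :
    QuasiIso (dualShiftMap φ d) := by
  rw [quasiIso_iff_elem] at hφ ⊢
  intro n₀ n n₁ h₀ h₁ (ω : B.X (d - n₁) →ₗ[k] k) (c : A.X (d - n) →ₗ[k] k) hω hc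
  have key : sgn k (d - n₀) = - sgn k (d - n) := by rw [← sgn_succ]; congr 1; omega
  have e3 := sgn_mul_self (k := k) (d - n)
  have e4 := sgn_mul_self (k := k) (d - n₁)
  obtain ⟨ω', c', h1, h2⟩ := hφ.dual (n₀ := d - (n₁ + 1)) (n := d - n₁) (n₁ := d - n)
    (n₂ := d - n₀) (by omega) (by omega) (by omega) ω
    (sgn k (d - n) • c)
    (fun b => by
      have h : sgn k (d - n₁) * ω ((B.d _ _).hom b) = 0 :=
        LinearMap.congr_fun (f := ((dualShift B d).d n₁ (n₁ + 1)).hom ω) (g := 0) (hω (n₁ + 1)) b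
      linear_combination sgn k (d - n₁) * h -
        (ω ((B.d _ _).hom b)) * e4)
    (fun a => LinearMap.congr_fun (f := ((dualShiftMap φ d).f n₁).hom ω)
      (g := ((dualShift A d).d n n₁).hom c) hc a)
  refine ⟨(sgn k (d - n) • ω' : B.X (d - n) →ₗ[k] k),
    (- c' : A.X (d - n₀) →ₗ[k] k), ?_, ?_⟩
  · refine LinearMap.ext fun (b : B.X (d - n₁)) => ?_
    change sgn k (d - n) * (sgn k (d - n) * ω' ((B.d _ _).hom b)) = _
    rw [← mul_assoc, e3, one_mul]
    exact (h1 b).symm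
  · refine LinearMap.ext fun (a : A.X (d - n)) => ?_
    change sgn k (d - n₀) * (- c' ((A.d _ _).hom a)) =
      sgn k (d - n) * ω' ((φ.f _).hom a) - c a
    have h3 : sgn k (d - n) * c a = _ := h2 a
    rw [key]
    linear_combination sgn k (d - n) * h3 - c a * e3

end Duality

/-! ### Relative duality data and their gluing. -/

section RelativeDuality

variable {k : Type u} [Field k] {d : ℤ}

/-- Restriction maps `A ⟶ B`, `A' ⟶ B'` together with a null-homotopy on `A ⊗ A'` of a pairing
`B ⊗ B' ⟶ k[-d]`. -/
structure RelDatum (A A' : Cpx k) {B B' : Cpx k} (β : Pairing B B' d) where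
  /-- the first restriction map -/
  r : A ⟶ B
  /-- the second restriction map -/
  r' : A' ⟶ B'
  /-- the null-homotopy -/
  path : ∀ i j : ℤ, i + j = d + 1 → (A.X i →ₗ[k] A'.X j →ₗ[k] k)
  path_d : ∀ (i i' j j' : ℤ) (_ : i + 1 = i') (_ : j + 1 = j') (h : i + j = d)
    (a : A.X i) (b : A'.X j),
    path i' j (by omega) ((A.d i i').hom a) b + sgn k i * path i j' (by omega) a ((A'.d j j').hom b)
      = β.toFun i j h ((r.f i).hom a) ((r'.f j).hom b)

/-- Elementwise form of the non-degeneracy of a null-homotopic pairing: the total complex of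
`A' ⟶ B' ⟶ A^∨[-d]` is acyclic. -/
def RelDatum.IsExact {A A' B B' : Cpx k} {β : Pairing B B' d} (R : RelDatum A A' β) : Prop :=
  ∀ (n₀ n n₁ m m₁ m₂ : ℤ) (_ : n₀ + 1 = n) (_ : n + 1 = n₁) (_ : m + 1 = m₁) (_ : m₁ + 1 = m₂)
    (h : m + n = d) (a : A'.X n₁) (b : B'.X n) (c : A.X m₁ →ₗ[k] k),
    (∀ l, (A'.d n₁ l).hom a = 0) → (B'.d n n₁).hom b = (R.r'.f n₁).hom a →
    (∀ e : A.X m, c ((A.d m m₁).hom e) =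
      β.toFun m n h ((R.r.f m).hom e) b - sgn k m * R.path m n₁ (by omega) e a) →
    ∃ (a' : A'.X n) (b' : B'.X n₀) (c' : A.X m₂ →ₗ[k] k), (A'.d n n₁).hom a' = a ∧
      (B'.d n₀ n).hom b' = (R.r'.f n).hom a' - b ∧
      ∀ e : A.X m₁, c e = c' ((A.d m₁ m₂).hom e) +
        sgn k m * β.toFun m₁ n₀ (by omega) ((R.r.f m₁).hom e) b' + R.path m₁ n (by omega) e a'

/-- A datum on a product `B₀ × B₁` is exact as soon as the restrictions `A ⟶ B₀` and `A' ⟶ B₁'`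
are surjective with acyclic kernels and the pairing on `B₀` is perfect. -/
lemma RelDatum.isExact_of_acyclic_kernels {C C' Y₀ Y₀' Y₁ Y₁' : Cpx k} {β₀ : Pairing Y₀ Y₀' d}
    {β₁ : Pairing Y₁ Y₁' d} (R : RelDatum C C' (β₀.prodSub β₁)) (hβ : β₀.IsPerfect)
    (surj : ∀ n (y : Y₀.X n), ∃ w : C.X n, ((R.r.f n).hom w : Y₀.X n × Y₁.X n).1 = y)
    (surj' : ∀ n (y : Y₁'.X n), ∃ w : C'.X n, ((R.r'.f n).hom w : Y₀'.X n × Y₁'.X n).2 = y)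
    (ac : ∀ n n₁, n + 1 = n₁ → ∀ w : C.X n₁, (∀ l, (C.d n₁ l).hom w = 0) →
      ((R.r.f n₁).hom w : Y₀.X n₁ × Y₁.X n₁).1 = 0 → ∃ v : C.X n, (C.d n n₁).hom v = w ∧
        ((R.r.f n).hom v : Y₀.X n × Y₁.X n).1 = 0)
    (ac' : ∀ n n₁, n + 1 = n₁ → ∀ w : C'.X n₁, (∀ l, (C'.d n₁ l).hom w = 0) →
      ((R.r'.f n₁).hom w : Y₀'.X n₁ × Y₁'.X n₁).2 = 0 → ∃ v : C'.X n, (C'.d n n₁).hom v = w ∧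
        ((R.r'.f n).hom v : Y₀'.X n × Y₁'.X n).2 = 0) :
    R.IsExact := by
  rintro n₀ n n₁ m m₁ m₂ h₀ h₁ g₁ g₂ h a ⟨y₀, y₁⟩ c ha hy hc
  let ρ (n : ℤ) : C.X n →ₗ[k] Y₀.X n × Y₁.X n := (R.r.f n).hom
  let ρ' (n : ℤ) : C'.X n →ₗ[k] Y₀'.X n × Y₁'.X n := (R.r'.f n).hom
  have hρ : ∀ (i j : ℤ) (w : C.X i), ρ j ((C.d i j).hom w) =
      ((Y₀.d i j).hom (ρ i w).1, (Y₁.d i j).hom (ρ i w).2) := fun i j w =>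
    (comm_apply R.r i j w).symm
  have hρ' : ∀ (i j : ℤ) (w : C'.X i), ρ' j ((C'.d i j).hom w) =
      ((Y₀'.d i j).hom (ρ' i w).1, (Y₁'.d i j).hom (ρ' i w).2) := fun i j w =>
    (comm_apply R.r' i j w).symm
  have hpd : ∀ (i i' j j' : ℤ) (_ : i + 1 = i') (_ : j + 1 = j') (h : i + j = d)
      (a : C.X i) (b : C'.X j),
      R.path i' j (by omega) ((C.d i i').hom a) b +
        sgn k i * R.path i j' (by omega) a ((C'.d j j').hom b) =
      β₀.toFun i j h (ρ i a).1 (ρ' j b).1 - β₁.toFun i j h (ρ i a).2 (ρ' j b).2 := R.path_d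
  have hy0 : (Y₀'.d n n₁).hom y₀ = (ρ' n₁ a).1 := congrArg Prod.fst hy
  have hy1 : (Y₁'.d n n₁).hom y₁ = (ρ' n₁ a).2 := congrArg Prod.snd hy
  have hc : ∀ e : C.X m, c ((C.d m m₁).hom e) = β₀.toFun m n h (ρ m e).1 y₀ -
    β₁.toFun m n h (ρ m e).2 y₁ - sgn k m * R.path m n₁ (by omega) e a := hc
  -- An arbitrary lift of `y₁` misses `a` by a cocycle in the kernel of `C' → Y₁'`. That kernel is
  -- acyclic, so the lift can be corrected to a primitive of `a` restricting exactly to `y₁`.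
  obtain ⟨u₀, hu₀⟩ := surj' n y₁
  obtain ⟨u₁, hu₁, hu₁'⟩ := ac' n n₁ h₁ (a - (C'.d n n₁).hom u₀)
    (fun l => by rw [map_sub, ha, d_d_apply, sub_zero]) (by
      change (ρ' n₁ (a - (C'.d n n₁).hom u₀)).2 = 0
      rw [map_sub, hρ']
      change (ρ' n₁ a).2 - (Y₁'.d n n₁).hom (ρ' n u₀).2 = 0
      rw [show (ρ' n u₀).2 = y₁ from hu₀, hy1, sub_self])
  set a' := u₀ + u₁ with ha'
  have da' : (C'.d n n₁).hom a' = a := by rw [ha', map_add, hu₁]; abel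
  have ra' : (ρ' n a').2 = y₁ := by
    rw [ha', map_add]
    change (ρ' n u₀).2 + (ρ' n u₁).2 = y₁
    rw [show (ρ' n u₀).2 = y₁ from hu₀, show (ρ' n u₁).2 = 0 from hu₁', add_zero]
  -- The second component is now settled. The remaining problem lives on `Y₀`: a cocycle `y`, and
  -- the functional `c` corrected by the path against `a'`.
  let y := y₀ - (ρ' n a').1
  let c₁ : C.X m₁ →ₗ[k] k := c - (R.path m₁ n (by omega)).flip a'
  have hc₁ : ∀ e : C.X m, c₁ ((C.d m m₁).hom e) = β₀.toFun m n h (ρ m e).1 y := fun e => by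
    have h2 := hpd m m₁ n n₁ g₁ h₁ h e a'
    rw [da', ra'] at h2
    change c _ - R.path m₁ n _ ((C.d m m₁).hom e) a' = _
    rw [hc, map_sub]
    linear_combination -h2
  -- A cocycle in the kernel of `C → Y₀` is the differential of an element of that kernel, where
  -- `hc₁` gives zero. Hence `c₁` depends only on the differential and on the restriction to `Y₀`.
  obtain ⟨c', hc'⟩ := exists_factor (k := k)
    (LinearMap.prod (C.d m₁ m₂).hom (LinearMap.fst k _ _ ∘ₗ ρ m₁)) c₁ (fun e he => by
      have e1 : (C.d m₁ m₂).hom e = 0 := congrArg Prod.fst he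
      have e2 : (ρ m₁ e).1 = 0 := congrArg Prod.snd he
      obtain ⟨v, hv, hv'⟩ := ac m m₁ g₁ e (fun l => by
        by_cases hl : m₁ + 1 = l
        · obtain rfl : m₂ = l := by omega
          exact e1
        · rw [C.shape _ _ hl]; rfl) e2
      rw [← hv, hc₁, show (ρ m v).1 = 0 from hv', map_zero, LinearMap.zero_apply])
  let ε : Y₀.X m₁ →ₗ[k] k := c' ∘ₗ LinearMap.inr k _ _
  have hcε : ∀ e, c₁ e = c' ((C.d m₁ m₂).hom e, 0) + ε (ρ m₁ e).1 := fun e => by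
    rw [hc']
    change _ = c' _ + c' (0, (ρ m₁ e).1)
    rw [← map_add]
    simp
  -- Every element of `Y₀` lifts to `C`, and on the differential of a lift only the `ε` part of `c₁`
  -- survives. So `ε` and `y` form an input for perfectness of `β₀`.
  obtain ⟨y', κ, hy', hκ⟩ := hβ n₀ n m m₁ m₂ h₀ g₁ g₂ h y ε (fun l => by
      by_cases hl : n + 1 = l
      · obtain rfl : n₁ = l := by omega
        rw [map_sub, hy0, ← da', hρ', sub_self]
      · rw [Y₀'.shape _ _ hl]; rfl) (fun e => by
      obtain ⟨w, hw⟩ := surj m e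
      have h1 := hcε ((C.d m m₁).hom w)
      rw [d_d_apply, hc₁, hρ, show (ρ m w).1 = e from hw] at h1
      rw [h1]
      change _ = c' 0 + _
      rw [map_zero, zero_add])
  -- The sign of `y'` is reversed because `y` is `y₀` minus the restriction of `a'`, while the goal
  -- asks for the opposite difference. The second component is zero because `a'` restricts to `y₁`
  -- on the nose.
  refine ⟨a', (-y', 0), c' ∘ₗ LinearMap.inl k _ _ + κ ∘ₗ LinearMap.fst k _ _ ∘ₗ ρ m₂, da',
    ?_, fun e => ?_⟩
  · refine Prod.ext ?_ ?_
    · change (Y₀'.d n₀ n).hom (-y') = (ρ' n a').1 - y₀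
      rw [map_neg, hy']
      simp only [y]; abel
    · change (Y₁'.d n₀ n).hom 0 = (ρ' n a').2 - y₁
      rw [map_zero, ra', sub_self]
  · change c e = c' ((C.d m₁ m₂).hom e, 0) + κ (ρ m₂ ((C.d m₁ m₂).hom e)).1 +
      sgn k m * (β₀.toFun m₁ n₀ _ (ρ m₁ e).1 (-y') - β₁.toFun m₁ n₀ _ (ρ m₁ e).2 0) +
        R.path m₁ n _ e a'
    have h1 := hcε e
    rw [hκ] at h1
    change c e - R.path m₁ n _ e a' = _ at h1
    rw [hρ, map_neg, map_zero]
    linear_combination h1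

/-- Gluing of exact data along perfect pairings. -/
lemma RelDatum.IsExact.glue {X X' Y₀ Y₀' Y₁ Y₁' Z Z' F F' G G' C C' T T' : Cpx k}
    {βX : Pairing X X' d} {β₀ : Pairing Y₀ Y₀' d} {β₁ : Pairing Y₁ Y₁' d} {βZ : Pairing Z Z' d}
    {RF : RelDatum F F' (βX.prodSub β₀)} {RG : RelDatum G G' (β₁.prodSub βZ)}
    {RC : RelDatum C C' (β₀.prodSub β₁)} {RT : RelDatum T T' (βX.prodSub βZ)}
    (hF : RF.IsExact) (hG : RG.IsExact) (hC : RC.IsExact)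
    (hβ₀ : β₀.IsPerfect) (hβ₁ : β₁.IsPerfect)
    (iF : T ⟶ F) (iG : T ⟶ G) (iC : T ⟶ C) (iF' : T' ⟶ F') (iG' : T' ⟶ G') (iC' : T' ⟶ C')
    (path_eq : ∀ i j h (e : T.X i) (a : T'.X j), RT.path i j h e a =
      RF.path i j h ((iF.f i).hom e) ((iF'.f j).hom a) +
      RG.path i j h ((iG.f i).hom e) ((iG'.f j).hom a) +
      RC.path i j h ((iC.f i).hom e) ((iC'.f j).hom a))
    (rX : ∀ n (e : T.X n), ((RT.r.f n).hom e : X.X n × Z.X n).1 =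
      ((RF.r.f n).hom ((iF.f n).hom e) : X.X n × Y₀.X n).1)
    (rZ : ∀ n (e : T.X n), ((RT.r.f n).hom e : X.X n × Z.X n).2 =
      ((RG.r.f n).hom ((iG.f n).hom e) : Y₁.X n × Z.X n).2)
    (rX' : ∀ n (e : T'.X n), ((RT.r'.f n).hom e : X'.X n × Z'.X n).1 =
      ((RF.r'.f n).hom ((iF'.f n).hom e) : X'.X n × Y₀'.X n).1)
    (rZ' : ∀ n (e : T'.X n), ((RT.r'.f n).hom e : X'.X n × Z'.X n).2 =
      ((RG.r'.f n).hom ((iG'.f n).hom e) : Y₁'.X n × Z'.X n).2)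
    (mt₀ : ∀ n (e : T.X n), ((RF.r.f n).hom ((iF.f n).hom e) : X.X n × Y₀.X n).2 =
      ((RC.r.f n).hom ((iC.f n).hom e) : Y₀.X n × Y₁.X n).1)
    (mt₁ : ∀ n (e : T.X n), ((RG.r.f n).hom ((iG.f n).hom e) : Y₁.X n × Z.X n).1 =
      ((RC.r.f n).hom ((iC.f n).hom e) : Y₀.X n × Y₁.X n).2)
    (mt₀' : ∀ n (e : T'.X n), ((RF.r'.f n).hom ((iF'.f n).hom e) : X'.X n × Y₀'.X n).2 =
      ((RC.r'.f n).hom ((iC'.f n).hom e) : Y₀'.X n × Y₁'.X n).1)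
    (mt₁' : ∀ n (e : T'.X n), ((RG.r'.f n).hom ((iG'.f n).hom e) : Y₁'.X n × Z'.X n).1 =
      ((RC.r'.f n).hom ((iC'.f n).hom e) : Y₀'.X n × Y₁'.X n).2)
    (inj : ∀ n (e : T.X n), (iF.f n).hom e = 0 → (iG.f n).hom e = 0 → (iC.f n).hom e = 0 → e = 0)
    (inj' : ∀ n (e : T'.X n), (iF'.f n).hom e = 0 → (iG'.f n).hom e = 0 →
      (iC'.f n).hom e = 0 → e = 0)
    (ex : ∀ n (f : F.X n) (g : G.X n) (w : C.X n),
      ((RF.r.f n).hom f : X.X n × Y₀.X n).2 = ((RC.r.f n).hom w : Y₀.X n × Y₁.X n).1 →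
      ((RG.r.f n).hom g : Y₁.X n × Z.X n).1 = ((RC.r.f n).hom w : Y₀.X n × Y₁.X n).2 →
      ∃ e : T.X n, (iF.f n).hom e = f ∧ (iG.f n).hom e = g ∧ (iC.f n).hom e = w)
    (ex' : ∀ n (f : F'.X n) (g : G'.X n) (w : C'.X n),
      ((RF.r'.f n).hom f : X'.X n × Y₀'.X n).2 = ((RC.r'.f n).hom w : Y₀'.X n × Y₁'.X n).1 →
      ((RG.r'.f n).hom g : Y₁'.X n × Z'.X n).1 = ((RC.r'.f n).hom w : Y₀'.X n × Y₁'.X n).2 →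
      ∃ e : T'.X n, (iF'.f n).hom e = f ∧ (iG'.f n).hom e = g ∧ (iC'.f n).hom e = w)
    (surj : ∀ n, Function.Surjective (RC.r.f n).hom)
    (surj' : ∀ n, Function.Surjective (RC.r'.f n).hom) :
    RT.IsExact := by
  rintro n₀ n n₁ m m₁ m₂ en₀ en₁ em₁ em₂ hmn t ⟨x, z⟩ c ht hxz hc
  let ρF (n : ℤ) : F.X n →ₗ[k] X.X n × Y₀.X n := (RF.r.f n).hom
  let ρG (n : ℤ) : G.X n →ₗ[k] Y₁.X n × Z.X n := (RG.r.f n).hom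
  let ρC (n : ℤ) : C.X n →ₗ[k] Y₀.X n × Y₁.X n := (RC.r.f n).hom
  let ρT (n : ℤ) : T.X n →ₗ[k] X.X n × Z.X n := (RT.r.f n).hom
  let ρF' (n : ℤ) : F'.X n →ₗ[k] X'.X n × Y₀'.X n := (RF.r'.f n).hom
  let ρG' (n : ℤ) : G'.X n →ₗ[k] Y₁'.X n × Z'.X n := (RG.r'.f n).hom
  let ρC' (n : ℤ) : C'.X n →ₗ[k] Y₀'.X n × Y₁'.X n := (RC.r'.f n).hom
  let ρT' (n : ℤ) : T'.X n →ₗ[k] X'.X n × Z'.X n := (RT.r'.f n).hom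
  have hρF : ∀ (i j : ℤ) (w : F.X i), ρF j ((F.d i j).hom w) =
      ((X.d i j).hom (ρF i w).1, (Y₀.d i j).hom (ρF i w).2) := fun i j w =>
    (comm_apply RF.r i j w).symm
  have hρG : ∀ (i j : ℤ) (w : G.X i), ρG j ((G.d i j).hom w) =
      ((Y₁.d i j).hom (ρG i w).1, (Z.d i j).hom (ρG i w).2) := fun i j w =>
    (comm_apply RG.r i j w).symm
  have hρC : ∀ (i j : ℤ) (w : C.X i), ρC j ((C.d i j).hom w) =
      ((Y₀.d i j).hom (ρC i w).1, (Y₁.d i j).hom (ρC i w).2) := fun i j w =>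
    (comm_apply RC.r i j w).symm
  have hρC' : ∀ (i j : ℤ) (w : C'.X i), ρC' j ((C'.d i j).hom w) =
      ((Y₀'.d i j).hom (ρC' i w).1, (Y₁'.d i j).hom (ρC' i w).2) := fun i j w =>
    (comm_apply RC.r' i j w).symm
  have hpC : ∀ (i i' j j' : ℤ) (_ : i + 1 = i') (_ : j + 1 = j') (h : i + j = d)
      (a : C.X i) (b : C'.X j),
      RC.path i' j (by omega) ((C.d i i').hom a) b +
        sgn k i * RC.path i j' (by omega) a ((C'.d j j').hom b) =
      β₀.toFun i j h (ρC i a).1 (ρC' j b).1 - β₁.toFun i j h (ρC i a).2 (ρC' j b).2 := RC.path_d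
  have hx : (X'.d n n₁).hom x = (ρF' n₁ ((iF'.f n₁).hom t)).1 :=
    (congrArg Prod.fst hxz).trans (rX' n₁ t)
  have hz : (Z'.d n n₁).hom z = (ρG' n₁ ((iG'.f n₁).hom t)).2 :=
    (congrArg Prod.snd hxz).trans (rZ' n₁ t)
  have hc : ∀ e : T.X m, c ((T.d m m₁).hom e) = βX.toFun m n hmn (ρF m ((iF.f m).hom e)).1 x -
      βZ.toFun m n hmn (ρG m ((iG.f m).hom e)).2 z - sgn k m *
        (RF.path m n₁ (by omega) ((iF.f m).hom e) ((iF'.f n₁).hom t) +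
        RG.path m n₁ (by omega) ((iG.f m).hom e) ((iG'.f n₁).hom t) +
        RC.path m n₁ (by omega) ((iC.f m).hom e) ((iC'.f n₁).hom t)) := fun e => by
    have h := hc e
    rw [path_eq] at h
    refine h.trans ?_
    change βX.toFun m n hmn (ρT m e).1 x - βZ.toFun m n hmn (ρT m e).2 z - _ = _
    rw [show (ρT m e).1 = _ from rX m e, show (ρT m e).2 = _ from rZ m e]
    rfl
  -- extension of the functional `c` to the three pieces
  obtain ⟨c₀, hc₀⟩ := exists_factor (k := k)
    (LinearMap.prod (iF.f m₁).hom (LinearMap.prod (iG.f m₁).hom (iC.f m₁).hom)) c (fun e he => by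
      rw [inj m₁ e (congrArg Prod.fst he) (congrArg (fun p => p.2.1) he)
        (congrArg (fun p => p.2.2) he), map_zero])
  let cF : F.X m₁ →ₗ[k] k := c₀ ∘ₗ LinearMap.inl k _ _
  let cG : G.X m₁ →ₗ[k] k := c₀ ∘ₗ LinearMap.inr k _ _ ∘ₗ LinearMap.inl k _ _
  let cC : C.X m₁ →ₗ[k] k := c₀ ∘ₗ LinearMap.inr k _ _ ∘ₗ LinearMap.inr k _ _
  have hcsum : ∀ e, c e = cF ((iF.f m₁).hom e) + cG ((iG.f m₁).hom e) + cC ((iC.f m₁).hom e) := by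
    intro e
    rw [hc₀]
    change c₀ ((iF.f m₁).hom e, ((iG.f m₁).hom e, (iC.f m₁).hom e)) =
      c₀ ((iF.f m₁).hom e, 0) + c₀ (0, ((iG.f m₁).hom e, 0)) + c₀ (0, (0, (iC.f m₁).hom e))
    rw [← map_add, ← map_add]
    simp
  -- the defect of the three functionals is concentrated on the interfaces
  let eF : F.X m →ₗ[k] k := cF ∘ₗ (F.d m m₁).hom -
    (βX.toFun m n hmn).flip x ∘ₗ LinearMap.fst k _ _ ∘ₗ ρF m +
    sgn k m • (RF.path m n₁ (by omega)).flip ((iF'.f n₁).hom t)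
  let eG : G.X m →ₗ[k] k := cG ∘ₗ (G.d m m₁).hom +
    (βZ.toFun m n hmn).flip z ∘ₗ LinearMap.snd k _ _ ∘ₗ ρG m +
    sgn k m • (RG.path m n₁ (by omega)).flip ((iG'.f n₁).hom t)
  let eC : C.X m →ₗ[k] k := cC ∘ₗ (C.d m m₁).hom +
    sgn k m • (RC.path m n₁ (by omega)).flip ((iC'.f n₁).hom t)
  have heF : ∀ f, eF f = cF ((F.d m m₁).hom f) - βX.toFun m n hmn (ρF m f).1 x +
    sgn k m * RF.path m n₁ (by omega) f ((iF'.f n₁).hom t) := fun _ => rfl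
  have heG : ∀ g, eG g = cG ((G.d m m₁).hom g) + βZ.toFun m n hmn (ρG m g).2 z +
    sgn k m * RG.path m n₁ (by omega) g ((iG'.f n₁).hom t) := fun _ => rfl
  have heC : ∀ w, eC w = cC ((C.d m m₁).hom w) +
    sgn k m * RC.path m n₁ (by omega) w ((iC'.f n₁).hom t) := fun _ => rfl
  -- `df₀` and `df₁` measure the mismatch of restrictions on the two interfaces; by `ex` their
  -- common kernel comes from `T`.
  let df₀ : F.X m × G.X m × C.X m →ₗ[k] Y₀.X m := LinearMap.coprod
    (LinearMap.snd k _ _ ∘ₗ ρF m) (LinearMap.coprod 0 (-(LinearMap.fst k _ _ ∘ₗ ρC m)))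
  let df₁ : F.X m × G.X m × C.X m →ₗ[k] Y₁.X m := LinearMap.coprod
    0 (LinearMap.coprod (LinearMap.fst k _ _ ∘ₗ ρG m) (-(LinearMap.snd k _ _ ∘ₗ ρC m)))
  -- On elements of `T` the three defects add up to zero, which is the equation `hc` satisfied by
  -- `c`. The total defect is therefore a functional `ε` of the mismatch alone.
  obtain ⟨ε, hε⟩ := exists_factor (k := k) (LinearMap.prod df₀ df₁)
    (LinearMap.coprod eF (LinearMap.coprod eG eC)) (by
      rintro ⟨f, g, w⟩ h
      have e0 : (ρF m f).2 + (0 + -(ρC m w).1) = 0 := congrArg Prod.fst h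
      have e1 : 0 + ((ρG m g).1 + -(ρC m w).2) = 0 := congrArg Prod.snd h
      obtain ⟨e, rfl, rfl, rfl⟩ := ex m f g w
        (by rw [zero_add] at e0; exact eq_of_sub_eq_zero ((sub_eq_add_neg _ _).trans e0))
        (by rw [zero_add] at e1; exact eq_of_sub_eq_zero ((sub_eq_add_neg _ _).trans e1))
      change eF ((iF.f m).hom e) + (eG ((iG.f m).hom e) + eC ((iC.f m).hom e)) = 0
      have h1 := hcsum ((T.d m m₁).hom e)
      rw [← comm_apply iF, ← comm_apply iG, ← comm_apply iC, hc] at h1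
      rw [heF, heG, heC]
      linear_combination -h1)
  let ε₀ : Y₀.X m →ₗ[k] k := ε ∘ₗ LinearMap.inl k _ _
  let ε₁ : Y₁.X m →ₗ[k] k := ε ∘ₗ LinearMap.inr k _ _
  have hεs : ∀ f g w, eF f + (eG g + eC w) = ε₀ ((ρF m f).2 - (ρC m w).1) +
      ε₁ ((ρG m g).1 - (ρC m w).2) := by
    intro f g w
    have h : eF f + (eG g + eC w) =
      ε ((ρF m f).2 + (0 + -(ρC m w).1), 0 + ((ρG m g).1 + -(ρC m w).2)) := hε (f, g, w)
    rw [h]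
    change _ = ε ((ρF m f).2 - (ρC m w).1, 0) + ε (0, (ρG m g).1 - (ρC m w).2)
    rw [← map_add]
    congr 1
    ext <;> simp [sub_eq_add_neg]
  have hεF : ∀ f, eF f = ε₀ (ρF m f).2 := fun f => by simpa using hεs f 0 0
  have hεG : ∀ g, eG g = ε₁ (ρG m g).1 := fun g => by simpa using hεs 0 g 0
  have hεC : ∀ w, eC w = -ε₀ (ρC m w).1 - ε₁ (ρC m w).2 := fun w => by
    have := hεs 0 0 w
    simp only [map_zero, zero_add] at this
    rw [this]
    change ε₀ (0 - _) + ε₁ (0 - _) = _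
    rw [zero_sub, zero_sub, map_neg, map_neg, sub_eq_add_neg]
  have hdt : ∀ l, (C'.d n₁ l).hom ((iC'.f n₁).hom t) = 0 := fun l => by
    rw [comm_apply, ht, map_zero]
  have sm : sgn k (m - 1) = - sgn k m := by
    have := sgn_succ (k := k) (m - 1)
    rw [sub_add_cancel] at this
    rw [this, neg_neg]
  have ss := sgn_mul_self (k := k) m
  -- Apply `hεC` to a coboundary: the `cC` term dies, and since `t` is a cocycle the path term
  -- becomes the two pairings on the ends.
  have hεd : ∀ w : C.X (m - 1), -ε₀ ((Y₀.d (m - 1) m).hom (ρC _ w).1) -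
      ε₁ ((Y₁.d (m - 1) m).hom (ρC _ w).2) = sgn k m *
        (β₀.toFun (m - 1) n₁ (by omega) (ρC _ w).1 (ρC' n₁ ((iC'.f n₁).hom t)).1 -
          β₁.toFun (m - 1) n₁ (by omega) (ρC _ w).2 (ρC' n₁ ((iC'.f n₁).hom t)).2) := fun w => by
    have h1 := hεC ((C.d (m - 1) m).hom w)
    rw [hρC, heC, d_d_apply, map_zero, zero_add] at h1
    have h2 := hpC (m - 1) m n₁ (n₁ + 1) (by omega) rfl (by omega) w ((iC'.f n₁).hom t)
    rw [hdt, map_zero, mul_zero, add_zero] at h2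
    rw [← h2, h1]
  have hty : ∀ l, (Y₀'.d n₁ l).hom (ρC' n₁ ((iC'.f n₁).hom t)).1 = 0 ∧
      (Y₁'.d n₁ l).hom (ρC' n₁ ((iC'.f n₁).hom t)).2 = 0 := fun l => by
    have h := hρC' n₁ l ((iC'.f n₁).hom t)
    rw [hdt, map_zero] at h
    exact ⟨(congrArg Prod.fst h).symm, (congrArg Prod.snd h).symm⟩
  -- Surjectivity of `C → Y₀ × Y₁` allows testing on `(e, 0)`, which isolates the `Y₀` part of
  -- `hεd`. Perfectness then supplies the missing boundary value `y₀` on the interface and expresses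
  -- `ε₀` by pairing with `y₀`, up to the term in `κ₀`.
  obtain ⟨y₀, κ₀, hy₀, hκ₀⟩ := hβ₀ n n₁ (m - 1) m m₁ en₁ (by omega) em₁ (by omega)
    (ρC' n₁ ((iC'.f n₁).hom t)).1 (-sgn k m • ε₀) (fun l => (hty l).1) (fun e => by
      obtain ⟨w, hw⟩ := surj (m - 1) (e, 0)
      have h := hεd w
      rw [show ρC _ w = (e, 0) from hw] at h
      simp only [map_zero, sub_zero, LinearMap.zero_apply] at h
      change -sgn k m * ε₀ _ = _
      linear_combination sgn k m * h + β₀.toFun (m - 1) n₁ (by omega) e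
        (ρC' n₁ ((iC'.f n₁).hom t)).1 * ss)
  obtain ⟨y₁, κ₁, hy₁, hκ₁⟩ := hβ₁ n n₁ (m - 1) m m₁ en₁ (by omega) em₁ (by omega)
    (ρC' n₁ ((iC'.f n₁).hom t)).2 (sgn k m • ε₁) (fun l => (hty l).2) (fun e => by
      obtain ⟨w, hw⟩ := surj (m - 1) (0, e)
      have h := hεd w
      rw [show ρC _ w = (0, e) from hw] at h
      simp only [map_zero, neg_zero, zero_sub, LinearMap.zero_apply] at h
      change sgn k m * ε₁ _ = _
      linear_combination -sgn k m * h + β₁.toFun (m - 1) n₁ (by omega) e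
        (ρC' n₁ ((iC'.f n₁).hom t)).2 * ss)
  have hκ₀' : ∀ e, ε₀ e = -β₀.toFun m n hmn e y₀ - sgn k m * κ₀ ((Y₀.d m m₁).hom e) := fun e => by
    have h : -sgn k m * ε₀ e = _ := hκ₀ e
    rw [sm] at h
    linear_combination -sgn k m * h - (ε₀ e + β₀.toFun m n hmn e y₀) * ss
  have hκ₁' : ∀ e, ε₁ e = β₁.toFun m n hmn e y₁ + sgn k m * κ₁ ((Y₁.d m m₁).hom e) := fun e => by
    have h : sgn k m * ε₁ e = _ := hκ₁ e
    rw [sm] at h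
    linear_combination sgn k m * h + (-ε₁ e + β₁.toFun m n hmn e y₁) * ss
  -- Each piece now has a full set of boundary values. The term in `κ₀` is added on `F` and
  -- subtracted on `C`, and the term in `κ₁` is subtracted on `G` and added on `C`, so that each
  -- piece satisfies its own equation while the corrections cancel in the sum.
  obtain ⟨aF, ⟨xF, yF⟩, cF', haF, hbF, hcF⟩ := hF n₀ n n₁ m m₁ m₂ en₀ en₁ em₁ em₂ hmn
    ((iF'.f n₁).hom t) (x, y₀) (cF + sgn k m • κ₀ ∘ₗ LinearMap.snd k _ _ ∘ₗ ρF m₁)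
    (fun l => by rw [comm_apply, ht, map_zero])
    (Prod.ext hx (hy₀.trans (mt₀' n₁ t).symm)) (fun e => by
      have h := hεF e
      rw [heF, hκ₀'] at h
      change cF _ + sgn k m * κ₀ (ρF m₁ ((F.d m m₁).hom e)).2 =
        βX.toFun m n hmn (ρF m e).1 x - β₀.toFun m n hmn (ρF m e).2 y₀ - _
      rw [hρF]
      linear_combination h)
  obtain ⟨aG, ⟨yG, zG⟩, cG', haG, hbG, hcG⟩ := hG n₀ n n₁ m m₁ m₂ en₀ en₁ em₁ em₂ hmn
    ((iG'.f n₁).hom t) (y₁, z) (cG - sgn k m • κ₁ ∘ₗ LinearMap.fst k _ _ ∘ₗ ρG m₁)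
    (fun l => by rw [comm_apply, ht, map_zero])
    (Prod.ext (hy₁.trans (mt₁' n₁ t).symm) hz) (fun e => by
      have h := hεG e
      rw [heG, hκ₁'] at h
      change cG _ - sgn k m * κ₁ (ρG m₁ ((G.d m m₁).hom e)).1 =
        β₁.toFun m n hmn (ρG m e).1 y₁ - βZ.toFun m n hmn (ρG m e).2 z - _
      rw [hρG]
      linear_combination h)
  obtain ⟨aC, ⟨yC₀, yC₁⟩, cC', haC, hbC, hcC⟩ := hC n₀ n n₁ m m₁ m₂ en₀ en₁ em₁ em₂ hmn
    ((iC'.f n₁).hom t) (y₀, y₁) (cC - sgn k m • κ₀ ∘ₗ LinearMap.fst k _ _ ∘ₗ ρC m₁ +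
      sgn k m • κ₁ ∘ₗ LinearMap.snd k _ _ ∘ₗ ρC m₁) hdt (Prod.ext hy₀ hy₁) (fun e => by
      have h := hεC e
      rw [heC, hκ₀', hκ₁'] at h
      change cC _ - sgn k m * κ₀ (ρC m₁ ((C.d m m₁).hom e)).1 +
        sgn k m * κ₁ (ρC m₁ ((C.d m m₁).hom e)).2 =
        β₀.toFun m n hmn (ρC m e).1 y₀ - β₁.toFun m n hmn (ρC m e).2 y₁ - _
      rw [hρC]
      linear_combination h)
  have hbF₁ : (X'.d n₀ n).hom xF = (ρF' n aF).1 - x := congrArg Prod.fst hbF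
  have hbF₂ : (Y₀'.d n₀ n).hom yF = (ρF' n aF).2 - y₀ := congrArg Prod.snd hbF
  have hbG₁ : (Y₁'.d n₀ n).hom yG = (ρG' n aG).1 - y₁ := congrArg Prod.fst hbG
  have hbG₂ : (Z'.d n₀ n).hom zG = (ρG' n aG).2 - z := congrArg Prod.snd hbG
  have hbC₁ : (Y₀'.d n₀ n).hom yC₀ = (ρC' n aC).1 - y₀ := congrArg Prod.fst hbC
  have hbC₂ : (Y₁'.d n₀ n).hom yC₁ = (ρC' n aC).2 - y₁ := congrArg Prod.snd hbC
  -- On each interface the primitives restrict to the same `y₀` or `y₁` up to coboundaries. Adding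
  -- to `aC` the coboundary of a lift of the differences makes the restrictions agree and leaves the
  -- differential of `aC` unchanged.
  obtain ⟨u, hu⟩ := surj' n₀ (yF - yC₀, yG - yC₁)
  have hu : ρC' n₀ u = (yF - yC₀, yG - yC₁) := hu
  obtain ⟨a, aeF, aeG, aeC⟩ := ex' n aF aG (aC + (C'.d n₀ n).hom u)
    (by
      change (ρF' n aF).2 = (ρC' n (aC + (C'.d n₀ n).hom u)).1
      rw [map_add, hρC', hu]
      change _ = (ρC' n aC).1 + (Y₀'.d n₀ n).hom (yF - yC₀)
      rw [map_sub, hbF₂, hbC₁]; abel)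
    (by
      change (ρG' n aG).1 = (ρC' n (aC + (C'.d n₀ n).hom u)).2
      rw [map_add, hρC', hu]
      change _ = (ρC' n aC).2 + (Y₁'.d n₀ n).hom (yG - yC₁)
      rw [map_sub, hbG₁, hbC₂]; abel)
  -- Replacing `aC` by `aC + d u` changes the path term. By `path_d` the change is a path against
  -- `u`, absorbed here, plus pairings on the ends, which cancel the terms in `yF`, `yG`, `yC₀` and
  -- `yC₁`.
  let cC'' : C.X m₂ →ₗ[k] k := cC' - sgn k m • (RC.path m₂ n₀ (by omega)).flip u
  refine ⟨a, (xF, zG), cF' ∘ₗ (iF.f m₂).hom + cG' ∘ₗ (iG.f m₂).hom + cC'' ∘ₗ (iC.f m₂).hom,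
    ?_, ?_, fun e => ?_⟩
  · rw [← sub_eq_zero]
    apply inj'
    · rw [map_sub, ← comm_apply, aeF, haF, sub_self]
    · rw [map_sub, ← comm_apply, aeG, haG, sub_self]
    · rw [map_sub, ← comm_apply, aeC, map_add, d_d_apply, haC, add_zero, sub_self]
  · refine Prod.ext ?_ ?_
    · change (X'.d n₀ n).hom xF = (ρT' n a).1 - x
      rw [hbF₁, show (ρT' n a).1 = _ from rX' n a, aeF]
      rfl
    · change (Z'.d n₀ n).hom zG = (ρT' n a).2 - z
      rw [hbG₂, show (ρT' n a).2 = _ from rZ' n a, aeG]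
      rfl
  · have kF : cF ((iF.f m₁).hom e) + sgn k m * κ₀ (ρF m₁ ((iF.f m₁).hom e)).2 =
        cF' ((F.d m₁ m₂).hom ((iF.f m₁).hom e)) + sgn k m *
          (βX.toFun m₁ n₀ (by omega) (ρF m₁ ((iF.f m₁).hom e)).1 xF -
            β₀.toFun m₁ n₀ (by omega) (ρF m₁ ((iF.f m₁).hom e)).2 yF) +
          RF.path m₁ n (by omega) ((iF.f m₁).hom e) aF := hcF _
    have kG : cG ((iG.f m₁).hom e) - sgn k m * κ₁ (ρG m₁ ((iG.f m₁).hom e)).1 =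
        cG' ((G.d m₁ m₂).hom ((iG.f m₁).hom e)) + sgn k m *
          (β₁.toFun m₁ n₀ (by omega) (ρG m₁ ((iG.f m₁).hom e)).1 yG -
            βZ.toFun m₁ n₀ (by omega) (ρG m₁ ((iG.f m₁).hom e)).2 zG) +
          RG.path m₁ n (by omega) ((iG.f m₁).hom e) aG := hcG _
    have kC : cC ((iC.f m₁).hom e) - sgn k m * κ₀ (ρC m₁ ((iC.f m₁).hom e)).1 +
          sgn k m * κ₁ (ρC m₁ ((iC.f m₁).hom e)).2 =
        cC' ((C.d m₁ m₂).hom ((iC.f m₁).hom e)) + sgn k m *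
          (β₀.toFun m₁ n₀ (by omega) (ρC m₁ ((iC.f m₁).hom e)).1 yC₀ -
            β₁.toFun m₁ n₀ (by omega) (ρC m₁ ((iC.f m₁).hom e)).2 yC₁) +
          RC.path m₁ n (by omega) ((iC.f m₁).hom e) aC := hcC _
    have kP := hpC m₁ m₂ n₀ n em₂ en₀ (by omega) ((iC.f m₁).hom e) u
    rw [hu, show sgn k m₁ = -sgn k m by rw [← em₁, sgn_succ]] at kP
    simp only [map_sub] at kP
    rw [hcsum]
    change _ = cF' ((iF.f m₂).hom _) + cG' ((iG.f m₂).hom _) +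
      (cC' ((iC.f m₂).hom _) - sgn k m * RC.path m₂ n₀ _ ((iC.f m₂).hom _) u) +
      sgn k m * (βX.toFun _ n₀ _ (ρT _ e).1 xF - βZ.toFun _ n₀ _ (ρT _ e).2 zG) + _
    rw [show (ρT m₁ e).1 = (ρF m₁ ((iF.f m₁).hom e)).1 from rX _ e,
      show (ρT m₁ e).2 = (ρG m₁ ((iG.f m₁).hom e)).2 from rZ _ e, path_eq, aeF, aeG, aeC,
      map_add]
    rw [show (ρF m₁ ((iF.f m₁).hom e)).2 = (ρC m₁ ((iC.f m₁).hom e)).1 from mt₀ _ e,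
      comm_apply] at kF
    rw [show (ρG m₁ ((iG.f m₁).hom e)).1 = (ρC m₁ ((iC.f m₁).hom e)).2 from mt₁ _ e,
      comm_apply] at kG
    rw [comm_apply] at kC kP
    linear_combination kF + kG + kC + sgn k m * kP +
      RC.path m₁ n (by omega) ((iC.f m₁).hom e) ((C'.d n₀ n).hom u) * ss

end RelativeDuality

/-! ### Transport of coefficients along the track of a deformation. -/

section Contraction

variable {k : Type u} [Field k] {X : SSet.{u}}

/-- A deformation of `X` which is constant at time `e` and ends at the opposite time in the
simplices satisfying `A`, and which preserves `A`. -/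
structure Deformation (X : SSet.{u}) (A : ∀ p, Spx X p → Prop) (e : Fin 2) where
  /-- the underlying homotopy -/
  hom : X ⊗ SSet.stdSimplex.obj ⦋1⦌ ⟶ X
  hom_start : ∀ {p : ℕ} (y : Spx X p) (s : Spx (SSet.stdSimplex.obj ⦋1⦌) p), (∀ i, s i = e) →
    hom.app (op ⦋p⦌) (y, s) = y
  hom_end : ∀ {p : ℕ} (y : Spx X p) (s : Spx (SSet.stdSimplex.obj ⦋1⦌) p), (∀ i, s i ≠ e) →
    A p (hom.app (op ⦋p⦌) (y, s))
  hom_mem : ∀ {p : ℕ} (y : Spx X p) (s : Spx (SSet.stdSimplex.obj ⦋1⦌) p), A p y →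
    A p (hom.app (op ⦋p⦌) (y, s))
  map_mem : ∀ {p q : ℕ} (θ : ⦋p⦌ ⟶ ⦋q⦌) (y : Spx X q), A q y → A p (X.map θ.op y)

lemma map_op_comp_apply (X : SSet.{u}) {a b c : ℕ} (α : ⦋a⦌ ⟶ ⦋b⦌) (β : ⦋b⦌ ⟶ ⦋c⦌)
    (x : Spx X c) : X.map (α ≫ β).op x = X.map α.op (X.map β.op x) := by
  simp

namespace Deformation

variable {A : ∀ p, Spx X p → Prop} {e : Fin 2} (D : Deformation X A e)

/-- The operator underlying the first component of a simplex of `Δ[p] × Δ[1]`. -/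
def fstOp {p m : ℕ} (z : Spx (cyl (SSet.stdSimplex.obj ⦋p⦌)) m) : ⦋m⦌ ⟶ ⦋p⦌ :=
  SSet.stdSimplex.objEquiv z.1

/-- The simplices of the track of the simplex `y` under the deformation. -/
def track {p m : ℕ} (y : Spx X p) (z : Spx (cyl (SSet.stdSimplex.obj ⦋p⦌)) m) : Spx X m :=
  D.hom.app (op ⦋m⦌) ((X.map (fstOp z).op y : Spx X m), z.2)

lemma track_map {p m r : ℕ} (y : Spx X p) (z : Spx (cyl (SSet.stdSimplex.obj ⦋p⦌)) m)
    (ψ : ⦋r⦌ ⟶ ⦋m⦌) :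
    D.track y ((cyl (SSet.stdSimplex.obj ⦋p⦌)).map ψ.op z) = X.map ψ.op (D.track y z) := by
  have h := NatTrans.naturality_apply D.hom ψ.op
    (show (cyl X).obj (op ⦋m⦌) from ((X.map (fstOp z).op y : Spx X m), z.2))
  refine Eq.trans ?_ h
  refine congrArg (D.hom.app (op ⦋r⦌)) (Prod.ext ?_ rfl)
  change X.map (ψ ≫ fstOp z).op y = X.map ψ.op (X.map (fstOp z).op y)
  simp

lemma map_track {p m r : ℕ} (y : Spx X p) (z : Spx (cyl (SSet.stdSimplex.obj ⦋p⦌)) m)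
    (ψ : ⦋r⦌ ⟶ ⦋m⦌) (h : ∀ i, z.2 (ψ.toOrderHom i) = e) :
    X.map ψ.op (D.track y z) = X.map (ψ ≫ fstOp z).op y := by
  rw [← track_map]
  exact D.hom_start _ _ h

lemma track_of_map {p q m : ℕ} (β : ⦋p⦌ ⟶ ⦋q⦌) (y : Spx X q)
    (z : Spx (cyl (SSet.stdSimplex.obj ⦋p⦌)) m) :
    D.track (X.map β.op y) z = D.track y ((SSet.stdSimplex.map β ▷ SSet.stdSimplex.obj ⦋1⦌).app (op ⦋m⦌) z) := by
  refine congrArg (D.hom.app (op ⦋m⦌)) (Prod.ext ?_ rfl)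
  change X.map (fstOp z).op (X.map β.op y) = X.map (fstOp z ≫ β).op y
  simp

variable {S : X.Elementsᵒᵖ ⥤ ModuleCat.{u} k} (hS : ∀ ⦃σ τ⦄ (φ : σ ⟶ τ), IsIso (S.map φ))

/-- Transport of a coefficient from `x` to `y` along a common face `v`. -/
def transport {a b r : ℕ} {x : Spx X a} {y : Spx X b} {v : Spx X r}
    (ψ : ⦋r⦌ ⟶ ⦋a⦌) (χ : ⦋r⦌ ⟶ ⦋b⦌) (hx : X.map ψ.op x = v) (hy : X.map χ.op y = v) :
    S.obj (smp x) ⟶ S.obj (smp y) :=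
  have := hS (arrow ψ hx)
  inv (S.map (arrow ψ hx)) ≫ S.map (arrow χ hy)

lemma transport_face {a b r r' : ℕ} {x : Spx X a} {y : Spx X b} {v : Spx X r} {v' : Spx X r'}
    (ψ : ⦋r⦌ ⟶ ⦋a⦌) (χ : ⦋r⦌ ⟶ ⦋b⦌) (hx : X.map ψ.op x = v) (hy : X.map χ.op y = v)
    (α : ⦋r'⦌ ⟶ ⦋r⦌) (hx' : X.map (α ≫ ψ).op x = v') (hy' : X.map (α ≫ χ).op y = v') :
    transport hS (α ≫ ψ) (α ≫ χ) hx' hy' = transport hS ψ χ hx hy := by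
  have hv : X.map α.op v = v' := by rw [← hx, ← hx']; simp
  have e1 : (arrow (α ≫ ψ) hx' : smp v' ⟶ smp x) = arrow α hv ≫ arrow ψ hx := rfl
  have e2 : (arrow (α ≫ χ) hy' : smp v' ⟶ smp y) = arrow α hv ≫ arrow χ hy := rfl
  have := hS (arrow ψ hx)
  have := hS (arrow (α ≫ ψ) hx')
  rw [transport, transport, IsIso.inv_comp_eq, e1, e2, S.map_comp, S.map_comp, Category.assoc,
    IsIso.hom_inv_id_assoc]

lemma map_transport {a a' b r : ℕ} {x : Spx X a} {x' : Spx X a'} {y : Spx X b} {v : Spx X r}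
    (ψ : ⦋r⦌ ⟶ ⦋a'⦌) (χ : ⦋r⦌ ⟶ ⦋b⦌) (α : ⦋a'⦌ ⟶ ⦋a⦌) (hα : X.map α.op x = x')
    (hx : X.map (ψ ≫ α).op x = v) (hx' : X.map ψ.op x' = v) (hy : X.map χ.op y = v) :
    S.map (arrow α hα) ≫ transport hS (ψ ≫ α) χ hx hy = transport hS ψ χ hx' hy := by
  have e1 : (arrow (ψ ≫ α) hx : smp v ⟶ smp x) = arrow ψ hx' ≫ arrow α hα := rfl
  have := hS (arrow ψ hx')
  have := hS (arrow α hα)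
  have := hS (arrow (ψ ≫ α) hx)
  rw [transport, transport, ← Category.assoc]
  congr 1
  rw [IsIso.comp_inv_eq, e1, S.map_comp, IsIso.inv_hom_id_assoc]

lemma transport_map {a b b' r : ℕ} {x : Spx X a} {y : Spx X b} {y' : Spx X b'} {v : Spx X r}
    (ψ : ⦋r⦌ ⟶ ⦋a⦌) (χ : ⦋r⦌ ⟶ ⦋b'⦌) (β : ⦋b'⦌ ⟶ ⦋b⦌) (hβ : X.map β.op y = y')
    (hx : X.map ψ.op x = v) (hy' : X.map χ.op y' = v) (hy : X.map (χ ≫ β).op y = v) :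
    transport hS ψ χ hx hy' ≫ S.map (arrow β hβ) = transport hS ψ (χ ≫ β) hx hy := by
  have e1 : (arrow (χ ≫ β) hy : smp v ⟶ smp y) = arrow χ hy' ≫ arrow β hβ := rfl
  rw [transport, transport, e1, S.map_comp, Category.assoc]

lemma transport_congr {a b r : ℕ} (c : ∀ x : Spx X a, S.obj (smp x)) {x x' : Spx X a}
    (e : x = x') {y : Spx X b} {v : Spx X r} (ψ : ⦋r⦌ ⟶ ⦋a⦌) (χ : ⦋r⦌ ⟶ ⦋b⦌)
    (hx : X.map ψ.op x = v) (hx' : X.map ψ.op x' = v) (hy : X.map χ.op y = v) :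
    (transport hS ψ χ hx hy).hom (c x) = (transport hS ψ χ hx' hy).hom (c x') := by
  subst e; rfl

lemma transport_self {a r : ℕ} (c : ∀ x : Spx X a, S.obj (smp x)) {x y : Spx X a}
    (e : x = y) {v : Spx X r} (ψ : ⦋r⦌ ⟶ ⦋a⦌)
    (hx : X.map ψ.op x = v) (hy : X.map ψ.op y = v) :
    (transport hS ψ ψ hx hy).hom (c x) = c y := by
  subst e
  have := hS (arrow ψ hx)
  exact hom_apply_eq (IsIso.inv_hom_id (S.map (arrow ψ hx))) (c x)

/-- Transport along a face of the track of a simplex at the initial time. -/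
def trackTransport {p m r : ℕ} (y : Spx X p)
    (z : Spx (cyl (SSet.stdSimplex.obj ⦋p⦌)) m) (ψ : ⦋r⦌ ⟶ ⦋m⦌)
    (h : ∀ i, z.2 (ψ.toOrderHom i) = e) : S.obj (smp (D.track y z)) ⟶ S.obj (smp y) :=
  transport hS ψ (ψ ≫ fstOp z) (D.map_track y z ψ h) rfl

lemma trackTransport_face {p m r r' : ℕ} (y : Spx X p)
    (z : Spx (cyl (SSet.stdSimplex.obj ⦋p⦌)) m) (ψ : ⦋r⦌ ⟶ ⦋m⦌) (α : ⦋r'⦌ ⟶ ⦋r⦌)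
    (h : ∀ i, z.2 (ψ.toOrderHom i) = e) (h' : ∀ i, z.2 ((α ≫ ψ).toOrderHom i) = e) :
    D.trackTransport hS y z (α ≫ ψ) h' = D.trackTransport hS y z ψ h :=
  transport_face hS ψ (ψ ≫ fstOp z) (D.map_track y z ψ h) rfl α
    (D.map_track y z (α ≫ ψ) h') rfl

/-- The inclusion of a vertex. -/
abbrev vertex {m : ℕ} (i : Fin (m + 1)) : ⦋0⦌ ⟶ ⦋m⦌ := SimplexCategory.const ⦋0⦌ ⦋m⦌ i

/-- The edge joining the two vertices has both ends at time `e`, so transport along the whole edge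
is defined, and it equals transport along either of its vertices. Transport to `y` is thus
independent of the chosen vertex. -/
lemma trackTransport_eq_of_le {p m : ℕ} (y : Spx X p)
    (z : Spx (cyl (SSet.stdSimplex.obj ⦋p⦌)) m)
    (i j : Fin (m + 1)) (hi : z.2 i = e) (hj : z.2 j = e) (hij : i ≤ j) :
    D.trackTransport hS y z (vertex i) (fun _ => hi) =
      D.trackTransport hS y z (vertex j) (fun _ => hj) := by
  let ed : ⦋1⦌ ⟶ ⦋m⦌ := SimplexCategory.mkOfLe i j hij
  have hed : ∀ l, z.2 (ed.toOrderHom l) = e := by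
    intro l
    fin_cases l
    exacts [hi, hj]
  have key : ∀ (ψ : ⦋0⦌ ⟶ ⦋m⦌) (l : Fin 2) (hψ : ∀ i, z.2 (ψ.toOrderHom i) = e)
      (_ : ψ = vertex (m := 1) l ≫ ed),
      D.trackTransport hS y z ψ hψ = D.trackTransport hS y z ed hed := by
    rintro _ l hψ rfl
    exact D.trackTransport_face hS y z ed (vertex l) hed hψ
  rw [key (vertex i) 0 (fun _ => hi) (by ext l; rfl), key (vertex j) 1 (fun _ => hj)
    (by ext l; rfl)]

lemma trackTransport_eq {p m : ℕ} (y : Spx X p) (z : Spx (cyl (SSet.stdSimplex.obj ⦋p⦌)) m)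
    (i j : Fin (m + 1)) (hi : z.2 i = e) (hj : z.2 j = e) :
    D.trackTransport hS y z (vertex i) (fun _ => hi) =
      D.trackTransport hS y z (vertex j) (fun _ => hj) := by
  rcases le_total i j with h | h
  · exact D.trackTransport_eq_of_le hS y z i j hi hj h
  · exact (D.trackTransport_eq_of_le hS y z j i hj hi h).symm

variable {m : ℕ} (c : ∀ x : Spx X m, S.obj (smp x))

open Classical in
/-- The values of a cochain on the track of `y`, transported to `y`. -/
def trackVal {p : ℕ} (y : Spx X p) (z : Spx (cyl (SSet.stdSimplex.obj ⦋p⦌)) m) :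
    S.obj (smp y) :=
  -- The default value zero is forced: with no vertex at time `e` the track lies in `A`, where the
  -- cochains to be contracted vanish.
  if h : ∃ i, z.2 i = e then
    (D.trackTransport hS y z (vertex h.choose) (fun _ => h.choose_spec)).hom (c (D.track y z))
  else 0

lemma trackVal_eq {p : ℕ} (y : Spx X p) (z : Spx (cyl (SSet.stdSimplex.obj ⦋p⦌)) m)
    (i : Fin (m + 1)) (hi : z.2 i = e) :
    D.trackVal hS c y z =
      (D.trackTransport hS y z (vertex i) (fun _ => hi)).hom (c (D.track y z)) := by
  have h : ∃ i, z.2 i = e := ⟨i, hi⟩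
  rw [trackVal, dif_pos h, D.trackTransport_eq hS y z _ i h.choose_spec hi]

lemma trackVal_eq_zero {p : ℕ} (y : Spx X p) (z : Spx (cyl (SSet.stdSimplex.obj ⦋p⦌)) m)
    (h : c (D.track y z) = 0) : D.trackVal hS c y z = 0 := by
  rw [trackVal]
  split_ifs
  · rw [h, map_zero]
  · rfl

lemma track_mem {p m : ℕ} (y : Spx X p) (z : Spx (cyl (SSet.stdSimplex.obj ⦋p⦌)) m)
    (h : ∀ i, z.2 i ≠ e) : A m (D.track y z) :=
  D.hom_end _ _ h

/-- If the face has a vertex at time `e`, transport can be computed there for both the face and `z`.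
If it has none, the face of the track lies in `A` and both sides vanish. -/
lemma trackVal_map (hc : ∀ x, A m x → c x = 0) {p n : ℕ} (y : Spx X p)
    (z : Spx (cyl (SSet.stdSimplex.obj ⦋p⦌)) n) (α : ⦋m⦌ ⟶ ⦋n⦌) (i : Fin (n + 1))
    (hi : z.2 i = e) :
    D.trackVal hS c y ((cyl (SSet.stdSimplex.obj ⦋p⦌)).map α.op z) =
      (D.trackTransport hS y z (vertex i) (fun _ => hi)).hom
        ((S.map (arrow α rfl)).hom (c (X.map α.op (D.track y z)))) := by
  have ht := D.track_map y z α
  by_cases h : ∃ j, z.2 (α.toOrderHom j) = e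
  · obtain ⟨j, hj⟩ := h
    rw [D.trackVal_eq hS c y _ j hj, D.trackTransport_eq hS y z i (α.toOrderHom j) hi hj]
    refine Eq.trans ?_ (hom_apply_eq (map_transport hS (a := n) (a' := m) (b := p) (r := 0)
      (x := D.track y z) (x' := X.map α.op (D.track y z)) (y := y)
      (vertex j) (vertex (α.toOrderHom j) ≫ fstOp z) α rfl
      (D.map_track y z (vertex (α.toOrderHom j)) (fun _ => hj))
      (by rw [← D.map_track y z (vertex (α.toOrderHom j)) (fun _ => hj)]
          exact (map_op_comp_apply X (vertex j) α _).symm) rfl) _).symm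
    exact transport_congr hS c ht _ _ _ _ _
  · have h0 : c (X.map α.op (D.track y z)) = 0 := by
      apply hc
      rw [← ht]
      exact D.track_mem y _ fun j hj => h ⟨j, hj⟩
    rw [h0, map_zero, map_zero]
    exact D.trackVal_eq_zero hS c y _ (by rw [ht, h0])

/-- Transport trivialises the coefficients along the track of `y`, so a twisted cocycle becomes an
ordinary cocycle on the prism with values in the single space `S.obj (smp y)`. -/
lemma sum_trackVal_faces (hc : ∀ x, A m x → c x = 0)
    (hd : ∀ w : Spx X (m + 1), ∑ j : Fin (m + 2), (-1 : ℤ) ^ (j : ℕ) •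
      (S.map (arrow (SimplexCategory.δ j) rfl)).hom
        (c (X.map (SimplexCategory.δ j).op w)) = 0) {p : ℕ} (y : Spx X p)
    (z : Spx (cyl (SSet.stdSimplex.obj ⦋p⦌)) (m + 1)) :
    ∑ j : Fin (m + 2), (-1 : ℤ) ^ (j : ℕ) •
      D.trackVal hS c y ((cyl (SSet.stdSimplex.obj ⦋p⦌)).map (SimplexCategory.δ j).op z) = 0 := by
  by_cases h : ∃ i, z.2 i = e
  · obtain ⟨i, hi⟩ := h
    have := congrArg (D.trackTransport hS y z (vertex i) (fun _ => hi)).hom (hd (D.track y z))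
    rw [map_zero, map_sum] at this
    rw [← this]
    exact Finset.sum_congr rfl fun j _ => by rw [D.trackVal_map hS c hc y z _ i hi, map_zsmul]
  · refine Finset.sum_eq_zero fun j _ => ?_
    rw [D.trackVal_eq_zero hS c, smul_zero]
    exact hc _ (D.track_mem y _ fun i hi => h ⟨_, hi⟩)

/-- The track of a face is the restriction of the track, and transport to the face followed by the
structure map of `S` is transport to `y`. This identifies the side terms of the prism identity with
values of the contraction on the faces of `y`. -/
lemma map_trackVal {p q : ℕ} (β : ⦋p⦌ ⟶ ⦋q⦌) (y : Spx X q)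
    (z : Spx (cyl (SSet.stdSimplex.obj ⦋p⦌)) m) :
    (S.map (arrow β rfl)).hom (D.trackVal hS c (X.map β.op y) z) =
      D.trackVal hS c y ((SSet.stdSimplex.map β ▷ SSet.stdSimplex.obj ⦋1⦌).app (op ⦋m⦌) z) := by
  have ht := D.track_of_map β y z
  by_cases h : ∃ i, z.2 i = e
  · obtain ⟨i, hi⟩ := h
    rw [D.trackVal_eq hS c _ z i hi, D.trackVal_eq hS c y
      ((SSet.stdSimplex.map β ▷ SSet.stdSimplex.obj ⦋1⦌).app (op ⦋m⦌) z) i hi]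
    refine (hom_apply_eq (transport_map hS (vertex i) (vertex i ≫ fstOp z) β rfl
      (D.map_track _ z (vertex i) (fun _ => hi)) rfl (by
        exact map_op_comp_apply X _ β y)) _).trans ?_
    refine (transport_congr hS c ht _ _ _ ?_ _).trans ?_
    · rw [← ht]; exact D.map_track _ z (vertex i) (fun _ => hi)
    have : ∀ {v v' : Spx X 0} (hv : v = v') (ψ : ⦋0⦌ ⟶ ⦋m⦌) (χ : ⦋0⦌ ⟶ ⦋q⦌) {x : Spx X m}
        (hx : X.map ψ.op x = v) (hx' : X.map ψ.op x = v') (hy : X.map χ.op y = v)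
        (hy' : X.map χ.op y = v'), transport hS ψ χ hx hy = transport hS ψ χ hx' hy' := by
      rintro v _ rfl ψ χ x _ _ _ _; rfl
    refine hom_apply_eq (this ?_ _ _ _ _ _ _) _
    exact (map_op_comp_apply X _ β y).symm
  · have e1 : D.trackVal hS c (X.map β.op y) z = 0 := dif_neg h
    have e2 : D.trackVal hS c y
      ((SSet.stdSimplex.map β ▷ SSet.stdSimplex.obj ⦋1⦌).app (op ⦋m⦌) z) = 0 := dif_neg h
    rw [e1, e2, map_zero]

lemma trackVal_start (y : Spx X m) (z : Spx (cyl (SSet.stdSimplex.obj ⦋m⦌)) m)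
    (hz : fstOp z = 𝟙 _) (h : ∀ i, z.2 i = e) : D.trackVal hS c y z = c y := by
  have hy : X.map (𝟙 ⦋m⦌ : ⦋m⦌ ⟶ ⦋m⦌).op y = y := by simp
  have ht : D.track y z = y := by
    rw [track, hz, hy]
    exact D.hom_start _ _ h
  rw [D.trackVal_eq hS c y z 0 (h 0)]
  have : ∀ (χ : ⦋0⦌ ⟶ ⦋m⦌) (hχ : χ = vertex 0) (hx : X.map (vertex 0).op (D.track y z) =
      X.map χ.op y), (transport hS (vertex 0) χ hx rfl).hom (c (D.track y z)) = c y := by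
    rintro _ rfl hx
    exact transport_self hS c ht _ _ _
  exact this _ (by rw [hz]; rfl) _

lemma trackVal_end (hc : ∀ x, A m x → c x = 0) {p : ℕ} (y : Spx X p)
    (z : Spx (cyl (SSet.stdSimplex.obj ⦋p⦌)) m) (h : ∀ i, z.2 i ≠ e) :
    D.trackVal hS c y z = 0 :=
  D.trackVal_eq_zero hS c y z (hc _ (D.track_mem y z h))

lemma trackVal_mem (hc : ∀ x, A m x → c x = 0) {p : ℕ} (y : Spx X p) (hy : A p y)
    (z : Spx (cyl (SSet.stdSimplex.obj ⦋p⦌)) m) : D.trackVal hS c y z = 0 :=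
  D.trackVal_eq_zero hS c y z (hc _ (D.hom_mem _ _ (D.map_mem _ _ hy)))

end Deformation

end Contraction

/-! ### The prism identity with values in a vector space. -/

section PrismModules

/-- The prism identity in positive degrees, for cochains with values in a vector space. -/
lemma prism_succ_module (k : Type u) [Field k] {V : Type*} [AddCommGroup V] [Module k V]
    {Z W : SSet.{u}} {f g : Z ⟶ W} (H : SimplicialObject.Homotopy f g) (N : ℕ)
    (c : Spx W (N + 1) → V) (y : Spx Z (N + 1)) :
    c (f.app _ y) - c (g.app _ y) =
      -(∑ j : Fin (N + 2), (-1 : ℤ) ^ (j : ℕ) • ∑ x : Fin (N + 1), ((-1 : ℤ) ^ (x : ℕ) •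
          c (H.h x (Z.map (SimplexCategory.δ j).op y)))) -
        ∑ j : Fin (N + 2), (-1 : ℤ) ^ (j : ℕ) • ∑ x : Fin (N + 3), ((-1 : ℤ) ^ (x : ℕ) •
          c (W.map (SimplexCategory.δ x).op (H.h j y))) := by
  -- Functionals separate the points of `V`, which reduces the identity to scalar cochains.
  rw [← sub_eq_zero, ← Module.forall_dual_apply_eq_zero_iff k]
  intro φ
  have h := prism_succ H N (φ ∘ c) y
  rw [Finset.sum_comm, Finset.sum_comm (s := (Finset.univ : Finset (Fin (N + 3))))] at h
  rw [map_sub, sub_eq_zero]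
  simp only [map_sub, map_neg, map_sum, map_zsmul, zsmul_eq_mul, Finset.mul_sum]
  push_cast
  exact h

/-- The prism identity in degree zero, for cochains with values in a vector space. -/
lemma prism_zero_module (k : Type u) [Field k] {V : Type*} [AddCommGroup V] [Module k V]
    {Z W : SSet.{u}} {f g : Z ⟶ W} (H : SimplicialObject.Homotopy f g)
    (c : Spx W 0 → V) (y : Spx Z 0) :
    c (f.app _ y) - c (g.app _ y) =
      -∑ x : Fin 2, (-1 : ℤ) ^ (x : ℕ) • c (W.map (SimplexCategory.δ x).op (H.h 0 y)) := by
  rw [← sub_eq_zero, ← Module.forall_dual_apply_eq_zero_iff k]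
  intro φ
  have h := prism_zero H (φ ∘ c) y
  rw [map_sub, sub_eq_zero]
  simp only [map_sub, map_neg, map_sum, map_zsmul, zsmul_eq_mul]
  push_cast
  exact h

end PrismModules

/-! ### Contraction of cochains with values in a local system of vector spaces. -/

namespace Deformation

variable {k : Type u} [Field k] {X : SSet.{u}}
  {A : ∀ p, Spx X p → Prop} {e : Fin 2} (D : Deformation X A e)
  {S : X.Elementsᵒᵖ ⥤ ModuleCat.{u} k} (hS : ∀ ⦃σ τ⦄ (φ : σ ⟶ τ), IsIso (S.map φ))

/-- The fundamental simplex of the standard simplex. -/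
abbrev idSpx (p : ℕ) : Spx (SSet.stdSimplex.obj ⦋p⦌ : SSet.{u}) p :=
  SSet.stdSimplex.objEquiv.symm (𝟙 _)

/-- The top-dimensional simplices of the prism. -/
abbrev prismSpx (p : ℕ) (i : Fin (p + 1)) :
    Spx (cyl (SSet.stdSimplex.obj ⦋p⦌ : SSet.{u})) (p + 1) :=
  (cylHomotopy (SSet.stdSimplex.obj ⦋p⦌)).toSimplicialObjectHomotopy.h i (idSpx p)

/-- The prism decomposition is natural in the base simplex. This is needed to compare the prism over
a face of `Δ[q]` with the prism over the standard simplex of that face. -/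
lemma map_prismSpx {p q : ℕ} (β : ⦋p⦌ ⟶ ⦋q⦌) (i : Fin (p + 1)) :
    (SSet.stdSimplex.map β ▷ SSet.stdSimplex.obj ⦋1⦌).app (op ⦋p + 1⦌) (prismSpx p i) =
      (cylHomotopy (SSet.stdSimplex.obj ⦋q⦌ : SSet.{u})).toSimplicialObjectHomotopy.h i
        ((SSet.stdSimplex.obj ⦋q⦌).map β.op (idSpx q)) := by
  have h1 : SSet.yonedaEquiv.symm (idSpx p) = 𝟙 (SSet.stdSimplex.obj ⦋p⦌ : SSet.{u}) :=
    SSet.yonedaEquiv_symm_stdSimplex_id ⦋p⦌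
  have h2 : SSet.yonedaEquiv.symm ((SSet.stdSimplex.obj ⦋q⦌).map β.op (idSpx q)) =
      (SSet.stdSimplex.map β : _ ⟶ (SSet.stdSimplex.obj ⦋q⦌ : SSet.{u})) := by
    rw [Equiv.symm_apply_eq, SSet.yonedaEquiv_map]
    exact congrArg SSet.stdSimplex.objEquiv.symm (Category.comp_id β)
  change _ = ((SSet.yonedaEquiv.symm ((SSet.stdSimplex.obj ⦋q⦌).map β.op (idSpx q)) ▷
    SSet.stdSimplex.obj ⦋1⦌) ≫ 𝟙 _).app _ (SSet.prodStdSimplex.nonDegenerateEquiv₁ i).1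
  rw [h2]
  change (SSet.stdSimplex.map β ▷ SSet.stdSimplex.obj ⦋1⦌).app (op ⦋p + 1⦌)
    (((SSet.yonedaEquiv.symm (idSpx p) ▷
    SSet.stdSimplex.obj ⦋1⦌) ≫ 𝟙 _).app _ (SSet.prodStdSimplex.nonDegenerateEquiv₁ i).1) = _
  rw [h1]
  rfl

/-- The value at `x` of the contraction of a cochain along a deformation. -/
def contract {p : ℕ} (c : ∀ x : Spx X (p + 1), S.obj (smp x)) (x : Spx X p) :
    S.obj (smp x) :=
  ∑ i : Fin (p + 1), (-1 : ℤ) ^ (i : ℕ) • D.trackVal hS c x (prismSpx p i)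

/-- The prism identity is applied to the values of `c` along the track of `y`. The coboundary term
vanishes since `c` is a cocycle, the side terms form the coboundary of `contract`, and the two ends
give `c y` and zero. The contraction vanishes on `A` because the deformation preserves `A`. -/
lemma exists_of_coboundary_eq_zero (D : Deformation X A e)
    (hS : ∀ ⦃σ τ⦄ (φ : σ ⟶ τ), IsIso (S.map φ)) {p : ℕ} (c : ∀ x : Spx X (p + 1), S.obj (smp x))
    (hc : ∀ x, A (p + 1) x → c x = 0)
    (hd : ∀ w : Spx X (p + 2), ∑ j : Fin (p + 3), (-1 : ℤ) ^ (j : ℕ) •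
      (S.map (arrow (SimplexCategory.δ j) rfl)).hom
        (c (X.map (SimplexCategory.δ j).op w)) = 0) :
    ∃ b : ∀ x : Spx X p, S.obj (smp x), (∀ x, A p x → b x = 0) ∧
      ∀ y : Spx X (p + 1), ∑ j : Fin (p + 2), (-1 : ℤ) ^ (j : ℕ) •
        (S.map (arrow (SimplexCategory.δ j) rfl)).hom
          (b (X.map (SimplexCategory.δ j).op y)) = c y := by
  have hA : ∀ x, A p x → D.contract hS c x = 0 := fun x hx => by
    refine Finset.sum_eq_zero fun i _ => ?_
    rw [D.trackVal_mem hS c hc x hx, smul_zero]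
  have key : ∀ y : Spx X (p + 1),
      D.trackVal hS c y ((SSet.ι₀ : _ ⟶ cyl (SSet.stdSimplex.obj ⦋p + 1⦌)).app _ (idSpx (p + 1))) -
      D.trackVal hS c y ((SSet.ι₁ : _ ⟶ cyl (SSet.stdSimplex.obj ⦋p + 1⦌)).app _ (idSpx (p + 1)))
      = -(∑ j : Fin (p + 2), (-1 : ℤ) ^ (j : ℕ) •
        (S.map (arrow (SimplexCategory.δ j) rfl)).hom
          (D.contract hS c (X.map (SimplexCategory.δ j).op y))) := by
    intro y
    rw [prism_succ_module k
      (cylHomotopy (SSet.stdSimplex.obj ⦋p + 1⦌)).toSimplicialObjectHomotopy p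
      (D.trackVal hS c y) (idSpx (p + 1))]
    rw [Finset.sum_eq_zero (f := fun j : Fin (p + 2) => (-1 : ℤ) ^ (j : ℕ) • ∑ x : Fin (p + 3), _),
      sub_zero]
    · congr 1
      refine Finset.sum_congr rfl fun j _ => ?_
      congr 1
      rw [contract, map_sum]
      refine Finset.sum_congr rfl fun i _ => ?_
      rw [map_zsmul, D.map_trackVal hS c, map_prismSpx]
    · intro j _
      rw [D.sum_trackVal_faces hS c hc hd, smul_zero]
  match e, D with
  -- The sign of the primitive depends on the direction: `c y` is the value at the end `ι₀`, which
  -- enters with a plus sign, when `e = 0`, and at `ι₁`, which enters with a minus sign, when `e =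
  -- 1`.
  | 0, D =>
    refine ⟨fun x => - D.contract hS c x, fun x hx => neg_eq_zero.2 (hA x hx), fun y => ?_⟩
    have h := key y
    rw [D.trackVal_start hS c y _ rfl (fun _ => rfl),
      D.trackVal_end hS c hc y ((SSet.ι₁ : _ ⟶ cyl (SSet.stdSimplex.obj ⦋p + 1⦌)).app _ (idSpx (p + 1)))
        (fun _ => Fin.zero_ne_one.symm), sub_zero] at h
    rw [h, ← Finset.sum_neg_distrib]
    exact Finset.sum_congr rfl fun j _ => by rw [map_neg, smul_neg]
  | 1, D =>
    refine ⟨fun x => D.contract hS c x, hA, fun y => ?_⟩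
    have h := key y
    rw [D.trackVal_start hS c y
        ((SSet.ι₁ : _ ⟶ cyl (SSet.stdSimplex.obj ⦋p + 1⦌)).app _ (idSpx (p + 1))) rfl (fun _ => rfl),
      D.trackVal_end hS c hc y ((SSet.ι₀ : _ ⟶ cyl (SSet.stdSimplex.obj ⦋p + 1⦌)).app _ (idSpx (p + 1)))
        (fun _ => Fin.zero_ne_one), zero_sub, neg_inj] at h
    exact h.symm

/-- In degree zero the prism identity has no side terms, so the two ends agree; one is `c y` and the
other is zero. -/
lemma eq_zero_of_coboundary_eq_zero (D : Deformation X A e)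
    (hS : ∀ ⦃σ τ⦄ (φ : σ ⟶ τ), IsIso (S.map φ)) (c : ∀ x : Spx X 0, S.obj (smp x))
    (hc : ∀ x, A 0 x → c x = 0)
    (hd : ∀ w : Spx X 1, ∑ j : Fin 2, (-1 : ℤ) ^ (j : ℕ) •
      (S.map (arrow (SimplexCategory.δ j) rfl)).hom
        (c (X.map (SimplexCategory.δ j).op w)) = 0) (y : Spx X 0) : c y = 0 := by
  have key : 
      D.trackVal hS c y ((SSet.ι₀ : _ ⟶ cyl (SSet.stdSimplex.obj ⦋0⦌)).app _ (idSpx 0)) -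
      D.trackVal hS c y ((SSet.ι₁ : _ ⟶ cyl (SSet.stdSimplex.obj ⦋0⦌)).app _ (idSpx 0)) = 0 := by
    rw [prism_zero_module k
      (cylHomotopy (SSet.stdSimplex.obj ⦋0⦌)).toSimplicialObjectHomotopy
      (D.trackVal hS c y) (idSpx 0), D.sum_trackVal_faces hS c hc hd, neg_zero]
  match e, D with
  | 0, D =>
    rwa [D.trackVal_start hS c y _ rfl (fun _ => rfl),
      D.trackVal_end hS c hc y ((SSet.ι₁ : _ ⟶ cyl (SSet.stdSimplex.obj ⦋0⦌)).app _ (idSpx 0))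
        (fun _ => Fin.zero_ne_one.symm), sub_zero] at key
  | 1, D =>
    rwa [D.trackVal_start hS c y
        ((SSet.ι₁ : _ ⟶ cyl (SSet.stdSimplex.obj ⦋0⦌)).app _ (idSpx 0)) rfl (fun _ => rfl),
      D.trackVal_end hS c hc y ((SSet.ι₀ : _ ⟶ cyl (SSet.stdSimplex.obj ⦋0⦌)).app _ (idSpx 0))
        (fun _ => Fin.zero_ne_one), zero_sub, neg_eq_zero] at key

end Deformation

/-! ### Vanishing conditions on total cochains and the simplicial filtration. -/

section Sections

variable {k : Type u} [Field k] {X : SSet.{u}} {E : Coeff k X}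

/-- A cochain vanishes on the simplices satisfying a predicate. -/
def Sec.VanishesOn {n : ℤ} (α : Sec E n) (A : ∀ p, Spx X p → Prop) : Prop :=
  ∀ (t : Bideg n) (σ : Spx X t.p), A t.p σ → α t σ = 0

/-- A cochain vanishes in simplicial degrees less than `p`. -/
def Sec.VanishesBelow {n : ℤ} (α : Sec E n) (p : ℕ) : Prop :=
  ∀ t : Bideg n, t.p < p → α t = 0

lemma Sec.D_add {n n' : ℤ} (hn : n + 1 = n') (α β : Sec E n) :
    (α + β).D hn = α.D hn + β.D hn := (Sec.dLin E hn).map_add α β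

lemma Sec.D_sub {n n' : ℤ} (hn : n + 1 = n') (α β : Sec E n) :
    (α - β).D hn = α.D hn - β.D hn := (Sec.dLin E hn).map_sub α β

lemma Sec.D_neg {n n' : ℤ} (hn : n + 1 = n') (α : Sec E n) :
    (-α).D hn = -(α.D hn) := (Sec.dLin E hn).map_neg α

lemma Sec.D_sum {ι : Type*} (s : Finset ι) {n n' : ℤ} (hn : n + 1 = n') (α : ι → Sec E n) :
    (∑ i ∈ s, α i).D hn = ∑ i ∈ s, (α i).D hn := map_sum (Sec.dLin E hn) α s

lemma Sec.D_of_zero {n n' : ℤ} (hn : n + 1 = n') : (0 : Sec E n).D hn = 0 :=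
  (Sec.dLin E hn).map_zero

lemma Sec.ev_eq_zero {n : ℤ} {α : Sec E n} {p N : ℕ} (q : ℤ) (h : (p : ℤ) + q = n)
    (θ : ⦋p⦌ ⟶ ⦋N⦌) (σ : Spx X N) (h0 : α ⟨p, q, h⟩ (X.map θ.op σ) = 0) :
    α.ev q h θ σ = 0 := by
  rw [Sec.ev, h0, map_zero]

/-- The value of `D` on `σ` involves only values of the cochain on `σ` and its faces, in the same
simplicial degree or one less. This locality serves both the vanishing on `A` and the filtration. -/
lemma Sec.D_eq_zero {n n' : ℤ} (hn : n + 1 = n') {α : Sec E n} (t : Bideg n') (σ : Spx X t.p)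
    (h : ∀ s : Bideg n, s.p = t.p → ∀ θ : ⦋s.p⦌ ⟶ ⦋t.p⦌, α s (X.map θ.op σ) = 0)
    (h' : ∀ s : Bideg n, s.p + 1 = t.p → ∀ θ : ⦋s.p⦌ ⟶ ⦋t.p⦌, α s (X.map θ.op σ) = 0) :
    α.D hn t σ = 0 := by
  obtain ⟨p, q, hq⟩ := t
  have h0 : α ⟨p, q - 1, by omega⟩ σ = 0 := by
    have h1 := h ⟨p, q - 1, by omega⟩ rfl (𝟙 _)
    have e : X.map (𝟙 ⦋p⦌ : ⦋p⦌ ⟶ ⦋p⦌).op σ = σ := by simp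
    rwa [e] at h1
  cases p with
  | zero => rw [Sec.D_zero hn α q (q - 1) hq (by omega), h0, map_zero]
  | succ p =>
    rw [Sec.D_succ hn α p q (q - 1) hq (by omega), h0, map_zero, smul_zero, add_zero]
    refine Finset.sum_eq_zero fun i _ => ?_
    rw [Sec.ev_eq_zero q _ _ σ (h' ⟨p, q, by push_cast at hq; omega⟩ rfl _), smul_zero]

lemma Sec.VanishesBelow.D_eq_zero {n n' : ℤ} (hn : n + 1 = n') {α : Sec E n} {p : ℕ}
    (hα : α.VanishesBelow p) : (α.D hn).VanishesBelow p := fun t ht => funext fun σ =>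
  Sec.D_eq_zero hn t σ (fun s hs θ => congrFun (hα s (by omega)) _)
    (fun s hs θ => congrFun (hα s (by omega)) _)

lemma Sec.VanishesOn.D {A : ∀ p, Spx X p → Prop}
    (hA : ∀ {p q : ℕ} (θ : ⦋p⦌ ⟶ ⦋q⦌) (y : Spx X q), A q y → A p (X.map θ.op y))
    {n n' : ℤ} (hn : n + 1 = n') {α : Sec E n} (hα : α.VanishesOn A) :
    (α.D hn).VanishesOn A := fun t σ hσ =>
  Sec.D_eq_zero hn t σ (fun s _ θ => hα s _ (hA θ σ hσ)) (fun s _ θ => hα s _ (hA θ σ hσ))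

lemma Sec.VanishesOn.sub {A : ∀ p, Spx X p → Prop} {n : ℤ} {α β : Sec E n}
    (hα : α.VanishesOn A) (hβ : β.VanishesOn A) : (α - β).VanishesOn A := fun t σ hσ => by
  rw [Pi.sub_apply, Pi.sub_apply, hα t σ hσ, hβ t σ hσ, sub_zero]

/-- The cochain concentrated in a given bidegree. -/
def Sec.single {n : ℤ} (p : ℕ) (q : ℤ) (h : (p : ℤ) + q = n)
    (x : ∀ σ : Spx X p, ((E.obj (smp σ)).X q : Type u)) : Sec E n
  | ⟨p', q', h'⟩, σ => if e : p' = p then by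
      subst e
      obtain rfl : q' = q := by omega
      exact x σ
    else 0

lemma Sec.single_self {n : ℤ} (p : ℕ) (q : ℤ) (h : (p : ℤ) + q = n)
    (x : ∀ σ : Spx X p, ((E.obj (smp σ)).X q : Type u)) (h' : (p : ℤ) + q = n) :
    Sec.single p q h x ⟨p, q, h'⟩ = x := by
  funext σ
  exact dif_pos rfl

lemma Sec.single_of_ne {n : ℤ} (p : ℕ) (q : ℤ) (h : (p : ℤ) + q = n)
    (x : ∀ σ : Spx X p, ((E.obj (smp σ)).X q : Type u)) (t : Bideg n) (ht : t.p ≠ p) :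
    Sec.single p q h x t = 0 := by
  funext σ
  exact dif_neg ht

lemma Sec.single_vanishesOn {A : ∀ p, Spx X p → Prop} {n : ℤ} (p : ℕ) (q : ℤ)
    (h : (p : ℤ) + q = n) (x : ∀ σ : Spx X p, ((E.obj (smp σ)).X q : Type u))
    (hx : ∀ σ, A p σ → x σ = 0) : (Sec.single p q h x).VanishesOn A := by
  rintro ⟨p', q', h'⟩ σ hσ
  by_cases e : p' = p
  · subst e
    obtain rfl : q' = q := by omega
    rw [Sec.single_self, hx σ hσ]
  · rw [Sec.single_of_ne (ht := e)]
    rfl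

end Sections

lemma sum_zsmul_cls {k : Type u} [Field k] (A : Cpx k) {n n₁ : ℤ} (h : n + 1 = n₁) {ι : Type*}
    (s : Finset ι) (ε : ι → ℤ) (x : ι → LinearMap.ker (A.d n n₁).hom) :
    ∑ j ∈ s, ε j • cls A h (x j) = cls A h (∑ j ∈ s, ε j • x j) := by
  simp only [map_sum, map_zsmul]

lemma eq_zero_of_neg_one_pow_zsmul {M : Type*} [AddCommGroup M] {p : ℕ} {x : M}
    (h : (-1 : ℤ) ^ p • x = 0) : x = 0 := by
  have h1 := congrArg (fun y => (-1 : ℤ) ^ p • y) h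
  simpa [smul_smul, ← mul_pow] using h1

/-! ### Contraction of cochains with values in a local system of complexes. -/

namespace Deformation

variable {k : Type u} [Field k] {X : SSet.{u}}
  {A : ∀ p, Spx X p → Prop} {e : Fin 2} {E : Coeff k X}

/-- Internal primitives are chosen simplex by simplex, zero on `A`, and placed in a single bidegree.
The factor `(-1)^p` cancels the sign of the internal differential in `D`. -/
lemma exists_primitive_of_cls_eq_zero {n₁ n : ℤ} {p : ℕ} {q₀ q : ℤ} (hq : q₀ + 1 = q)
    (hn : n + 1 = n₁) (h : (p : ℤ) + q = n₁) {α : Sec E n₁} (hα : α.VanishesOn A)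
    (hex : ∀ σ : Spx X p, ∃ y, ((E.obj (smp σ)).d q₀ q).hom y = α ⟨p, q, h⟩ σ) :
    ∃ β : Sec E n, β.VanishesOn A ∧ β.VanishesBelow p ∧ (β.D hn) ⟨p, q, h⟩ = α ⟨p, q, h⟩ := by
  have hex' : ∀ σ : Spx X p, ∃ y, ((E.obj (smp σ)).d q₀ q).hom y = α ⟨p, q, h⟩ σ ∧
      (A p σ → y = 0) := by
    intro σ
    by_cases hσ : A p σ
    · exact ⟨0, (map_zero _).trans (hα ⟨p, q, h⟩ σ hσ).symm, fun _ => rfl⟩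
    · obtain ⟨y, hy⟩ := hex σ
      exact ⟨y, hy, fun h => (hσ h).elim⟩
  choose y hy hyA using hex'
  have hs : ∀ h' σ, Sec.single p q₀ (by omega) (fun σ => (-1 : ℤ) ^ p • y σ) ⟨p, q₀, h'⟩ σ =
    (-1 : ℤ) ^ p • y σ := fun h' σ =>
      congrFun (Sec.single_self (n := n) p q₀ (by omega) _ h') σ
  refine ⟨Sec.single p q₀ (by omega) (fun σ => (-1 : ℤ) ^ p • y σ), ?_, ?_, ?_⟩
  · exact Sec.single_vanishesOn _ _ _ _ fun σ hσ => by rw [hyA σ hσ, smul_zero]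
  · exact fun t ht => Sec.single_of_ne _ _ _ _ t (by omega)
  · funext σ
    cases p with
    | zero =>
      rw [Sec.D_zero hn _ q q₀ h hq, hs, pow_zero, one_smul, hy]
    | succ p =>
      rw [Sec.D_succ hn _ p q q₀ h hq, hs, Finset.sum_eq_zero, zero_add, map_zsmul, smul_smul,
        ← mul_pow, hy]
      · simp
      · intro i _
        rw [Sec.ev_eq_zero, smul_zero]
        rw [Sec.single_of_ne (ht := by simp)]
        rfl

/-- The lowest component of `α` is an internal cocycle, and its classes form a cocycle in the local
system `H^q(E)` which vanishes on `A`. In simplicial degree zero these classes vanish; otherwise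
they bound a cochain `b` one degree lower. Lifting `b` to internal cocycles `β₁` makes the remaining
component internally exact, and `β₂` removes it. Hence the correction may start in simplicial degree
`p - 1`, truncated at zero. -/
lemma exists_primitive_step (D : Deformation X A e) (hE : E.IsLocallyConstant) {n n₁ n₂ : ℤ}
    (hn : n + 1 = n₁) (hn₁ : n₁ + 1 = n₂) (p : ℕ) {α : Sec E n₁} (hα : α.VanishesOn A)
    (hd : α.D hn₁ = 0) (hp : α.VanishesBelow p) :
    ∃ β : Sec E n, β.VanishesOn A ∧ β.VanishesBelow (p - 1) ∧
      (α - β.D hn).VanishesBelow (p + 1) := by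
  obtain ⟨q, hq⟩ : ∃ q : ℤ, (p : ℤ) + q = n₁ := ⟨n₁ - p, by omega⟩
  let S : X.Elementsᵒᵖ ⥤ ModuleCat.{u} k := E ⋙ HomologicalComplex.homologyFunctor _ _ q
  have hS : ∀ ⦃σ τ⦄ (φ : σ ⟶ τ), IsIso (S.map φ) := fun σ τ φ => by
    have := hE φ
    exact (inferInstance : IsIso (HomologicalComplex.homologyMap (E.map φ) q))
  have hcyc : ∀ σ : Spx X p, ((E.obj (smp σ)).d q (q + 1)).hom (α ⟨p, q, hq⟩ σ) = 0 := by
    intro σ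
    have h := congrFun (congrFun hd ⟨p, q + 1, by omega⟩) σ
    cases p with
    | zero => rwa [Sec.D_zero hn₁ α (q + 1) q (by omega) rfl] at h
    | succ p =>
      rw [Sec.D_succ hn₁ α p (q + 1) q (by omega) rfl, Finset.sum_eq_zero, zero_add] at h
      · exact eq_zero_of_neg_one_pow_zsmul h
      · intro i _
        rw [Sec.ev_eq_zero, smul_zero]
        rw [hp _ (by simp)]
        rfl
  let c : ∀ σ : Spx X p, S.obj (smp σ) := fun σ => cls (E.obj (smp σ)) rfl ⟨_, hcyc σ⟩
  have hc : ∀ σ, A p σ → c σ = 0 := fun σ hσ => by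
    refine (cls_eq_zero_iff _ (sub_add_cancel q 1) rfl _).2
      ⟨0, (map_zero _).trans (hα ⟨p, q, hq⟩ σ hσ).symm⟩
  have hSc : ∀ {r : ℕ} (θ : ⦋p⦌ ⟶ ⦋r⦌) (w : Spx X r),
      ∃ h, (S.map (arrow θ rfl)).hom (c (X.map θ.op w)) =
        cls (E.obj (smp w)) rfl ⟨α.ev q hq θ w, h⟩ := fun θ w =>
    ⟨_, homologyMap_cls (E.map (arrow θ rfl)) rfl ⟨_, hcyc _⟩⟩
  have hdc : ∀ w : Spx X (p + 1), ∑ j : Fin (p + 2), (-1 : ℤ) ^ (j : ℕ) •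
      (S.map (arrow (SimplexCategory.δ j) rfl)).hom
        (c (X.map (SimplexCategory.δ j).op w)) = 0 := by
    intro w
    choose hj hcj using fun j : Fin (p + 2) => hSc (SimplexCategory.δ j) w
    -- The alternating sum of the components of `α` need not vanish: this component of `D α = 0`
    -- exhibits it as an internal coboundary, which suffices for classes.
    have h := congrFun (congrFun hd ⟨p + 1, q, by push_cast; omega⟩) w
    rw [Sec.D_succ hn₁ α p q (q - 1) (by push_cast; omega) (by omega)] at h
    refine (Finset.sum_congr rfl fun (j : Fin (p + 2)) _ => congrArg (fun y => (-1 : ℤ) ^ (j : ℕ) • y)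
      (hcj j)).trans ((sum_zsmul_cls _ _ _ _ _).trans ?_)
    refine (cls_eq_zero_iff _ (sub_add_cancel q 1) rfl _).2
      ⟨-((-1 : ℤ) ^ (p + 1) • α ⟨p + 1, q - 1, by push_cast; omega⟩ w), ?_⟩
    rw [map_neg, map_zsmul, neg_eq_iff_add_eq_zero]
    refine ((add_comm _ _).trans ?_).trans h
    congr 1
    simp
  cases p with
  | zero =>
    have h0 := D.eq_zero_of_coboundary_eq_zero hS c hc hdc
    obtain ⟨β, h1, h2, h3⟩ := exists_primitive_of_cls_eq_zero (sub_add_cancel q 1) hn hq hα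
      fun σ => (cls_eq_zero_iff _ (sub_add_cancel q 1) rfl _).1 (h0 σ)
    refine ⟨β, h1, h2, fun t ht => ?_⟩
    obtain ⟨p', q', h'⟩ := t
    obtain rfl : p' = 0 := by simp at ht; omega
    obtain rfl : q' = q := by omega
    rw [Pi.sub_apply, h3, sub_self]
  | succ p =>
    obtain ⟨b, hbA, hb⟩ := D.exists_of_coboundary_eq_zero hS c hc hdc
    have hex : ∀ σ : Spx X p, ∃ x : LinearMap.ker ((E.obj (smp σ)).d q (q + 1)).hom,
        cls (E.obj (smp σ)) rfl x = b σ ∧ (A p σ → x = 0) := by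
      intro σ
      by_cases hσ : A p σ
      · exact ⟨0, (map_zero _).trans (hbA σ hσ).symm, fun _ => rfl⟩
      · obtain ⟨y, hy⟩ := cls_surjective (E.obj (smp σ)) (n := q) rfl (b σ)
        exact ⟨y, hy, fun h => (hσ h).elim⟩
    choose x hx hxA using hex
    -- The values are internal cocycles, so `D β₁` has no component in simplicial degree `p` and
    -- does not disturb what has already been cleared.
    let β₁ : Sec E n := Sec.single p q (by push_cast at hq; omega) (fun σ => x σ)
    have hβ₁s : ∀ h', β₁ ⟨p, q, h'⟩ = fun σ => (x σ : (E.obj (smp σ)).X q) :=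
      Sec.single_self (n := n) p q (by push_cast at hq; omega) _
    have hβ₁A : β₁.VanishesOn A := Sec.single_vanishesOn _ _ _ _ fun σ hσ => by
      rw [hxA σ hσ]; rfl
    have hβ₁D : (β₁.D hn).VanishesBelow (p + 1) := by
      rintro ⟨p', q', h'⟩ ht
      funext σ
      by_cases hpp : p' = p
      · subst hpp
        obtain rfl : q' = q + 1 := by push_cast at hq; omega
        have h0 : ((E.obj (smp σ)).d q (q + 1)).hom (x σ) = 0 := (x σ).2
        cases p' with
        | zero => rw [Sec.D_zero hn _ (q + 1) q h' rfl, hβ₁s, h0]; rfl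
        | succ p' =>
          rw [Sec.D_succ hn _ p' (q + 1) q h' rfl, hβ₁s, h0, smul_zero, add_zero]
          refine Finset.sum_eq_zero fun i _ => ?_
          rw [Sec.ev_eq_zero, smul_zero]
          exact congrFun (Sec.single_of_ne _ _ _ _ _ (by simp)) _
      · have hlt : p' < p := by simp at ht; omega
        have : β₁.VanishesBelow p := fun t ht => Sec.single_of_ne _ _ _ _ t (by omega)
        exact congrFun (this.D_eq_zero hn _ hlt) σ
    have hα' : (α - β₁.D hn).VanishesOn A := hα.sub (hβ₁A.D D.map_mem hn)
    obtain ⟨β₂, h1, h2, h3⟩ := exists_primitive_of_cls_eq_zero (sub_add_cancel q 1) hn hq hα'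
      fun σ => by
        have hbc : ∀ j : Fin (p + 2), ∃ hj : _ ∈ _,
            (S.map (arrow (SimplexCategory.δ j) rfl)).hom (b (X.map (SimplexCategory.δ j).op σ)) =
              cls (E.obj (smp σ)) rfl
                ⟨β₁.ev q (by push_cast at hq; omega) (SimplexCategory.δ j) σ, hj⟩ := fun j => by
          have h0 : β₁.ev q (by push_cast at hq; omega) (SimplexCategory.δ j) σ =
              mapKer (E.map (arrow (SimplexCategory.δ j) rfl))
                (x (X.map (SimplexCategory.δ j).op σ)) := by
            rw [Sec.ev, hβ₁s]; rfl
          exact ⟨by rw [h0]; exact Subtype.property _,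
            (congrArg (S.map (arrow (SimplexCategory.δ j) rfl)).hom (hx _).symm).trans
              ((homologyMap_cls _ rfl _).trans (congrArg (cls _ rfl) (Subtype.ext h0.symm)))⟩
        choose hj hcj using hbc
        have h := hb σ
        have h' : cls (E.obj (smp σ)) rfl ⟨_, hcyc σ⟩ = _ := h.symm.trans
          ((Finset.sum_congr rfl fun (j : Fin (p + 2)) _ => congrArg (fun y => (-1 : ℤ) ^ (j : ℕ) • y)
            (hcj j)).trans (sum_zsmul_cls _ _ _ _ _))
        rw [← sub_eq_zero, ← map_sub, cls_eq_zero_iff _ (sub_add_cancel q 1) rfl] at h'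
        obtain ⟨y, hy⟩ := h'
        refine ⟨y, hy.trans ?_⟩
        rw [Pi.sub_apply, Pi.sub_apply, Sec.D_succ hn _ p q (q - 1) hq (by omega)]
        have h0 : β₁ ⟨p + 1, q - 1, by omega⟩ σ = 0 := by
          exact congrFun (Sec.single_of_ne _ _ _ _ _ (by simp)) _
        rw [h0, map_zero, smul_zero, add_zero]
        simp
    refine ⟨β₁ + β₂, ?_, ?_, ?_⟩
    · intro t σ hσ
      rw [Pi.add_apply, Pi.add_apply, hβ₁A t σ hσ, h1 t σ hσ, add_zero]
    · intro t ht
      rw [Nat.add_sub_cancel] at ht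
      rw [Pi.add_apply, h2 t (by omega), add_zero]
      exact Sec.single_of_ne _ _ _ _ t (by omega)
    · rw [Sec.D_add, ← sub_sub]
      rintro ⟨p', q', h'⟩ ht
      by_cases hpp : p' = p + 1
      · subst hpp
        obtain rfl : q' = q := by omega
        rw [Pi.sub_apply, h3, sub_self]
      · have hlt : p' < p + 1 := by simp at ht; omega
        rw [Pi.sub_apply, Pi.sub_apply, hp _ hlt, hβ₁D _ hlt, h2.D_eq_zero hn _ hlt, sub_zero,
          sub_zero]

/-- A cocycle with locally constant coefficients which vanishes on the target of a deformation is
the coboundary of a cochain which vanishes there. -/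
lemma exists_primitive (D : Deformation X A e) (hE : E.IsLocallyConstant) {n n₁ n₂ : ℤ}
    (hn : n + 1 = n₁) (hn₁ : n₁ + 1 = n₂) {α : Sec E n₁} (hα : α.VanishesOn A)
    (hd : α.D hn₁ = 0) : ∃ β : Sec E n, β.VanishesOn A ∧ β.D hn = α := by
  let Q (p : ℕ) : Type u :=
    {γ : Sec E n₁ // γ.VanishesOn A ∧ γ.D hn₁ = 0 ∧ γ.VanishesBelow p}
  choose! B hB₁ hB₂ hB₃ using fun (p : ℕ) (γ : Sec E n₁) (h : γ.VanishesOn A ∧ γ.D hn₁ = 0 ∧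
    γ.VanishesBelow p) => D.exists_primitive_step hE hn hn₁ p h.1 h.2.1 h.2.2
  -- `a p` is the remainder after `p` corrections; it vanishes in simplicial degrees less than `p`.
  let a : ℕ → Sec E n₁ := fun p => Nat.rec α (fun p γ => γ - (B p γ).D hn) p
  have ha : ∀ p, (a p).VanishesOn A ∧ (a p).D hn₁ = 0 ∧ (a p).VanishesBelow p := by
    intro p
    induction p with
    | zero => exact ⟨hα, hd, fun t ht => (Nat.not_lt_zero _ ht).elim⟩
    | succ p ih =>
      refine ⟨ih.1.sub ((hB₁ p _ ih).D D.map_mem hn), ?_, hB₃ p _ ih⟩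
      change (a p - (B p (a p)).D hn).D hn₁ = 0
      rw [Sec.D_sub, ih.2.1, Sec.D_D, sub_zero]
  have hsum : ∀ N, (∑ i ∈ Finset.range N, B i (a i)).D hn = α - a N := by
    intro N
    rw [Sec.D_sum]
    have : ∀ i, (B i (a i)).D hn = a i - a (i + 1) := fun i => (sub_sub_cancel _ _).symm
    simp only [this]
    exact Finset.sum_range_sub' a N
  -- The correction of index `i` vanishes below degree `i - 1`, so only indices less than `t.p + 2`
  -- contribute at `t`. The infinite sum is therefore finite in each bidegree.
  have hst : ∀ (t : Bideg n) (N : ℕ), t.p + 2 ≤ N →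
      (∑ i ∈ Finset.range N, B i (a i)) t = (∑ i ∈ Finset.range (t.p + 2), B i (a i)) t := by
    intro t N hN
    rw [Finset.sum_apply, Finset.sum_apply]
    refine (Finset.sum_subset (by simpa using hN) fun i _ hi => ?_).symm
    rw [Finset.mem_range, not_lt] at hi
    exact hB₂ i _ (ha i) t (by omega)
  refine ⟨fun t => (∑ i ∈ Finset.range (t.p + 2), B i (a i)) t, fun t σ hσ => ?_, ?_⟩
  · change (∑ i ∈ Finset.range (t.p + 2), B i (a i)) t σ = 0
    rw [Finset.sum_apply, Finset.sum_apply]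
    exact Finset.sum_eq_zero fun i _ => hB₁ i _ (ha i) t σ hσ
  · funext t σ
    rw [← sub_eq_zero]
    have h1 : (∑ i ∈ Finset.range (t.p + 2), B i (a i)).D hn t σ = α t σ := by
      rw [hsum, Pi.sub_apply, Pi.sub_apply, (ha (t.p + 2)).2.2 t (by omega)]
      exact sub_zero _
    rw [← h1, ← Pi.sub_apply, ← Pi.sub_apply, ← Sec.D_sub]
    -- `D` at `t` reads the cochain only in simplicial degrees at most `t.p`, where the infinite sum
    -- and the partial sum up to `t.p + 2` agree.
    refine Sec.D_eq_zero hn t σ (fun s hs θ => ?_) (fun s hs θ => ?_)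
    · rw [Pi.sub_apply, hst s (t.p + 2) (by omega), sub_self]; rfl
    · rw [Pi.sub_apply, hst s (t.p + 2) (by omega), sub_self]; rfl

end Deformation

/-! ### Acyclicity of cochains on a cylinder relative to one end. -/

section Cylinder

variable {k : Type u} [Field k] {Y : SSet.{u}}

/-- The map `Δ[1] × Δ[1] ⟶ Δ[1]` induced by a monotone map. -/
def lineOp (m : Fin 2 × Fin 2 →o Fin 2) :
    (SSet.stdSimplex.obj ⦋1⦌ ⊗ SSet.stdSimplex.obj ⦋1⦌ : SSet.{u}) ⟶ SSet.stdSimplex.obj ⦋1⦌ where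
  app _ := ↾fun z => SSet.stdSimplex.objMk
    (m.comp ((SSet.stdSimplex.asOrderHom z.1).prod (SSet.stdSimplex.asOrderHom z.2)))
  naturality _ _ _ := rfl

/-- The deformation of the cylinder defined by a monotone map `m` on the second factor. -/
def cylDeformation (Y : SSet.{u}) (e : Fin 2) (m : Fin 2 × Fin 2 →o Fin 2)
    (h₁ : ∀ a, m (a, e) = a) (h₂ : ∀ a b, b ≠ e → m (a, b) ≠ e)
    (h₃ : ∀ a b, a ≠ e → m (a, b) ≠ e) :
    Deformation (cyl Y) (fun _ z => ∀ i, z.2 i ≠ e) e where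
  hom := (α_ Y (SSet.stdSimplex.obj ⦋1⦌) (SSet.stdSimplex.obj ⦋1⦌)).hom ≫ Y ◁ lineOp m
  hom_start y s h := Prod.ext rfl (SSet.stdSimplex.ext _ _ fun i => by
    refine Eq.trans ?_ (h₁ (y.2 i))
    exact congrArg (fun b => m (y.2 i, b)) (h i))
  hom_end y s h i := h₂ _ _ (h i)
  hom_mem y s h i := h₃ _ _ (h i)
  map_mem θ y h i := h (θ.toOrderHom i)

/-- The deformation of the cylinder onto its initial end. -/
def cylDeformation₀ (Y : SSet.{u}) :
    Deformation (cyl Y) (fun _ z => ∀ i, z.2 i ≠ 1) 1 :=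
  cylDeformation Y 1 ⟨fun x => min x.1 x.2, fun _ _ h => min_le_min h.1 h.2⟩
    (by decide) (by decide) (by decide)

/-- The deformation of the cylinder onto its terminal end. -/
def cylDeformation₁ (Y : SSet.{u}) :
    Deformation (cyl Y) (fun _ z => ∀ i, z.2 i ≠ 0) 0 :=
  cylDeformation Y 0 ⟨fun x => max x.1 x.2, fun _ _ h => max_le_max h.1 h.2⟩
    (by decide) (by decide) (by decide)

lemma eq_ι₀_of_ne_one {p : ℕ} (z : Spx (cyl Y) p) (h : ∀ i, z.2 i ≠ 1) :
    z = (SSet.ι₀ : Y ⟶ cyl Y).app (op ⦋p⦌) z.1 :=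
  Prod.ext rfl (SSet.stdSimplex.ext _ _ fun i => by
    exact (by decide : ∀ a : Fin 2, a ≠ 1 → a = 0) _ (h i))

lemma eq_ι₁_of_ne_zero {p : ℕ} (z : Spx (cyl Y) p) (h : ∀ i, z.2 i ≠ 0) :
    z = (SSet.ι₁ : Y ⟶ cyl Y).app (op ⦋p⦌) z.1 :=
  Prod.ext rfl (SSet.stdSimplex.ext _ _ fun i => by
    exact (by decide : ∀ a : Fin 2, a ≠ 0 → a = 1) _ (h i))

variable {E : Coeff k (cyl Y)}

lemma Sec.vanishesOn_iff_pull_ι₀ {n : ℤ} (α : Sec E n) :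
    α.VanishesOn (fun _ z => ∀ i, z.2 i ≠ 1) ↔ α.pull (SSet.ι₀ : Y ⟶ cyl Y) = 0 := by
  constructor
  · intro h
    funext t σ
    exact h t _ fun i => Fin.zero_ne_one
  · intro h t z hz
    rw [eq_ι₀_of_ne_one z hz]
    exact congrFun (congrFun h t) z.1

lemma Sec.vanishesOn_iff_pull_ι₁ {n : ℤ} (α : Sec E n) :
    α.VanishesOn (fun _ z => ∀ i, z.2 i ≠ 0) ↔ α.pull (SSet.ι₁ : Y ⟶ cyl Y) = 0 := by
  constructor
  · intro h
    funext t σ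
    exact h t _ fun i => Fin.zero_ne_one.symm
  · intro h t z hz
    rw [eq_ι₁_of_ne_zero z hz]
    exact congrFun (congrFun h t) z.1

/-- A cocycle on the cylinder which vanishes on the initial end is the coboundary of a cochain
which vanishes there. -/
lemma exists_primitive_of_pull_ι₀ (hE : E.IsLocallyConstant) {n n₁ n₂ : ℤ}
    (hn : n + 1 = n₁) (hn₁ : n₁ + 1 = n₂) {α : Sec E n₁} (hα : α.pull (SSet.ι₀ : Y ⟶ cyl Y) = 0)
    (hd : α.D hn₁ = 0) : ∃ β : Sec E n, β.pull (SSet.ι₀ : Y ⟶ cyl Y) = 0 ∧ β.D hn = α := by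
  simp only [← Sec.vanishesOn_iff_pull_ι₀] at hα ⊢
  exact (cylDeformation₀ Y).exists_primitive hE hn hn₁ hα hd

/-- A cocycle on the cylinder which vanishes on the terminal end is the coboundary of a cochain
which vanishes there. -/
lemma exists_primitive_of_pull_ι₁ (hE : E.IsLocallyConstant) {n n₁ n₂ : ℤ}
    (hn : n + 1 = n₁) (hn₁ : n₁ + 1 = n₂) {α : Sec E n₁} (hα : α.pull (SSet.ι₁ : Y ⟶ cyl Y) = 0)
    (hd : α.D hn₁ = 0) : ∃ β : Sec E n, β.pull (SSet.ι₁ : Y ⟶ cyl Y) = 0 ∧ β.D hn = α := by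
  simp only [← Sec.vanishesOn_iff_pull_ι₁] at hα ⊢
  exact (cylDeformation₁ Y).exists_primitive hE hn hn₁ hα hd

open Classical in
/-- Cochains on the two ends of the cylinder extend by zero. -/
lemma exists_extension_by_zero {n : ℤ} (c₀ : Sec (E.pullback (SSet.ι₀ : Y ⟶ cyl Y)) n)
    (c₁ : Sec (E.pullback (SSet.ι₁ : Y ⟶ cyl Y)) n) :
    ∃ e : Sec E n, e.pull SSet.ι₀ = c₀ ∧ e.pull SSet.ι₁ = c₁ ∧
      ∀ (t : Bideg n) (z : Spx (cyl Y) t.p), (∀ y, (SSet.ι₀ : Y ⟶ cyl Y).app _ y ≠ z) →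
        (∀ y, (SSet.ι₁ : Y ⟶ cyl Y).app _ y ≠ z) → e t z = 0 := by
  -- The prescriptions on the two ends cannot conflict, since the second coordinates of vertices are
  -- 0 on one end and 1 on the other; each end inclusion is injective.
  have H : ∀ (t : Bideg n) (z : Spx (cyl Y) t.p), ∃ x : ((E.obj (smp z)).X t.q : Type u),
      (∀ y (hy : (SSet.ι₀ : Y ⟶ cyl Y).app _ y = z), x = hy ▸ c₀ t y) ∧
      (∀ y (hy : (SSet.ι₁ : Y ⟶ cyl Y).app _ y = z), x = hy ▸ c₁ t y) ∧
      ((∀ y, (SSet.ι₀ : Y ⟶ cyl Y).app _ y ≠ z) →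
        (∀ y, (SSet.ι₁ : Y ⟶ cyl Y).app _ y ≠ z) → x = 0) := by
    intro t z
    by_cases h₀ : ∃ y, (SSet.ι₀ : Y ⟶ cyl Y).app _ y = z
    · obtain ⟨y, rfl⟩ := h₀
      refine ⟨c₀ t y, ?_, ?_, fun h => (h y rfl).elim⟩
      · intro y' hy'
        obtain rfl : y' = y := congrArg Prod.fst hy'
        rfl
      · intro y' hy'
        have : (1 : Fin 2) = 0 := congrArg (fun z : Spx (cyl Y) t.p => z.2 0) hy'
        exact absurd this (by decide)
    · by_cases h₁ : ∃ y, (SSet.ι₁ : Y ⟶ cyl Y).app _ y = z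
      · obtain ⟨y, rfl⟩ := h₁
        refine ⟨c₁ t y, fun y' hy' => (h₀ ⟨y', hy'⟩).elim, ?_, fun _ h => (h y rfl).elim⟩
        intro y' hy'
        obtain rfl : y' = y := congrArg Prod.fst hy'
        rfl
      · exact ⟨0, fun y hy => (h₀ ⟨y, hy⟩).elim, fun y hy => (h₁ ⟨y, hy⟩).elim, fun _ _ => rfl⟩
  choose e he₀ he₁ he using H
  exact ⟨e, funext fun t => funext fun y => he₀ t _ y rfl,
    funext fun t => funext fun y => he₁ t _ y rfl, he⟩

end Cylinder

/-! ### Restriction between coefficient systems pulled back from a common base. -/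

section Restriction

variable {k : Type u} [Field k] {T U V : SSet.{u}}

/-- Restriction along `w` of a cochain on `V` with coefficients pulled back from `T`. -/
def Sec.restr {E : Coeff k T} {i : V ⟶ T} {w : U ⟶ V} {v : U ⟶ T} (h : w ≫ i = v) {n : ℤ}
    (α : Sec (E.pullback i) n) : Sec (E.pullback v) n :=
  -- The transport along `h` lets an interface reached through two different pieces carry one and
  -- the same coefficient system `E.pullback v`.
  h ▸ (fun t σ => α t (w.app _ σ) : Sec (E.pullback (w ≫ i)) n)

variable {E : Coeff k T} {i : V ⟶ T} {w : U ⟶ V} {v : U ⟶ T} (h : w ≫ i = v)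

/-- Heterogeneous equality is the form in which compatibility is checked when cochains are glued on
a pushout. -/
lemma Sec.restr_heq {n : ℤ} (α : Sec (E.pullback i) n) (t : Bideg n) (σ : Spx U t.p) :
    HEq (α.restr h t σ) (α t (w.app _ σ)) := by
  subst h; rfl

lemma Sec.restr_eq_zero_iff {n : ℤ} (α : Sec (E.pullback i) n) (t : Bideg n) (σ : Spx U t.p) :
    α.restr h t σ = 0 ↔ α t (w.app _ σ) = 0 := by
  subst h; rfl

lemma Sec.restr_D {n n' : ℤ} (hn : n + 1 = n') (α : Sec (E.pullback i) n) :
    (α.restr h).D hn = (α.D hn).restr h := by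
  subst h
  exact Sec.pull_D w hn α

lemma Sec.restr_pull {n : ℤ} (α : Sec E n) : (α.pull i).restr h = α.pull v := by
  subst h; rfl

lemma Sec.restr_add {n : ℤ} (α β : Sec (E.pullback i) n) :
    (α + β).restr h = α.restr h + β.restr h := by
  subst h; rfl

lemma Sec.restr_smul {n : ℤ} (c : k) (α : Sec (E.pullback i) n) :
    (c • α).restr h = c • α.restr h := by
  subst h; rfl

lemma Sec.restr_zero {n : ℤ} : (0 : Sec (E.pullback i) n).restr h = 0 := by
  subst h; rfl

lemma cup_restr {E' : Coeff k T} (P : CoeffPairing E E') {m n l : ℤ}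
    (hl : m + n = l) (a : Sec (E.pullback i) m) (b : Sec (E'.pullback i) n) :
    cup (P.pullback v) hl (a.restr h) (b.restr h) = (cup (P.pullback i) hl a b).pull w := by
  subst h
  exact cup_pull w (P.pullback i) hl a b

/-- Restriction along `w` as a morphism of complexes. -/
def sectionsRestr (E : Coeff k T) {i : V ⟶ T} {w : U ⟶ V} {v : U ⟶ T} (h : w ≫ i = v) :
    sections (E.pullback i) ⟶ sections (E.pullback v) where
  f n := ModuleCat.ofHom
    { toFun := fun α : Sec (E.pullback i) n => α.restr h
      map_add' := Sec.restr_add h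
      map_smul' := Sec.restr_smul h }
  comm' n n' hn := by
    have hn' : n + 1 = n' := hn
    rw [sections_d _ hn', sections_d _ hn']
    exact ModuleCat.hom_ext (LinearMap.ext fun α => Sec.restr_D h hn' α)

lemma sections_d_apply {X : SSet.{u}} (E : Coeff k X) {n n' : ℤ} (hn : n + 1 = n') (α : Sec E n) :
    ((sections E).d n n').hom α = α.D hn := by
  rw [sections_d E hn]
  rfl

lemma sections_d_eq_zero {X : SSet.{u}} (E : Coeff k X) {n n' : ℤ} (hn : n + 1 = n') (α : Sec E n)
    (hα : α.D hn = 0) (l : ℤ) : ((sections E).d n l).hom α = 0 := by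
  by_cases h : n + 1 = l
  · obtain rfl : n' = l := by omega
    rw [sections_d_apply E hn, hα]; rfl
  · rw [(sections E).shape _ _ h]; rfl

end Restriction

/-! ### Duality data with two boundary pieces, and mapping cocones. -/

section Datum

variable {k : Type u} [Field k] {d : ℤ} {T V U₁ U₂ : SSet.{u}}

/-- The duality datum on `V ⟶ T` with two boundary pieces. -/
def boundaryDatum {E E' : Coeff k T} (P : CoeffPairing E E') {i : V ⟶ T} {w₁ : U₁ ⟶ V}
    {w₂ : U₂ ⟶ V} {v₁ : U₁ ⟶ T} {v₂ : U₂ ⟶ T} (h₁ : w₁ ≫ i = v₁) (h₂ : w₂ ≫ i = v₂)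
    (θ₁ : FundClass k U₁ d) (θ₂ : FundClass k U₂ d) (path : Coch k V (d + 1) →ₗ[k] k)
    (path_D : ∀ c : Coch k V d, path (c.D rfl) = θ₁.ev (c.pull w₁) - θ₂.ev (c.pull w₂)) :
    RelDatum (sections (E.pullback i)) (sections (E'.pullback i))
      ((θ₁.pairing (P.pullback v₁)).prodSub (θ₂.pairing (P.pullback v₂))) where
  r := prodLift (sectionsRestr E h₁) (sectionsRestr E h₂)
  r' := prodLift (sectionsRestr E' h₁) (sectionsRestr E' h₂)
  path i j h := (cupLin _ h).compr₂ path
  path_d m m' n n' hm hn h a b := by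
    have key := path_D (cup (P.pullback i) h a b)
    rw [cup_D (P.pullback i) hm hn a b h rfl, map_add, map_smul] at key
    have e₁ := cup_restr h₁ P h a b
    have e₂ := cup_restr h₂ P h a b
    rw [← e₁, ← e₂] at key
    rw [sections_d _ hm, sections_d _ hn]
    exact key

/-- Exactness of a datum does not change when the target is replaced by an isomorphic one. -/
lemma RelDatum.isExact_congr {A A' B B' B₂ B₂' : Cpx k} {β : Pairing B B' d}
    {β₂ : Pairing B₂ B₂' d} (R : RelDatum A A' β) (R₂ : RelDatum A A' β₂) (s' : B' ⟶ B₂')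
    (hs' : ∀ n, Function.Bijective (s'.f n).hom)
    (hr' : ∀ n a, (R₂.r'.f n).hom a = (s'.f n).hom ((R.r'.f n).hom a))
    (hβ : ∀ i j h e b, β.toFun i j h ((R.r.f i).hom e) b =
      β₂.toFun i j h ((R₂.r.f i).hom e) ((s'.f j).hom b))
    (hp : ∀ i j h a b, R.path i j h a b = R₂.path i j h a b) : R.IsExact ↔ R₂.IsExact := by
  have hd : ∀ (i j : ℤ) (b : B'.X i), (B₂'.d i j).hom ((s'.f i).hom b) =
      (s'.f j).hom ((B'.d i j).hom b) := fun i j b => comm_apply s' i j b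
  constructor
  · intro H n₀ n n₁ m m₁ m₂ e₀ e₁ e₂ e₃ h a b c ha hb hc
    obtain ⟨b, rfl⟩ := (hs' n).2 b
    obtain ⟨a', b', c', h1, h2, h3⟩ := H n₀ n n₁ m m₁ m₂ e₀ e₁ e₂ e₃ h a b c ha
      ((hs' n₁).1 (by rw [← hd, hb, hr'])) (fun e => by rw [hc, hβ, hp])
    refine ⟨a', (s'.f n₀).hom b', c', h1, ?_, fun e => ?_⟩
    · rw [hd, h2, map_sub, hr']
    · rw [h3, hβ, hp]
  · intro H n₀ n n₁ m m₁ m₂ e₀ e₁ e₂ e₃ h a b c ha hb hc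
    obtain ⟨a', b', c', h1, h2, h3⟩ := H n₀ n n₁ m m₁ m₂ e₀ e₁ e₂ e₃ h a ((s'.f n).hom b) c ha
      (by rw [hd, hb, hr']) (fun e => by rw [hc, hβ, hp])
    obtain ⟨b', rfl⟩ := (hs' n₀).2 b'
    refine ⟨a', b', c', h1, (hs' n).1 ?_, fun e => ?_⟩
    · rw [← hd, h2, map_sub, hr']
    · rw [h3, hβ, hp]

/-- Perfectness of a pairing does not change under isomorphisms. -/
lemma Pairing.isPerfect_of_bijective {A A' B B' : Cpx k} {β : Pairing A A' d} {β₂ : Pairing B B' d}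
    (s : A ⟶ B) (s' : A' ⟶ B') (hs : ∀ n, Function.Bijective (s.f n).hom)
    (hs' : ∀ n, Function.Bijective (s'.f n).hom)
    (hβ : ∀ i j h a b, β.toFun i j h a b = β₂.toFun i j h ((s.f i).hom a) ((s'.f j).hom b))
    (h : β₂.IsPerfect) : β.IsPerfect := by
  intro n₀ n m m₁ m₂ e₀ e₁ e₂ e b c hb hc
  let t := fun n => LinearEquiv.ofBijective _ (hs n)
  have ht : ∀ n x, (s.f n).hom ((t n).symm x) = x := fun n x => (t n).apply_symm_apply x
  have ht' : ∀ n x, (t n).symm ((s.f n).hom x) = x := fun n x => (t n).symm_apply_apply x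
  obtain ⟨b', c', h1, h2⟩ := h n₀ n m m₁ m₂ e₀ e₁ e₂ e ((s'.f n).hom b) (c ∘ₗ (t m₁).symm)
    (fun l => by rw [comm_apply s', hb, map_zero]) (fun x => by
      have : (B.d m m₁).hom x = (s.f m₁).hom ((A.d m m₁).hom ((t m).symm x)) := by
        rw [← comm_apply s, ht]
      rw [LinearMap.comp_apply, this]
      refine (congrArg c (ht' _ _)).trans ?_
      rw [hc, hβ, ht])
  obtain ⟨b', rfl⟩ := (hs' n₀).2 b'
  refine ⟨b', c' ∘ₗ (s.f m₂).hom, (hs' n).1 ?_, fun x => ?_⟩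
  · rw [← comm_apply s', h1]
  · have := h2 ((s.f m₁).hom x)
    rw [LinearMap.comp_apply, comm_apply s, ← hβ] at this
    rw [LinearMap.comp_apply, ← this]
    exact congrArg c (ht' _ _).symm

/-- The two factors do not interact. The minus sign on the second pairing is absorbed by negating
the functional there. -/
lemma Pairing.IsPerfect.prodSub {A A' B B' : Cpx k} {β : Pairing A A' d} {β₂ : Pairing B B' d}
    (h : β.IsPerfect) (h₂ : β₂.IsPerfect) : (β.prodSub β₂).IsPerfect := by
  intro n₀ n m m₁ m₂ e₀ e₁ e₂ e (b : A'.X n × B'.X n) (c : A.X m₁ × B.X m₁ →ₗ[k] k) hb hc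
  have hc' : ∀ x : A.X m × B.X m, c ((A.d m m₁).hom x.1, (B.d m m₁).hom x.2) =
    β.toFun m n e x.1 b.1 - β₂.toFun m n e x.2 b.2 := hc
  obtain ⟨b₁, c₁, h1, h2⟩ := h n₀ n m m₁ m₂ e₀ e₁ e₂ e b.1 (c ∘ₗ LinearMap.inl k _ _)
    (fun l => congrArg Prod.fst (hb l)) (fun x => by simpa using hc' (x, 0))
  obtain ⟨b₂, c₂, h3, h4⟩ := h₂ n₀ n m m₁ m₂ e₀ e₁ e₂ e b.2 (-(c ∘ₗ LinearMap.inr k _ _))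
    (fun l => congrArg Prod.snd (hb l)) (fun x => by
      have := hc' (0, x)
      rw [map_zero, map_zero, LinearMap.zero_apply, zero_sub] at this
      rw [LinearMap.neg_apply, LinearMap.comp_apply, LinearMap.inr_apply, this, neg_neg])
  refine ⟨(b₁, b₂), LinearMap.coprod c₁ (-c₂), Prod.ext h1 h3, ?_⟩
  rintro ⟨x, y⟩
  have e1 := h2 x
  have e2 := h4 y
  have e3 : c (x, y) = c (x, 0) + c (0, y) := by rw [← map_add]; simp
  change c (x, 0) = _ at e1
  change -c (0, y) = _ at e2
  change c (x, y) = c₁ ((A.d m₁ m₂).hom x) + -c₂ ((B.d m₁ m₂).hom y) - sgn k m * (β.toFun _ _ _ x b₁ - β₂.toFun _ _ _ y b₂)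
  rw [e3]
  linear_combination e1 - e2

/-- Elementwise form of being a quasi-isomorphism for a morphism to a mapping cocone. -/
lemma quasiIso_lift_iff {K L M : Cpx k} (φ : K ⟶ L) (α : M ⟶ K)
    (β : CochainComplex.HomComplex.Cochain M L (-1))
    (h : CochainComplex.HomComplex.δ (-1) 0 β +
      CochainComplex.HomComplex.Cochain.ofHom (α ≫ φ) = 0) :
    QuasiIso (CochainComplex.mappingCocone.lift φ α β h) ↔
      ∀ (l n₀ n n₁ : ℤ) (_ : l + 1 = n₀) (_ : n₀ + 1 = n) (e : n + 1 = n₁)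
        (a : M.X n₁) (b : K.X n) (c : L.X n₀), (∀ n₂, (M.d n₁ n₂).hom a = 0) →
        (K.d n n₁).hom b = (α.f n₁).hom a →
        (L.d n₀ n).hom c = -(φ.f n).hom b - (β.v n₁ n (by omega)).hom a →
        ∃ (a' : M.X n) (b' : K.X n₀) (c' : L.X l), (M.d n n₁).hom a' = a ∧
          (K.d n₀ n).hom b' = (α.f n).hom a' - b ∧
          (L.d l n₀).hom c' = c - (φ.f n₀).hom b' - (β.v n n₀ (by omega)).hom a' := by
  rw [quasiIso_iff_elem]
  let C := CochainComplex.mappingCocone φ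
  let F : ∀ n, C.X n →ₗ[k] K.X n := fun n => ((CochainComplex.mappingCocone.fst φ).f n).hom
  let S : ∀ n n', n + -1 = n' → (C.X n →ₗ[k] L.X n') := fun n n' h =>
    ((CochainComplex.mappingCocone.snd φ).v n n' h).hom
  let I : ∀ n, K.X n →ₗ[k] C.X n := fun n =>
    ((CochainComplex.mappingCocone.inl φ).v n n (add_zero n)).hom
  let J : ∀ n n', n + 1 = n' → (L.X n →ₗ[k] C.X n') := fun n n' h =>
    ((CochainComplex.mappingCocone.inr φ).1.v n n' h).hom
  have FI : ∀ n x, F n (I n x) = x := fun n x =>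
    hom_apply_eq (CochainComplex.mappingCocone.inl_v_fst_f φ n) x
  have FJ : ∀ n n' h x, F n' (J n n' h x) = 0 := fun n n' h x =>
    hom_apply_eq (CochainComplex.mappingCocone.inr_v_fst_f φ n n' h) x
  have SI : ∀ n n' h x, S n n' h (I n x) = 0 := fun n n' h x =>
    hom_apply_eq (CochainComplex.mappingCocone.inl_v_snd_v φ n n' h) x
  have SJ : ∀ n n' h h' x, S n' n h' (J n n' h x) = x := fun n n' h h' x =>
    hom_apply_eq (CochainComplex.mappingCocone.inr_v_snd_v φ n n' h) x
  have ext : ∀ n n' h (x y : C.X n), F n x = F n y → S n n' h x = S n n' h y → x = y := by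
    intro n n' h x y h1 h2
    have key : ∀ x : C.X n, I n (F n x) + J n' n (by omega) (S n n' h x) = x := fun x =>
      hom_apply_eq (CochainComplex.mappingCocone.id_X φ n n' h) x
    rw [← key x, ← key y, h1, h2]
  have Fd : ∀ i j x, F j ((C.d i j).hom x) = (K.d i j).hom (F i x) := fun i j x =>
    (comm_apply (CochainComplex.mappingCocone.fst φ) i j x).symm
  have Sd : ∀ i i' j h h' x, i + 1 = j → S j i h ((C.d i j).hom x) =
      -(φ.f i).hom (F i x) - (L.d i' i).hom (S i i' h' x) := by
    intro i i' j h h' x hij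
    -- The second projection is the cochain with components zero on `K` and the identity on `L`; its
    -- differential, and with it the formula for the second component of a coboundary, can then be
    -- read off from `δ_descCochain`.
    have e0 : CochainComplex.mappingCocone.snd φ =
        CochainComplex.mappingCocone.descCochain φ (0 : CochainComplex.HomComplex.Cochain K L (-1))
          (CochainComplex.HomComplex.Cochain.ofHom (𝟙 L)) (by omega) := by
      refine CochainComplex.HomComplex.Cochain.ext _ _ fun p q hpq => ?_
      rw [← cancel_epi (𝟙 _), ← CochainComplex.mappingCocone.id_X φ p q hpq]
      simp
    have e1 := CochainComplex.mappingCocone.δ_descCochain φ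
      (0 : CochainComplex.HomComplex.Cochain K L (-1))
          (CochainComplex.HomComplex.Cochain.ofHom (𝟙 L)) (by omega) 1 (by omega)
    rw [← e0] at e1
    have e2 := CochainComplex.HomComplex.Cochain.congr_v e1 i i (add_zero i)
    rw [CochainComplex.HomComplex.δ_v (-1) 0 (by omega) _ i i _ i' j (by omega) hij] at e2
    simp at e2
    have e3 : (L.d i' i).hom (S i i' h' x) + S j i h ((C.d i j).hom x) =
      -(φ.f i).hom (F i x) := hom_apply_eq e2 x
    rw [← e3]
    abel
  let Λ := CochainComplex.mappingCocone.lift φ α β h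
  have ΛF : ∀ n x, F n ((Λ.f n).hom x) = (α.f n).hom x := fun n x =>
    hom_apply_eq (CochainComplex.mappingCocone.lift_f_fst_f φ α β h n) x
  have ΛS : ∀ n n' hn x, S n n' hn ((Λ.f n).hom x) = (β.v n n' hn).hom x := fun n n' hn x =>
    hom_apply_eq (CochainComplex.mappingCocone.lift_f_snd_v φ α β h n n' hn) x
  constructor
  · intro H l n₀ n n₁ e₀ e₁ e₂ a b c ha hb hc
    obtain ⟨a', κ, h1, h2⟩ := H n₀ n n₁ e₁ e₂ a (I n b + J n₀ n e₁ c) ha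
      (ext n₁ n (by omega) _ _ (by
        refine (ΛF n₁ a).trans ?_
        rw [Fd, map_add, FI, FJ, add_zero, hb]) (by
        refine (ΛS n₁ n (by omega) a).trans ?_
        rw [Sd n n₀ n₁ (by omega) (by omega) _ e₂, map_add, FI, FJ, add_zero, map_add (S _ _ _), SI, SJ, zero_add, hc]
        abel))
    refine ⟨a', F n₀ κ, S n₀ l (by omega) κ, h1, ?_, ?_⟩
    · rw [← Fd, h2, map_sub, map_add, FI, FJ, add_zero]
      exact congrArg (· - b) (ΛF n a')
    · have h3 := congrArg (S n n₀ (by omega)) h2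
      rw [Sd n₀ l n (by omega) (by omega) _ e₁, map_sub, map_add, SI, SJ, zero_add] at h3
      have h4 := ΛS n n₀ (by omega) a'
      rw [← h4, eq_sub_iff_add_eq]
      have h5 : -(φ.f n₀).hom (F n₀ κ) - (L.d l n₀).hom (S n₀ l (by omega) κ) =
        S n n₀ (by omega) ((Λ.f n).hom a') - c := h3
      rw [eq_sub_iff_add_eq] at h5
      rw [← h5]
      abel
  · intro H n₀ n n₁ e₀ e₁ a κ ha hκ
    obtain ⟨a', b', c', h1, h2, h3⟩ := H (n₀ - 1) n₀ n n₁ (by omega) e₀ e₁ a (F n κ)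
      (S n n₀ (by omega) κ) ha (by rw [← Fd, ← hκ]; exact ΛF n₁ a) (by
        have h5 := Sd n n₀ n₁ (by omega) (by omega) κ e₁
        have h6 := ΛS n₁ n (by omega) a
        rw [← h6, show (Λ.f n₁).hom a = (C.d n n₁).hom κ from hκ, h5]
        abel)
    refine ⟨a', I n₀ b' + J (n₀ - 1) n₀ (by omega) c', h1, ?_⟩
    refine ext n n₀ (by omega) _ _ ?_ ?_
    · rw [Fd, map_add, map_sub, FI, FJ, add_zero, h2]
      exact congrArg (· - F n κ) (ΛF n a').symm
    · rw [Sd n₀ (n₀ - 1) n (by omega) (by omega) _ e₀, map_add, FI, FJ, add_zero, map_add (S _ _ _), SI, SJ, zero_add, h3, map_sub]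
      have h4 := ΛS n n₀ (by omega) a'
      have h5 : S n n₀ (by omega) ((Λ.f n).hom a') - S n n₀ (by omega) κ =
        S n n₀ (by omega) (((CochainComplex.mappingCocone.lift φ α β h).f n).hom a') -
          S n n₀ (by omega) κ := rfl
      rw [← h5, h4]
      abel

end Datum

/-! ### Non-degeneracy of a boundary structure as exactness. -/

namespace BoundaryStructure

open CochainComplex.HomComplex CochainComplex

variable {k : Type u} [Field k] {d : ℤ} {U V : SSet.{u}} {f : U ⟶ V} {η : FundClass k U d}

/-- The duality datum of a boundary structure. -/
def datum (γ : BoundaryStructure f η) {E E' : Coeff k V} (P : CoeffPairing E E') :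
    RelDatum (sections E) (sections E') (η.pairing (P.pullback f)) where
  r := sectionsPullback f E
  r' := sectionsPullback f E'
  path i j h := (cupLin P h).compr₂ γ.path
  path_d m m' n n' hm hn h a b := by
    have key := γ.path_D (cup P h a b)
    rw [cup_D P hm hn a b h rfl, map_add, map_smul] at key
    rw [sections_d _ hm, sections_d _ hn]
    refine key.trans ?_
    exact congrArg η.ev (cup_pull f P h a b).symm

/-- Both sides express acyclicity of the same total complex. They differ in the indexing of dual
degrees and in the factor `sgn k (d - n)` on functionals, which reconciles the signs in `dualShift`
and `nullHomotopy`. -/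
lemma quasiIso_toPerp_iff (γ : BoundaryStructure f η) {E E' : Coeff k V} (P : CoeffPairing E E') :
    QuasiIso (γ.toPerp P) ↔ (γ.datum P).IsExact := by
  refine (quasiIso_lift_iff _ _ _ _).trans ?_
  have sg : ∀ m m₁ : ℤ, m + 1 = m₁ → sgn k m₁ = -sgn k m := fun m m₁ h => by
    rw [← h, sgn_succ]
  constructor
  · intro H n₀ n n₁ m m₁ m₂ e₀ e₁ e₂ e₃ h a b c ha hb hc
    obtain rfl : m = d - n := by omega
    obtain rfl : m₁ = d - n₀ := by omega
    obtain rfl : m₂ = d - (n₀ - 1) := by omega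
    have s₁ := sg _ _ e₂
    have s₂ := sg _ _ e₃
    have s₃ := sg (d - n₁) (d - n) (by omega)
    have s₄ := sgn_mul_self (k := k) (d - n)
    obtain ⟨a', b', (c' : (sections E).X (d - (n₀ - 1)) →ₗ[k] k), h1, h2, h3⟩ := H (n₀ - 1) n₀ n n₁ (by omega) e₀ e₁ a b
      (sgn k (d - n) • c : _ →ₗ[k] k) ha hb (LinearMap.ext fun e => by
        have h5 := hc e
        change sgn k (d - n₀) * (sgn k (d - n) * c _) = -(η.pairing (P.pullback f)).toFun _ _ _
            (((γ.datum P).r.f _).hom e) _ -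
          sgn k (d - n₁) * (γ.datum P).path _ _ _ e a
        rw [h5, s₁, ← neg_eq_iff_eq_neg.2 s₃]
        linear_combination (- (η.pairing (P.pullback f)).toFun _ _ _
          (((γ.datum P).r.f _).hom e) b + sgn k (d - n) * (γ.datum P).path _ _ _ e a) * s₄)
    refine ⟨a', b', c', h1, h2, fun e => ?_⟩
    have h4 : sgn k (d - (n₀ - 1)) * c' (((sections E).d (d - n₀) (d - (n₀ - 1))).hom e) =
      sgn k (d - n) * c e - (η.pairing (P.pullback f)).toFun (d - n₀) n₀ (by omega)
        (((γ.datum P).r.f _).hom e) b' - sgn k (d - n) * (γ.datum P).path (d - n₀) n (by omega) e a' :=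
      LinearMap.congr_fun h3 e
    rw [s₂, s₁] at h4
    linear_combination (-sgn k (d - n)) * h4 + (- c e + (γ.datum P).path (d - n₀) n (by omega) e a' +
      c' (((sections E).d (d - n₀) (d - (n₀ - 1))).hom e)) * s₄
  · intro H l n₀ n n₁ e₀ e₁ e₂ a b (c : (sections E).X (d - n₀) →ₗ[k] k) ha hb hc
    have s₁ := sg (d - n) (d - n₀) (by omega)
    have s₂ := sg (d - n₀) (d - l) (by omega)
    have s₃ := sg (d - n₁) (d - n) (by omega)
    have s₄ := sgn_mul_self (k := k) (d - n)
    obtain ⟨a', b', c', h1, h2, h3⟩ := H n₀ n n₁ (d - n) (d - n₀) (d - l) e₁ e₂ (by omega)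
      (by omega) (by omega) a b (sgn k (d - n) • c) ha hb (fun e => by
        have h5 : sgn k (d - n₀) * c (((sections E).d (d - n) (d - n₀)).hom e) =
          -(η.pairing (P.pullback f)).toFun (d - n) n (by omega) (((γ.datum P).r.f _).hom e) b -
          sgn k (d - n₁) * (γ.datum P).path (d - n) n₁ (by omega) e a := LinearMap.congr_fun hc e
        rw [s₁, ← neg_eq_iff_eq_neg.2 s₃] at h5
        change sgn k (d - n) * c _ = _
        linear_combination -h5)
    refine ⟨a', b', (c' : (sections E).X (d - l) →ₗ[k] k), h1, h2, LinearMap.ext fun e => ?_⟩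
    have h4 : sgn k (d - n) * c e = _ := h3 e
    change sgn k (d - l) * c' (((sections E).d (d - n₀) (d - l)).hom e) =
      c e - (η.pairing (P.pullback f)).toFun (d - n₀) n₀ (by omega)
        (((γ.datum P).r.f _).hom e) b' - sgn k (d - n) * (γ.datum P).path (d - n₀) n (by omega) e a'
    rw [s₂, s₁]
    linear_combination (-sgn k (d - n)) * h4 + (c e -
      (η.pairing (P.pullback f)).toFun (d - n₀) n₀ (by omega)
        (((γ.datum P).r.f _).hom e) b') * s₄

end BoundaryStructure

/-! ### Cochains on disjoint unions and homotopy pushouts. -/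

section Gluing

lemma heq_of_eq_arg {D : Type*} {V : D → Type*} (s : ∀ d, V d) {z z' : D} (e : z = z') :
    HEq (s z) (s z') := by
  subst e; rfl

/-- Dependent functions on a pushout of types. -/
lemma exists_section_of_isPushout {A B C D : Type u} {f : A ⟶ B} {g : A ⟶ C} {h : B ⟶ D}
    {i : C ⟶ D} (sq : IsPushout f g h i) (V : D → Type u) (b : ∀ x, V (h x)) (c : ∀ x, V (i x))
    (hbc : ∀ a, HEq (b (f a)) (c (g a))) :
    ∃ s : ∀ x, V x, (∀ x, s (h x) = b x) ∧ ∀ x, s (i x) = c x := by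
  have w : ∀ a, h (f a) = i (g a) := fun a => ConcreteCategory.congr_hom sq.w a
  -- A dependent function is a section of the projection from the total space, so the universal
  -- property applies to the total space; uniqueness then shows that the map obtained is a section.
  let σ : D ⟶ (Σ x, V x) := sq.desc (↾fun x => ⟨h x, b x⟩) (↾fun x => ⟨i x, c x⟩) (by
    refine ConcreteCategory.hom_ext _ _ fun a => ?_
    exact (Sigma.ext (w a) (hbc a) : (⟨h (f a), b (f a)⟩ : Σ x, V x) = ⟨i (g a), c (g a)⟩))
  have hσh : ∀ x, σ (h x) = ⟨h x, b x⟩ := fun x =>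
    ConcreteCategory.congr_hom (sq.inl_desc _ _ _) x
  have hσi : ∀ x, σ (i x) = ⟨i x, c x⟩ := fun x =>
    ConcreteCategory.congr_hom (sq.inr_desc _ _ _) x
  have h1 : σ ≫ (↾fun y : (Σ x, V x) => y.1) = 𝟙 D := by
    refine sq.hom_ext ?_ ?_
    · ext x
      exact congrArg Sigma.fst (hσh x)
    · ext x
      exact congrArg Sigma.fst (hσi x)
  have h2 : ∀ x, (σ x).1 = x := fun x => by
    have h3 := ConcreteCategory.congr_hom h1 x
    exact h3
  refine ⟨fun x => cast (congrArg V (h2 x)) (σ x).2, fun x => ?_, fun x => ?_⟩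
  · exact eq_of_heq ((cast_heq _ _).trans (Sigma.ext_iff.1 (hσh x)).2)
  · exact eq_of_heq ((cast_heq _ _).trans (Sigma.ext_iff.1 (hσi x)).2)

/-- The maps to a pushout of types are jointly surjective. -/
lemma exists_preimage_of_isPushout {A B C D : Type u} {f : A ⟶ B} {g : A ⟶ C} {h : B ⟶ D}
    {i : C ⟶ D} (sq : IsPushout f g h i) (y : D) : (∃ x, h x = y) ∨ ∃ x, i x = y := by
  have w : ∀ a, h (f a) = i (g a) := fun a => ConcreteCategory.congr_hom sq.w a
  -- A family of subsingletons inhabited exactly where the claim holds: a section of it is a proof.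
  let V : D → Type u := fun y => {_x : PUnit.{u + 1} // (∃ x, h x = y) ∨ ∃ x, i x = y}
  obtain ⟨s, -⟩ := exists_section_of_isPushout sq V (fun x => ⟨⟨⟩, Or.inl ⟨x, rfl⟩⟩)
    (fun x => ⟨⟨⟩, Or.inr ⟨x, rfl⟩⟩) (fun a => Subsingleton.helim (congrArg V (w a)) _ _)
  exact (s y).2

lemma isPushout_app {A B C D : SSet.{u}} {f : A ⟶ B} {g : A ⟶ C} {h : B ⟶ D}
    {i : C ⟶ D} (sq : IsPushout f g h i) (p : SimplexCategoryᵒᵖ) :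
    IsPushout (f.app p) (g.app p) (h.app p) (i.app p) :=
  sq.map ((CategoryTheory.evaluation _ _).obj p)

variable {X Y : SSet.{u}}

lemma isEmpty_initial (p : SimplexCategoryᵒᵖ) : IsEmpty ((⊥_ SSet.{u}).obj p) := by
  have h : IsInitial ((⊥_ SSet.{u}).obj p) :=
    initialIsInitial.isInitialObj ((CategoryTheory.evaluation _ _).obj p) _
  exact ⟨fun x => ((h.to PEmpty.{u + 1}) x).elim⟩

/-- A disjoint union is a pushout over the empty space, so the descent argument for pushouts applies
with a void compatibility condition. -/
lemma isPushout_coprod_app (X Y : SSet.{u}) (p : SimplexCategoryᵒᵖ) :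
    IsPushout ((initial.to X).app p) ((initial.to Y).app p)
      ((coprod.inl : X ⟶ X ⨿ Y).app p) ((coprod.inr : Y ⟶ X ⨿ Y).app p) :=
  isPushout_app (IsPushout.of_hasBinaryCoproduct' X Y) p

lemma exists_section_coprod {p : SimplexCategoryᵒᵖ} (V : (X ⨿ Y).obj p → Type u)
    (b : ∀ x, V ((coprod.inl : X ⟶ X ⨿ Y).app p x))
    (c : ∀ y, V ((coprod.inr : Y ⟶ X ⨿ Y).app p y)) :
    ∃ s : ∀ z, V z, (∀ x, s ((coprod.inl : X ⟶ X ⨿ Y).app p x) = b x) ∧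
      ∀ y, s ((coprod.inr : Y ⟶ X ⨿ Y).app p y) = c y :=
  exists_section_of_isPushout (isPushout_coprod_app X Y p) V b c
    fun a => ((isEmpty_initial p).false a).elim

lemma exists_preimage_coprod {p : SimplexCategoryᵒᵖ} (z : (X ⨿ Y).obj p) :
    (∃ x, (coprod.inl : X ⟶ X ⨿ Y).app p x = z) ∨ ∃ y, (coprod.inr : Y ⟶ X ⨿ Y).app p y = z :=
  exists_preimage_of_isPushout (isPushout_coprod_app X Y p) z

variable {k : Type u} [Field k] {T : SSet.{u}}

/-- Cochains on a disjoint union. -/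
lemma exists_sec_coprod (E : Coeff k (X ⨿ Y)) {n : ℤ}
    (a : Sec (E.pullback (coprod.inl : X ⟶ X ⨿ Y)) n)
    (b : Sec (E.pullback (coprod.inr : Y ⟶ X ⨿ Y)) n) :
    ∃ α : Sec E n, α.pull coprod.inl = a ∧ α.pull coprod.inr = b := by
  choose α h₁ h₂ using fun t : Bideg n => exists_section_coprod
    (fun z : Spx (X ⨿ Y) t.p => ((E.obj (smp z)).X t.q : Type u)) (a t) (b t)
  exact ⟨α, funext fun t => funext fun x => h₁ t x, funext fun t => funext fun x => h₂ t x⟩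

/-- Each simplex of the disjoint union lies in one of the summands, and cochains are arbitrary
functions on simplices. -/
lemma bijective_restr_coprod (E : Coeff k T) {f : X ⨿ Y ⟶ T} {v₁ : X ⟶ T} {v₂ : Y ⟶ T}
    (h₁ : coprod.inl ≫ f = v₁) (h₂ : coprod.inr ≫ f = v₂) (n : ℤ) :
    Function.Bijective ((prodLift (sectionsRestr E h₁) (sectionsRestr E h₂)).f n).hom := by
  constructor
  · refine (injective_iff_map_eq_zero _).2 fun α hα => ?_
    have e₁ : Sec.restr h₁ α = 0 := congrArg Prod.fst hα
    have e₂ : Sec.restr h₂ α = 0 := congrArg Prod.snd hα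
    funext t z
    rcases exists_preimage_coprod z with ⟨x, rfl⟩ | ⟨y, rfl⟩
    · exact (Sec.restr_eq_zero_iff h₁ α t x).1 (congrFun (congrFun e₁ t) x)
    · exact (Sec.restr_eq_zero_iff h₂ α t y).1 (congrFun (congrFun e₂ t) y)
  · subst h₁ h₂
    rintro ⟨a, b⟩
    obtain ⟨α, h₁, h₂⟩ := exists_sec_coprod (E.pullback f) a b
    exact ⟨α, Prod.ext h₁ h₂⟩

section HomotopyPushout

variable {F G Z : SSet.{u}} (f : X ⨿ Y ⟶ F) (g : Y ⨿ Z ⟶ G)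

lemma isPushout_cospanComp (p : SimplexCategoryᵒᵖ) :
    IsPushout ((coprod.map (coprod.inr ≫ f) (coprod.inl ≫ g)).app p)
      ((coprod.desc (SSet.ι₀ : Y ⟶ cyl Y) SSet.ι₁).app p)
      ((pushout.inl _ _ : F ⨿ G ⟶ cospanComp f g).app p) ((cylToComp f g).app p) :=
  isPushout_app (IsPushout.of_hasPushout _ _) p

lemma exists_preimage_cospanComp {p : SimplexCategoryᵒᵖ} (z : (cospanComp f g).obj p) :
    (∃ x, (toCompLeft f g).app p x = z) ∨ (∃ x, (toCompRight f g).app p x = z) ∨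
      ∃ x, (cylToComp f g).app p x = z := by
  rcases exists_preimage_of_isPushout (isPushout_cospanComp f g p) z with ⟨x, rfl⟩ | ⟨x, rfl⟩
  · rcases exists_preimage_coprod x with ⟨x, rfl⟩ | ⟨x, rfl⟩
    · exact Or.inl ⟨x, rfl⟩
    · exact Or.inr (Or.inl ⟨x, rfl⟩)
  · exact Or.inr (Or.inr ⟨x, rfl⟩)

variable {E : Coeff k (cospanComp f g)} {n : ℤ}

lemma sec_cospanComp_eq_zero {α : Sec E n} (hF : α.pull (toCompLeft f g) = 0)
    (hG : α.pull (toCompRight f g) = 0) (hC : α.pull (cylToComp f g) = 0) : α = 0 := by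
  funext t z
  rcases exists_preimage_cospanComp f g z with ⟨x, rfl⟩ | ⟨x, rfl⟩ | ⟨x, rfl⟩
  · exact congrFun (congrFun hF t) x
  · exact congrFun (congrFun hG t) x
  · exact congrFun (congrFun hC t) x

/-- Cochains on a homotopy pushout. -/
lemma exists_sec_cospanComp {v₀ v₁ : Y ⟶ cospanComp f g}
    (hF : (coprod.inr ≫ f) ≫ toCompLeft f g = v₀) (hG : (coprod.inl ≫ g) ≫ toCompRight f g = v₁)
    (hC₀ : SSet.ι₀ ≫ cylToComp f g = v₀) (hC₁ : SSet.ι₁ ≫ cylToComp f g = v₁)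
    (a : Sec (E.pullback (toCompLeft f g)) n) (b : Sec (E.pullback (toCompRight f g)) n)
    (c : Sec (E.pullback (cylToComp f g)) n) (h₀ : a.restr hF = c.restr hC₀)
    (h₁ : b.restr hG = c.restr hC₁) :
    ∃ α : Sec E n, α.pull (toCompLeft f g) = a ∧ α.pull (toCompRight f g) = b ∧
      α.pull (cylToComp f g) = c := by
  have H : ∀ t : Bideg n, ∃ α : ∀ z : Spx (cospanComp f g) t.p, ((E.obj (smp z)).X t.q : Type u),
      (∀ x, α ((toCompLeft f g).app _ x) = a t x) ∧ (∀ x, α ((toCompRight f g).app _ x) = b t x) ∧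
      (∀ x, α ((cylToComp f g).app _ x) = c t x) := by
    intro t
    let V : Spx (cospanComp f g) t.p → Type u := fun z => ((E.obj (smp z)).X t.q : Type u)
    obtain ⟨s, hs₁, hs₂⟩ := exists_section_coprod (X := F) (Y := G) (p := op ⦋t.p⦌)
      (fun z => V ((pushout.inl _ _ : F ⨿ G ⟶ cospanComp f g).app _ z)) (a t) (b t)
    obtain ⟨α, hα₁, hα₂⟩ := exists_section_of_isPushout (isPushout_cospanComp f g (op ⦋t.p⦌)) V s
      (c t) (by
        intro y
        rcases exists_preimage_coprod y with ⟨y, rfl⟩ | ⟨y, rfl⟩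
        · have e₁ : (coprod.map (coprod.inr ≫ f) (coprod.inl ≫ g)).app (op ⦋t.p⦌)
              ((coprod.inl : Y ⟶ Y ⨿ Y).app _ y) =
              (coprod.inl : F ⟶ F ⨿ G).app _ ((coprod.inr ≫ f).app _ y) :=
            ConcreteCategory.congr_hom (NatTrans.congr_app
              (coprod.inl_map (coprod.inr ≫ f) (coprod.inl ≫ g)) (op ⦋t.p⦌)) y
          have e₂ : (coprod.desc (SSet.ι₀ : Y ⟶ cyl Y) SSet.ι₁).app (op ⦋t.p⦌)
              ((coprod.inl : Y ⟶ Y ⨿ Y).app _ y) = (SSet.ι₀ : Y ⟶ cyl Y).app _ y :=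
            ConcreteCategory.congr_hom (NatTrans.congr_app
              (coprod.inl_desc (SSet.ι₀ : Y ⟶ cyl Y) SSet.ι₁) (op ⦋t.p⦌)) y
          refine (heq_of_eq_arg s e₁).trans ((heq_of_eq (hs₁ _)).trans ?_)
          refine HEq.trans ?_ (heq_of_eq_arg (c t) e₂).symm
          refine (Sec.restr_heq hF a t y).symm.trans ?_
          rw [h₀]
          exact Sec.restr_heq hC₀ c t y
        · have e₁ : (coprod.map (coprod.inr ≫ f) (coprod.inl ≫ g)).app (op ⦋t.p⦌)
              ((coprod.inr : Y ⟶ Y ⨿ Y).app _ y) =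
              (coprod.inr : G ⟶ F ⨿ G).app _ ((coprod.inl ≫ g).app _ y) :=
            ConcreteCategory.congr_hom (NatTrans.congr_app
              (coprod.inr_map (coprod.inr ≫ f) (coprod.inl ≫ g)) (op ⦋t.p⦌)) y
          have e₂ : (coprod.desc (SSet.ι₀ : Y ⟶ cyl Y) SSet.ι₁).app (op ⦋t.p⦌)
              ((coprod.inr : Y ⟶ Y ⨿ Y).app _ y) = (SSet.ι₁ : Y ⟶ cyl Y).app _ y :=
            ConcreteCategory.congr_hom (NatTrans.congr_app
              (coprod.inr_desc (SSet.ι₀ : Y ⟶ cyl Y) SSet.ι₁) (op ⦋t.p⦌)) y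
          refine (heq_of_eq_arg s e₁).trans ((heq_of_eq (hs₂ _)).trans ?_)
          refine HEq.trans ?_ (heq_of_eq_arg (c t) e₂).symm
          refine (Sec.restr_heq hG b t y).symm.trans ?_
          rw [h₁]
          exact Sec.restr_heq hC₁ c t y)
    exact ⟨α, fun x => (hα₁ _).trans (hs₁ x), fun x => (hα₁ _).trans (hs₂ x), hα₂⟩
  choose α h₁ h₂ h₃ using H
  exact ⟨α, funext fun t => funext fun x => h₁ t x, funext fun t => funext fun x => h₂ t x,
    funext fun t => funext fun x => h₃ t x⟩

end HomotopyPushout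

end Gluing

/-! ### Duals and pullbacks of local systems. -/

section DualCoefficients

variable {k : Type u} [Field k] {X Y : SSet.{u}}

/-- A dual of a perfect system of coefficients is locally constant. -/
lemma CoeffPairing.IsDual.isLocallyConstant_right {E E' : Coeff k X} {P : CoeffPairing E E'}
    (hP : P.IsDual) : E'.IsLocallyConstant := by
  intro σ τ φ
  have h₁ := hP.2 σ
  have h₂ := hP.2 τ
  have h₃ := hP.1.1 φ
  have h₄ := quasiIso_dualShiftMap (E.map φ) 0
  have e : E'.map φ ≫ (P.pair τ).toDual ≫ dualShiftMap (E.map φ) 0 = (P.pair σ).toDual := by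
    ext n b
    refine LinearMap.ext fun (a : (E.obj σ).X (0 - n)) => ?_
    exact P.natural φ (0 - n) n (by omega) a b
  have h₅ : QuasiIso (E'.map φ ≫ (P.pair τ).toDual ≫ dualShiftMap (E.map φ) 0) := e ▸ h₁
  exact quasiIso_of_comp_right (E'.map φ) ((P.pair τ).toDual ≫ dualShiftMap (E.map φ) 0)

lemma Coeff.IsLocallyConstant.pullback {E : Coeff k Y} (hE : E.IsLocallyConstant) (f : X ⟶ Y) :
    (E.pullback f).IsLocallyConstant := fun _ _ φ => hE ((CategoryOfElements.map f).op.map φ)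

lemma Coeff.IsPerfect.pullback {E : Coeff k Y} (hE : E.IsPerfect) (f : X ⟶ Y) :
    (E.pullback f).IsPerfect :=
  ⟨hE.1.pullback f, fun σ => hE.2 ((CategoryOfElements.map f).op.obj σ)⟩

lemma CoeffPairing.IsDual.pullback {E E' : Coeff k Y} {P : CoeffPairing E E'} (hP : P.IsDual)
    (f : X ⟶ Y) : (P.pullback f).IsDual :=
  ⟨hP.1.pullback f, fun σ => hP.2 ((CategoryOfElements.map f).op.obj σ)⟩

end DualCoefficients

/-! ### Fundamental classes and boundary data on disjoint unions. -/

section DisjointUnion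

variable {k : Type u} [Field k] {d : ℤ} {X Y V T : SSet.{u}}

lemma FundClass.disjUnion_neg_pairing (θ₁ : FundClass k X d) (θ₂ : FundClass k Y d)
    {E E' : Coeff k T} (P : CoeffPairing E E') {f : X ⨿ Y ⟶ T} {v₁ : X ⟶ T} {v₂ : Y ⟶ T}
    (h₁ : coprod.inl ≫ f = v₁) (h₂ : coprod.inr ≫ f = v₂) (i j : ℤ) (h : i + j = d)
    (a : Sec (E.pullback f) i) (b : Sec (E'.pullback f) j) :
    ((θ₁.disjUnion θ₂.neg).pairing (P.pullback f)).toFun i j h a b =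
      ((θ₁.pairing (P.pullback v₁)).prodSub (θ₂.pairing (P.pullback v₂))).toFun i j h
        (a.restr h₁, a.restr h₂) (b.restr h₁, b.restr h₂) := by
  have e₁ := cup_restr h₁ P h a b
  have e₂ := cup_restr h₂ P h a b
  refine Eq.trans ?_ (congrArg₂ (fun x y => θ₁.ev x - θ₂.ev y) e₁ e₂).symm
  exact (sub_eq_add_neg _ _).symm

/-- Sections on the disjoint union are the product of the sections on the summands, and the pairing
becomes the difference of the two perfect pairings. -/
lemma FundClass.isPerfect_disjUnion_neg {θ₁ : FundClass k X d} {θ₂ : FundClass k Y d}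
    (hθ₁ : θ₁.IsOrientation) (hθ₂ : θ₂.IsOrientation) {E E' : Coeff k (X ⨿ Y)}
    (P : CoeffPairing E E') (hP : P.IsDual) :
    ((θ₁.disjUnion θ₂.neg).pairing P).IsPerfect := by
  have hl : (coprod.inl : X ⟶ X ⨿ Y) ≫ 𝟙 _ = coprod.inl := Category.comp_id _
  have hr : (coprod.inr : Y ⟶ X ⨿ Y) ≫ 𝟙 _ = coprod.inr := Category.comp_id _
  exact Pairing.isPerfect_of_bijective (A := sections E) (A' := sections E')
    (prodLift (sectionsRestr E hl) (sectionsRestr E hr))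
    (prodLift (sectionsRestr E' hl) (sectionsRestr E' hr)) (bijective_restr_coprod E hl hr)
    (bijective_restr_coprod E' hl hr) (θ₁.disjUnion_neg_pairing θ₂ P hl hr)
    (((Pairing.isPerfect_iff _).2 (hθ₁.2 _ _ _ (hP.pullback coprod.inl))).prodSub
      ((Pairing.isPerfect_iff _).2 (hθ₂.2 _ _ _ (hP.pullback coprod.inr))))

lemma BoundaryStructure.path_D_disjUnion {θ₁ : FundClass k X d} {θ₂ : FundClass k Y d}
    {f : X ⨿ Y ⟶ V} (γ : BoundaryStructure f (θ₁.disjUnion θ₂.neg)) (c : Coch k V d) :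
    γ.path (c.D rfl) = θ₁.ev (c.pull (coprod.inl ≫ f)) - θ₂.ev (c.pull (coprod.inr ≫ f)) :=
  (γ.path_D c).trans (FundClass.disjUnion_neg_ev _ _ f c)

/-- Splitting the boundary term into its two components is what gives access to `Y` alone, along
which the gluing takes place. -/
lemma BoundaryStructure.isExact_datum_iff {θ₁ : FundClass k X d} {θ₂ : FundClass k Y d}
    {f : X ⨿ Y ⟶ V} (γ : BoundaryStructure f (θ₁.disjUnion θ₂.neg)) {E E' : Coeff k T}
    (P : CoeffPairing E E') {i : V ⟶ T} {v₁ : X ⟶ T} {v₂ : Y ⟶ T}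
    (h₁ : (coprod.inl ≫ f) ≫ i = v₁) (h₂ : (coprod.inr ≫ f) ≫ i = v₂) :
    (γ.datum (P.pullback i)).IsExact ↔
      (boundaryDatum P h₁ h₂ θ₁ θ₂ γ.path γ.path_D_disjUnion).IsExact := by
  subst h₁ h₂
  refine RelDatum.isExact_congr _ _
    (prodLift (sectionsRestr E' (i := f ≫ i) (w := coprod.inl) rfl)
      (sectionsRestr E' (i := f ≫ i) (w := coprod.inr) rfl))
    (bijective_restr_coprod E' (f := f ≫ i) rfl rfl) (fun n a => rfl) ?_ (fun _ _ _ _ _ => rfl)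
  intro m n h e b
  exact θ₁.disjUnion_neg_pairing θ₂ P (f := f ≫ i) rfl rfl m n h (Sec.pull f e) b

end DisjointUnion

/-! ### Relative duality for the cylinder. -/

section CylinderDatum

variable {k : Type u} [Field k] {d : ℤ} {Y T : SSet.{u}} {E : Coeff k T}

lemma Sec.restr_eq_zero {U V : SSet.{u}} {i : V ⟶ T} {w : U ⟶ V} {v : U ⟶ T} (h : w ≫ i = v)
    {n : ℤ} (α : Sec (E.pullback i) n) : α.restr h = 0 ↔ α.pull w = 0 := by
  subst h; rfl

lemma exists_restr_extension {i : cyl Y ⟶ T} {v₀ v₁ : Y ⟶ T} (h₀ : SSet.ι₀ ≫ i = v₀)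
    (h₁ : SSet.ι₁ ≫ i = v₁) {n : ℤ} (c₀ : Sec (E.pullback v₀) n) (c₁ : Sec (E.pullback v₁) n) :
    ∃ e : Sec (E.pullback i) n, e.restr h₀ = c₀ ∧ e.restr h₁ = c₁ ∧
      ∀ (t : Bideg n) (z : Spx (cyl Y) t.p), (∀ y, (SSet.ι₀ : Y ⟶ cyl Y).app _ y ≠ z) →
        (∀ y, (SSet.ι₁ : Y ⟶ cyl Y).app _ y ≠ z) → e t z = 0 := by
  subst h₀ h₁
  exact exists_extension_by_zero (E := E.pullback i) c₀ c₁

lemma FundClass.neg_prism_D (η : FundClass k Y d) (c : Coch k (cyl Y) d) :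
    (-(η.ev ∘ₗ prismLin k Y rfl)) (c.D rfl) =
      η.ev (c.pull SSet.ι₀) - η.ev (c.pull SSet.ι₁) := by
  change -η.ev (prism rfl (c.D rfl)) = _
  rw [η.ev_prism rfl (sub_add_cancel d 1), neg_sub]

/-- The duality datum of a cylinder is exact. -/
lemma isExact_cylinder {η : FundClass k Y d} (hη : η.IsOrientation) {E' : Coeff k T}
    (P : CoeffPairing E E') (hP : P.IsDual) {i : cyl Y ⟶ T} {v₀ v₁ : Y ⟶ T}
    (h₀ : SSet.ι₀ ≫ i = v₀) (h₁ : SSet.ι₁ ≫ i = v₁) :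
    (boundaryDatum P h₀ h₁ η η (-(η.ev ∘ₗ prismLin k Y rfl)) η.neg_prism_D).IsExact := by
  have hd : ∀ (E : Coeff k (cyl Y)) (n n₁ : ℤ) (_ : n + 1 = n₁) (w : Sec E n₁),
      (∀ l, ((sections E).d n₁ l).hom w = 0) → w.D rfl = 0 := fun E n n₁ hn w hw => by
    rw [← sections_d_apply E rfl]
    exact hw _
  -- Opposite ends are used for the two factors: `E` is restricted to the initial end and `E'` to
  -- the terminal one. Then `Γ(C, E')` cancels the terminal boundary term, and duality on the
  -- initial end cancels the rest.
  refine RelDatum.isExact_of_acyclic_kernels _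
    ((Pairing.isPerfect_iff _).2 (hη.2 _ _ _ (hP.pullback v₀))) ?_ ?_ ?_ ?_
  · intro n y
    obtain ⟨e, he, -⟩ := exists_restr_extension h₀ h₁ y 0
    exact ⟨e, he⟩
  · intro n y
    obtain ⟨e, -, he, -⟩ := exists_restr_extension (E := E') h₀ h₁ 0 y
    exact ⟨e, he⟩
  · intro n n₁ hn w hw hw₀
    obtain ⟨v, hv, hvw⟩ := exists_primitive_of_pull_ι₀ (hP.1.1.pullback i) hn rfl
      ((Sec.restr_eq_zero h₀ w).1 hw₀) (hd _ n n₁ hn w hw)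
    exact ⟨v, (sections_d_apply _ hn v).trans hvw, (Sec.restr_eq_zero h₀ v).2 hv⟩
  · intro n n₁ hn w hw hw₀
    obtain ⟨v, hv, hvw⟩ := exists_primitive_of_pull_ι₁ (hP.isLocallyConstant_right.pullback i) hn
      rfl ((Sec.restr_eq_zero h₁ w).1 hw₀) (hd _ n n₁ hn w hw)
    exact ⟨v, (sections_d_apply _ hn v).trans hvw, (Sec.restr_eq_zero h₁ v).2 hv⟩

end CylinderDatum

/-! ### Non-degeneracy of the glued boundary structure. -/

section Composition

variable {k : Type u} [Field k] {d : ℤ} {X Y Z F G : SSet.{u}} (f : X ⨿ Y ⟶ F) (g : Y ⨿ Z ⟶ G)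

lemma inl_compMap : (coprod.inl ≫ f) ≫ toCompLeft f g = coprod.inl ≫ compMap f g := by
  rw [compMap, coprod.inl_desc, Category.assoc]

lemma inr_compMap : (coprod.inr ≫ g) ≫ toCompRight f g = coprod.inr ≫ compMap f g := by
  rw [compMap, coprod.inr_desc, Category.assoc]

variable {f g} {ηX : FundClass k X d} {ηY : FundClass k Y d} {ηZ : FundClass k Z d}

/-- Non-degenerate boundary structures compose. -/
lemma BoundaryStructure.isNondegenerate_glue (hY : ηY.IsOrientation)
    {φ : BoundaryStructure f (ηX.disjUnion ηY.neg)} (hφ : φ.IsNondegenerate)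
    {ψ : BoundaryStructure g (ηY.disjUnion ηZ.neg)} (hψ : ψ.IsNondegenerate) :
    (φ.glue ψ).IsNondegenerate := by
  intro E E' P hP
  -- The two ends of the cylinder give two different maps `Y ⟶ T`, hence two pulled-back systems on
  -- `Y`; this is why the gluing lemma has separate pairings `β₀` and `β₁`.
  have hF₀ : (coprod.inr ≫ f) ≫ toCompLeft f g = SSet.ι₀ ≫ cylToComp f g := by
    rw [ι₀_cylToComp, Category.assoc]
  have hG₁ : (coprod.inl ≫ g) ≫ toCompRight f g = SSet.ι₁ ≫ cylToComp f g := by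
    rw [ι₁_cylToComp, Category.assoc]
  have hT₁ : (coprod.inl ≫ compMap f g) ≫ 𝟙 _ = coprod.inl ≫ compMap f g := Category.comp_id _
  have hT₂ : (coprod.inr ≫ compMap f g) ≫ 𝟙 _ = coprod.inr ≫ compMap f g := Category.comp_id _
  have hF := (φ.isExact_datum_iff P (inl_compMap f g) hF₀).1
    ((φ.quasiIso_toPerp_iff _).1 (hφ _ _ _ (hP.pullback (toCompLeft f g))))
  have hG := (ψ.isExact_datum_iff P hG₁ (inr_compMap f g)).1
    ((ψ.quasiIso_toPerp_iff _).1 (hψ _ _ _ (hP.pullback (toCompRight f g))))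
  have hC := isExact_cylinder hY P hP (i := cylToComp f g) rfl rfl
  have hβ : ∀ v : Y ⟶ cospanComp f g, (ηY.pairing (P.pullback v)).IsPerfect := fun v =>
    (Pairing.isPerfect_iff _).2 (hY.2 _ _ _ (hP.pullback v))
  refine ((φ.glue ψ).quasiIso_toPerp_iff P).2
    (((φ.glue ψ).isExact_datum_iff P (i := 𝟙 _) hT₁ hT₂).2 ?_)
  -- The remaining goals are the decomposition of the glued path, compatibility of the restrictions,
  -- the description of cochains on `T` as a fibre product, and extension of cochains from the ends
  -- of the cylinder.
  refine RelDatum.IsExact.glue hF hG hC (hβ _) (hβ _)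
    (sectionsPullback (toCompLeft f g) E) (sectionsPullback (toCompRight f g) E)
    (sectionsPullback (cylToComp f g) E) (sectionsPullback (toCompLeft f g) E')
    (sectionsPullback (toCompRight f g) E') (sectionsPullback (cylToComp f g) E')
    ?_ ?_ ?_ ?_ ?_ ?_ ?_ ?_ ?_ ?_ ?_ ?_ ?_ ?_ ?_
  · intro i j h e a
    have e₁ := cup_pull (toCompLeft f g) P h e a
    have e₂ := cup_pull (toCompRight f g) P h e a
    have e₃ := cup_pull (cylToComp f g) P h e a
    change φ.path ((cup P h e a).pull _) + ψ.path ((cup P h e a).pull _) -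
      ηY.ev (prism rfl ((cup P h e a).pull _)) =
      φ.path (cup (P.pullback (toCompLeft f g)) h (Sec.pull _ e) (Sec.pull _ a)) +
      ψ.path (cup (P.pullback (toCompRight f g)) h (Sec.pull _ e) (Sec.pull _ a)) +
      -ηY.ev (prism rfl (cup (P.pullback (cylToComp f g)) h (Sec.pull _ e) (Sec.pull _ a)))
    rw [e₁, e₂, e₃, sub_eq_add_neg]
  · exact fun n e => (Sec.restr_pull (E := E) hT₁ e).trans (Sec.restr_pull (inl_compMap f g) e).symm
  · exact fun n e => (Sec.restr_pull (E := E) hT₂ e).trans (Sec.restr_pull (inr_compMap f g) e).symm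
  · exact fun n e => (Sec.restr_pull (E := E') hT₁ e).trans
      (Sec.restr_pull (inl_compMap f g) e).symm
  · exact fun n e => (Sec.restr_pull (E := E') hT₂ e).trans
      (Sec.restr_pull (inr_compMap f g) e).symm
  · exact fun n e => Sec.restr_pull (E := E) hF₀ e
  · exact fun n e => Sec.restr_pull (E := E) hG₁ e
  · exact fun n e => Sec.restr_pull (E := E') hF₀ e
  · exact fun n e => Sec.restr_pull (E := E') hG₁ e
  · exact fun n e => sec_cospanComp_eq_zero f g
  · exact fun n e => sec_cospanComp_eq_zero f g
  · exact fun n a b c => exists_sec_cospanComp f g hF₀ hG₁ rfl rfl a b c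
  · exact fun n a b c => exists_sec_cospanComp f g hF₀ hG₁ rfl rfl a b c
  · rintro n ⟨c₀, c₁⟩
    obtain ⟨e, h₀, h₁, -⟩ := exists_restr_extension (E := E) (i := cylToComp f g) rfl rfl c₀ c₁
    exact ⟨e, Prod.ext h₀ h₁⟩
  · rintro n ⟨c₀, c₁⟩
    obtain ⟨e, h₀, h₁, -⟩ := exists_restr_extension (E := E') (i := cylToComp f g) rfl rfl c₀ c₁
    exact ⟨e, Prod.ext h₀ h₁⟩

end Composition

/-! ### Perfect complexes in short exact sequences. -/

section PerfectComplexes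

variable {k : Type u} [Field k]

lemma moduleFinite_of_exact {S : ShortComplex (ModuleCat.{u} k)} (hS : S.Exact)
    [Module.Finite k S.X₁] [Module.Finite k S.X₃] : Module.Finite k S.X₂ := by
  have h : LinearMap.range S.f.hom = LinearMap.ker S.g.hom := hS.moduleCat_range_eq_ker
  have h₁ : Module.Finite k (LinearMap.ker S.g.hom) := h ▸ inferInstance
  have h₂ : Module.Finite k (LinearMap.range S.g.hom) := inferInstance
  have h₃ : Module.Finite k (S.X₂ ⧸ LinearMap.ker S.g.hom) :=
    Module.Finite.equiv S.g.hom.quotKerEquivRange.symm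
  exact Module.Finite.of_submodule_quotient (LinearMap.ker S.g.hom)

lemma isZero_of_exact {S : ShortComplex (ModuleCat.{u} k)} (hS : S.Exact) (h₁ : IsZero S.X₁)
    (h₃ : IsZero S.X₃) : IsZero S.X₂ :=
  hS.isZero_X₂ (h₁.eq_of_src _ _) (h₃.eq_of_tgt _ _)

lemma shortExact_of_elem {A B C : Cpx k} (f : A ⟶ B) (g : B ⟶ C)
    (inj : ∀ n a, (f.f n).hom a = 0 → a = 0) (surj : ∀ n, Function.Surjective (g.f n).hom)
    (w : f ≫ g = 0) (ex : ∀ n b, (g.f n).hom b = 0 → ∃ a, (f.f n).hom a = b) :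
    (ShortComplex.mk f g w).ShortExact := by
  refine HomologicalComplex.shortExact_of_degreewise_shortExact _ fun n => ?_
  refine ShortComplex.ShortExact.mk' ?_ ?_ ?_
  · rw [ShortComplex.moduleCat_exact_iff]
    exact ex n
  · exact (ModuleCat.mono_iff_injective _).2 ((injective_iff_map_eq_zero (f.f n).hom).2 (inj n))
  · exact (ModuleCat.epi_iff_surjective _).2 (surj n)

lemma IsPerfectCpx.of_shortExact₁ {S : ShortComplex (Cpx k)} (hS : S.ShortExact)
    (h₂ : IsPerfectCpx S.X₂) (h₃ : IsPerfectCpx S.X₃) : IsPerfectCpx S.X₁ := by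
  have ex := fun n : ℤ => hS.homology_exact₁ (n - 1) n (sub_add_cancel n 1)
  constructor
  · intro n
    have i₁ := h₃.1 (n - 1)
    have i₂ := h₂.1 n
    exact moduleFinite_of_exact (ex n)
  · refine (h₂.2.union (h₃.2.image (· + 1))).subset fun n hn => ?_
    by_contra h
    rw [Set.mem_union, not_or] at h
    refine hn (isZero_of_exact (ex n) (not_not.1 fun h' => h.2 ⟨n - 1, h', ?_⟩) (not_not.1 h.1))
    exact sub_add_cancel n 1

lemma IsPerfectCpx.of_shortExact₂ {S : ShortComplex (Cpx k)} (hS : S.ShortExact)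
    (h₁ : IsPerfectCpx S.X₁) (h₃ : IsPerfectCpx S.X₃) : IsPerfectCpx S.X₂ := by
  have ex := fun n : ℤ => hS.homology_exact₂ n
  constructor
  · intro n
    have i₁ := h₁.1 n
    have i₂ := h₃.1 n
    exact moduleFinite_of_exact (ex n)
  · refine (h₁.2.union h₃.2).subset fun n hn => ?_
    by_contra h
    rw [Set.mem_union, not_or] at h
    exact hn (isZero_of_exact (ex n) (not_not.1 h.1) (not_not.1 h.2))

lemma IsPerfectCpx.of_quasiIso {A B : Cpx k} (φ : A ⟶ B) [QuasiIso φ] (h : IsPerfectCpx B) :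
    IsPerfectCpx A := by
  have e := fun n : ℤ => asIso (HomologicalComplex.homologyMap φ n)
  constructor
  · intro n
    have := h.1 n
    exact Module.Finite.equiv (e n).toLinearEquiv.symm
  · exact h.2.subset fun n hn hB => hn (hB.of_iso (e n))

/-- The first projection from a product of complexes. -/
def prodFst (A B : Cpx k) : prodCpx A B ⟶ A where
  f n := ModuleCat.ofHom (LinearMap.fst k (A.X n) (B.X n))
  comm' _ _ _ := rfl

/-- The second projection from a product of complexes. -/
def prodSnd (A B : Cpx k) : prodCpx A B ⟶ B where
  f n := ModuleCat.ofHom (LinearMap.snd k (A.X n) (B.X n))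
  comm' _ _ _ := rfl

lemma IsPerfectCpx.prodCpx {A B : Cpx k} (hA : IsPerfectCpx A) (hB : IsPerfectCpx B) :
    IsPerfectCpx (prodCpx A B) :=
  IsPerfectCpx.of_shortExact₂ (shortExact_of_elem (prodLift (𝟙 A) 0) (prodSnd A B)
    (fun _ _ h => congrArg Prod.fst h) (fun _ b => ⟨(0, b), rfl⟩) rfl
    (fun _ b (hb : b.2 = 0) => ⟨b.1, Prod.ext rfl hb.symm⟩)) hA hB

/-- A surjective morphism with acyclic kernel is a quasi-isomorphism. -/
lemma quasiIso_of_acyclic_kernel {A B : Cpx k} (φ : A ⟶ B)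
    (surj : ∀ n, Function.Surjective (φ.f n).hom)
    (ac : ∀ n n₁, n + 1 = n₁ → ∀ w : A.X n₁, (∀ l, (A.d n₁ l).hom w = 0) → (φ.f n₁).hom w = 0 →
      ∃ v : A.X n, (A.d n n₁).hom v = w ∧ (φ.f n).hom v = 0) : QuasiIso φ := by
  rw [quasiIso_iff_elem]
  intro n₀ n n₁ h₀ h₁ a x ha hx
  obtain ⟨x, rfl⟩ := surj n x
  obtain ⟨v, hv, hv'⟩ := ac n n₁ h₁ (a - (A.d n n₁).hom x)
    (fun l => by rw [map_sub, ha, d_d_apply, sub_zero])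
    (by rw [map_sub, hx, comm_apply, sub_self])
  refine ⟨x + v, 0, ?_, ?_⟩
  · rw [map_add, hv, add_sub_cancel]
  · rw [map_zero, map_add, hv', add_zero, sub_self]

lemma quasiIso_of_bijective {A B : Cpx k} (φ : A ⟶ B)
    (h : ∀ n, Function.Bijective (φ.f n).hom) : QuasiIso φ :=
  quasiIso_of_acyclic_kernel φ (fun n => (h n).2) fun n n₁ _ w _ hw => by
    obtain rfl : w = 0 := (h n₁).1 (hw.trans (map_zero _).symm)
    exact ⟨0, map_zero _, map_zero _⟩

end PerfectComplexes

/-! ### Perfectness of sections on disjoint unions and homotopy pushouts. -/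

section PerfectSections

variable {k : Type u} [Field k] {X Y Z F G : SSet.{u}}

lemma isPerfectCpx_sections_coprod (hX : ∀ E : Coeff k X, E.IsPerfect → IsPerfectCpx (sections E))
    (hZ : ∀ E : Coeff k Z, E.IsPerfect → IsPerfectCpx (sections E)) (E : Coeff k (X ⨿ Z))
    (hE : E.IsPerfect) : IsPerfectCpx (sections E) := by
  have hl : (coprod.inl : X ⟶ X ⨿ Z) ≫ 𝟙 _ = coprod.inl := Category.comp_id _
  have hr : (coprod.inr : Z ⟶ X ⨿ Z) ≫ 𝟙 _ = coprod.inr := Category.comp_id _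
  let φ : sections E ⟶ _ := prodLift (sectionsRestr E hl) (sectionsRestr E hr)
  have : QuasiIso φ := quasiIso_of_bijective φ (bijective_restr_coprod E hl hr)
  exact IsPerfectCpx.of_quasiIso φ
    ((hX _ (hE.pullback _)).prodCpx (hZ _ (hE.pullback _)))

/-- Restriction to the initial end of a cylinder is a quasi-isomorphism. -/
lemma quasiIso_pullback_ι₀ (E : Coeff k (cyl Y)) (hE : E.IsLocallyConstant) :
    QuasiIso (sectionsPullback (SSet.ι₀ : Y ⟶ cyl Y) E) := by
  refine quasiIso_of_acyclic_kernel _ (fun n c => ?_) fun n n₁ h w hw hw₀ => ?_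
  · obtain ⟨e, he, -⟩ := exists_extension_by_zero (E := E) c 0
    exact ⟨e, he⟩
  · obtain ⟨v, hv, hvw⟩ := exists_primitive_of_pull_ι₀ hE h rfl (α := w) hw₀
      ((sections_d_apply E rfl w).symm.trans (hw _))
    exact ⟨v, (sections_d_apply _ h v).trans hvw, hv⟩

/-- This is the Mayer–Vietoris sequence `0 → Γ(T) → Γ(F) × Γ(G) × Γ(Y × Δ¹) → Γ(Y) × Γ(Y) → 0`, in
which the cylinder has perfect sections because restriction to its initial end is a
quasi-isomorphism. -/
lemma isPerfectCpx_sections_cospanComp (f : X ⨿ Y ⟶ F) (g : Y ⨿ Z ⟶ G)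
    (hY : ∀ E : Coeff k Y, E.IsPerfect → IsPerfectCpx (sections E))
    (hF : ∀ E : Coeff k F, E.IsPerfect → IsPerfectCpx (sections E))
    (hG : ∀ E : Coeff k G, E.IsPerfect → IsPerfectCpx (sections E))
    (E : Coeff k (cospanComp f g)) (hE : E.IsPerfect) : IsPerfectCpx (sections E) := by
  have hF₀ : (coprod.inr ≫ f) ≫ toCompLeft f g = SSet.ι₀ ≫ cylToComp f g := by
    rw [ι₀_cylToComp, Category.assoc]
  have hG₁ : (coprod.inl ≫ g) ≫ toCompRight f g = SSet.ι₁ ≫ cylToComp f g := by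
    rw [ι₁_cylToComp, Category.assoc]
  have hC : IsPerfectCpx (sections (E.pullback (cylToComp f g))) := by
    have := quasiIso_pullback_ι₀ _ (hE.1.pullback (cylToComp f g))
    exact IsPerfectCpx.of_quasiIso (sectionsPullback (SSet.ι₀ : Y ⟶ cyl Y) _)
      (hY _ ((hE.pullback _).pullback _))
  let FC := sections (E.pullback (toCompLeft f g))
  let GC := sections (E.pullback (toCompRight f g))
  let CC := sections (E.pullback (cylToComp f g))
  let ρ : prodCpx FC (prodCpx GC CC) ⟶ _ := prodLift
    (prodFst FC (prodCpx GC CC) ≫ sectionsRestr E hF₀ -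
      prodSnd FC (prodCpx GC CC) ≫ prodSnd GC CC ≫
        sectionsRestr E (w := SSet.ι₀) (i := cylToComp f g) rfl)
    (prodSnd FC (prodCpx GC CC) ≫ prodFst GC CC ≫ sectionsRestr E hG₁ -
      prodSnd FC (prodCpx GC CC) ≫ prodSnd GC CC ≫
        sectionsRestr E (w := SSet.ι₁) (i := cylToComp f g) rfl)
  have hρ : ∀ n (x : (prodCpx FC (prodCpx GC CC)).X n), (ρ.f n).hom x =
      (Sec.restr hF₀ x.1 - Sec.restr rfl x.2.2, Sec.restr hG₁ x.2.1 - Sec.restr rfl x.2.2) :=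
    fun n x => rfl
  let j : sections E ⟶ prodCpx FC (prodCpx GC CC) := prodLift (sectionsPullback _ E)
    (prodLift (sectionsPullback _ E) (sectionsPullback _ E))
  have w : j ≫ ρ = 0 := by
    ext n α
    refine (hρ n ((j.f n).hom α)).trans ?_
    refine Prod.ext ?_ ?_
    · exact sub_eq_zero.2 (Sec.restr_pull (E := E) hF₀ α)
    · exact sub_eq_zero.2 (Sec.restr_pull (E := E) hG₁ α)
  refine IsPerfectCpx.of_shortExact₁ (S := ShortComplex.mk j ρ w)
    (shortExact_of_elem j ρ ?_ ?_ w ?_)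
    ((hF _ (hE.pullback _)).prodCpx ((hG _ (hE.pullback _)).prodCpx hC))
    ((hY _ (hE.pullback _)).prodCpx (hY _ (hE.pullback _)))
  · intro n α hα
    exact sec_cospanComp_eq_zero f g (congrArg Prod.fst hα)
      (congrArg Prod.fst (congrArg Prod.snd hα)) (congrArg Prod.snd (congrArg Prod.snd hα))
  · rintro n ⟨c₀, c₁⟩
    obtain ⟨e, h₀, h₁, -⟩ := exists_restr_extension (E := E) (i := cylToComp f g) rfl rfl c₀ c₁
    -- Surjectivity comes from the cylinder alone, by extending cochains from its ends; the sign is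
    -- there because `ρ` subtracts the cylinder component.
    refine ⟨(0, 0, -e), (hρ n _).trans (Prod.ext ?_ ?_)⟩
    · change Sec.restr hF₀ 0 - (-(Sec.restr rfl e)) = c₀
      rw [Sec.restr_zero, h₀]
      exact (zero_sub _).trans (neg_neg _)
    · change Sec.restr hG₁ 0 - (-(Sec.restr rfl e)) = c₁
      rw [Sec.restr_zero, h₁]
      exact (zero_sub _).trans (neg_neg _)
  · rintro n ⟨a, b, c⟩ h
    obtain ⟨α, h₁, h₂, h₃⟩ := exists_sec_cospanComp f g hF₀ hG₁ rfl rfl a b c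
      (sub_eq_zero.1 (congrArg Prod.fst ((hρ n (a, b, c)).symm.trans h)))
      (sub_eq_zero.1 (congrArg Prod.snd ((hρ n (a, b, c)).symm.trans h)))
    exact ⟨α, Prod.ext h₁ (Prod.ext h₂ h₃)⟩

end PerfectSections

/-! ### Explicit direct sums of complexes and of local systems. -/

section DirectSums

variable {k : Type u} [Field k] {ι : Type u}

/-- The direct sum of a family of complexes. -/
def dsumCpx (A : ι → Cpx k) : Cpx k where
  X n := ModuleCat.of k (Π₀ i, (A i).X n)
  d m n := ModuleCat.ofHom (DFinsupp.mapRange.linearMap fun i => ((A i).d m n).hom)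
  shape m n h := ModuleCat.hom_ext (LinearMap.ext fun x => DFinsupp.ext fun i =>
    hom_apply_eq ((A i).shape m n h) (x i))
  d_comp_d' l m n _ _ := ModuleCat.hom_ext (LinearMap.ext fun x => DFinsupp.ext fun i =>
    d_d_apply (A i) l m n (x i))

/-- A component of an element of a direct sum. -/
def dsumCoord {A : ι → Cpx k} {n : ℤ} (x : (dsumCpx A).X n) (i : ι) : (A i).X n :=
  (show Π₀ i, (A i).X n from x) i

lemma dsumCpx_ext {A : ι → Cpx k} {n : ℤ} {x y : (dsumCpx A).X n}
    (h : ∀ i, dsumCoord x i = dsumCoord y i) : x = y := DFinsupp.ext h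

lemma eventually_dsumCoord_eq_zero {A : ι → Cpx k} {n : ℤ} (x : (dsumCpx A).X n) :
    ∀ᶠ i in Filter.cofinite, dsumCoord x i = 0 := by
  refine Filter.eventually_cofinite.2 ?_
  exact DFinsupp.finite_support (show Π₀ i, (A i).X n from x)

lemma exists_dsumCoord {A : ι → Cpx k} {n : ℤ} (x : ∀ i, (A i).X n)
    (hx : ∀ᶠ i in Filter.cofinite, x i = 0) : ∃ y : (dsumCpx A).X n, ∀ i, dsumCoord y i = x i := by
  classical
  have hf := Filter.eventually_cofinite.1 hx
  refine ⟨(show Π₀ i, (A i).X n from DFinsupp.mk hf.toFinset fun i => x i), fun i => ?_⟩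
  refine DFinsupp.mk_apply.trans ?_
  split_ifs with h
  · rfl
  · rw [Set.Finite.mem_toFinset, Set.mem_ofPred_eq, not_not] at h
    exact h.symm

/-- The map of direct sums induced by a family of morphisms. -/
def dsumMap {A B : ι → Cpx k} (φ : ∀ i, A i ⟶ B i) : dsumCpx A ⟶ dsumCpx B where
  f n := ModuleCat.ofHom (DFinsupp.mapRange.linearMap fun i => ((φ i).f n).hom)
  comm' m n _ := ModuleCat.hom_ext (LinearMap.ext fun x => DFinsupp.ext fun i =>
    comm_apply (φ i) m n ((show Π₀ i, (A i).X m from x) i))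

/-- A projection of a direct sum. -/
def dsumProj (A : ι → Cpx k) (i : ι) : dsumCpx A ⟶ A i where
  f _ := ModuleCat.ofHom (DFinsupp.lapply i)
  comm' _ _ _ := rfl

open Classical in
/-- An inclusion into a direct sum. -/
def dsumInj (A : ι → Cpx k) (i : ι) : A i ⟶ dsumCpx A where
  f n := ModuleCat.ofHom (DFinsupp.lsingle (R := k) (M := fun i => (A i).X n) i)
  comm' m n _ := ModuleCat.hom_ext (LinearMap.ext fun x =>
    DFinsupp.mapRange_single (f := fun i => ((A i).d m n).hom) (hf := fun _ => map_zero _)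
      (i := i) (b := x))

open Classical in
/-- The morphism out of a direct sum given by a family of morphisms. -/
def dsumDesc {A : ι → Cpx k} {B : Cpx k} (φ : ∀ i, A i ⟶ B) : dsumCpx A ⟶ B where
  f n := ModuleCat.ofHom (DFinsupp.lsum ℕ fun i => ((φ i).f n).hom)
  comm' m n _ := ModuleCat.hom_ext (DFinsupp.lhom_ext fun i x => by
    change (B.d m n).hom (DFinsupp.lsum ℕ (fun i => ((φ i).f m).hom) (DFinsupp.single i x)) =
      DFinsupp.lsum ℕ (fun i => ((φ i).f n).hom)
        (DFinsupp.mapRange (fun i => ((A i).d m n).hom) (fun _ => map_zero _) (DFinsupp.single i x))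
    rw [DFinsupp.mapRange_single, DFinsupp.lsum_single, DFinsupp.lsum_single, comm_apply])

lemma dsumInj_desc {A : ι → Cpx k} {B : Cpx k} (φ : ∀ i, A i ⟶ B) (i : ι) :
    dsumInj A i ≫ dsumDesc φ = φ i := by
  classical
  ext n x
  exact DFinsupp.lsum_single ℕ (fun i => ((φ i).f n).hom) i x

lemma dsumCpx_hom_ext {A : ι → Cpx k} {B : Cpx k} {φ ψ : dsumCpx A ⟶ B}
    (h : ∀ i, dsumInj A i ≫ φ = dsumInj A i ≫ ψ) : φ = ψ := by
  classical
  refine HomologicalComplex.hom_ext _ _ fun n => ModuleCat.hom_ext ?_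
  exact DFinsupp.lhom_ext fun i x =>
    by
      have e := hom_apply_eq (congrArg (fun χ : A i ⟶ B => χ.f n) (h i)) x
      have e' : ((dsumInj A i).f n).hom x = (DFinsupp.single i x : Π₀ i, (A i).X n) := rfl
      change (φ.f n).hom (((dsumInj A i).f n).hom x) = (ψ.f n).hom (((dsumInj A i).f n).hom x) at e
      rw [e'] at e
      exact e

lemma dsumCoord_inj_same {A : ι → Cpx k} {n : ℤ} (i : ι) (x : (A i).X n) :
    dsumCoord (((dsumInj A i).f n).hom x) i = x := by
  classical
  exact DFinsupp.single_eq_same (β := fun i => (A i).X n)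

lemma dsumCoord_inj_of_ne {A : ι → Cpx k} {n : ℤ} {i j : ι} (h : i ≠ j) (x : (A i).X n) :
    dsumCoord (((dsumInj A i).f n).hom x) j = 0 := by
  classical
  exact DFinsupp.single_eq_of_ne (β := fun i => (A i).X n) h.symm

lemma dsumInj_map {A B : ι → Cpx k} (φ : ∀ i, A i ⟶ B i) (i : ι) :
    dsumInj A i ≫ dsumMap φ = φ i ≫ dsumInj B i := by
  classical
  ext n x
  exact DFinsupp.mapRange_single (f := fun i => ((φ i).f n).hom) (hf := fun _ => map_zero _)
    (i := i) (b := x)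

lemma quasiIso_dsumMap {A B : ι → Cpx k} (φ : ∀ i, A i ⟶ B i) (h : ∀ i, QuasiIso (φ i)) :
    QuasiIso (dsumMap φ) := by
  rw [quasiIso_iff_elem]
  intro n₀ n n₁ h₀ h₁ a x ha hx
  -- The last clause forces zero solutions where the data vanish, so that the chosen families have
  -- finite support.
  have H : ∀ i, ∃ (a' : (A i).X n) (x' : (B i).X n₀), ((A i).d n n₁).hom a' = dsumCoord a i ∧
      ((B i).d n₀ n).hom x' = ((φ i).f n).hom a' - dsumCoord x i ∧
      (dsumCoord a i = 0 → dsumCoord x i = 0 → a' = 0 ∧ x' = 0) := by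
    intro i
    by_cases hi : dsumCoord a i = 0 ∧ dsumCoord x i = 0
    · refine ⟨0, 0, ?_, ?_, fun _ _ => ⟨rfl, rfl⟩⟩
      · rw [hi.1, map_zero]
      · rw [hi.2, map_zero, map_zero, sub_zero]
    · obtain ⟨a', x', h₁, h₂⟩ := (quasiIso_iff_elem _).1 (h i) n₀ n n₁ h₀ h₁ (dsumCoord a i)
        (dsumCoord x i) (fun l => congrArg (dsumCoord · i) (ha l)) (congrArg (dsumCoord · i) hx)
      exact ⟨a', x', h₁, h₂, fun h h' => absurd ⟨h, h'⟩ hi⟩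
  choose a' x' e₁ e₂ e₃ using H
  have ev := (eventually_dsumCoord_eq_zero a).and (eventually_dsumCoord_eq_zero x)
  obtain ⟨α, hα⟩ := exists_dsumCoord a' (ev.mono fun i hi => (e₃ i hi.1 hi.2).1)
  obtain ⟨ξ, hξ⟩ := exists_dsumCoord x' (ev.mono fun i hi => (e₃ i hi.1 hi.2).2)
  refine ⟨α, ξ, dsumCpx_ext fun i => ?_, dsumCpx_ext fun i => ?_⟩
  · exact (congrArg ((A i).d n n₁).hom (hα i)).trans (e₁ i)
  · refine (congrArg ((B i).d n₀ n).hom (hξ i)).trans ((e₂ i).trans ?_)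
    rw [← hα i]
    rfl

/-- The direct sum of complexes is their coproduct. -/
def dsumIsColimit (A : ι → Cpx k) : IsColimit (Cofan.mk (dsumCpx A) (dsumInj A)) :=
  Cofan.IsColimit.mk _ (fun s => dsumDesc s.inj) (fun _ i => dsumInj_desc _ i) fun _ _ hm =>
    dsumCpx_hom_ext fun i => (hm i).trans (dsumInj_desc _ i).symm

variable {X : SSet.{u}}

/-- The direct sum of a family of coefficients. -/
def dsumCoeff (E : ι → Coeff k X) : Coeff k X where
  obj σ := dsumCpx fun i => (E i).obj σ
  map θ := dsumMap fun i => (E i).map θ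
  map_id σ := dsumCpx_hom_ext fun i => by
    rw [dsumInj_map, (E i).map_id, Category.id_comp, Category.comp_id]
  map_comp θ θ' := dsumCpx_hom_ext fun i => by
    rw [dsumInj_map, (E i).map_comp, ← Category.assoc, dsumInj_map, Category.assoc, Category.assoc,
      dsumInj_map]

lemma isLocallyConstant_dsumCoeff {E : ι → Coeff k X} (hE : ∀ i, (E i).IsLocallyConstant) :
    (dsumCoeff E).IsLocallyConstant := fun _ _ θ => quasiIso_dsumMap _ fun i => hE i θ

/-- An inclusion into a direct sum of coefficients. -/
def dsumCoeffInj (E : ι → Coeff k X) (i : ι) : E i ⟶ dsumCoeff E where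
  app σ := dsumInj (fun i => (E i).obj σ) i
  naturality _ _ θ := (dsumInj_map (fun i => (E i).map θ) i).symm

/-- A projection of a direct sum of coefficients. -/
def dsumCoeffProj (E : ι → Coeff k X) (i : ι) : dsumCoeff E ⟶ E i where
  app σ := dsumProj (fun i => (E i).obj σ) i
  naturality _ _ _ := rfl

/-- The direct sum of coefficients is their coproduct. -/
def dsumCoeffIsColimit (E : ι → Coeff k X) : IsColimit (Cofan.mk (dsumCoeff E) (dsumCoeffInj E)) :=
  Cofan.IsColimit.mk _
    (fun s =>
      { app := fun σ => dsumDesc fun i => (s.inj i).app σ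
        naturality := fun σ τ θ => dsumCpx_hom_ext (A := fun i => (E i).obj σ) fun i => by
          change dsumInj (fun i => (E i).obj σ) i ≫ dsumMap _ ≫ dsumDesc _ =
            dsumInj (fun i => (E i).obj σ) i ≫ dsumDesc _ ≫ s.pt.map θ
          rw [← Category.assoc, dsumInj_map, Category.assoc, dsumInj_desc, ← Category.assoc,
            dsumInj_desc]
          exact (s.inj i).naturality θ })
    (fun _ i => NatTrans.ext (funext fun _ => dsumInj_desc _ i)) fun s _ hm =>
      NatTrans.ext (funext fun σ => dsumCpx_hom_ext fun i =>
        (NatTrans.congr_app (hm i) σ).trans (dsumInj_desc (fun i => (s.inj i).app σ) i).symm)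

/-- The comparison map from the direct sum of the sections to the sections of the direct sum. -/
def dsumSections (E : ι → Coeff k X) : dsumCpx (fun i => sections (E i)) ⟶ sections (dsumCoeff E) :=
  dsumDesc fun i => sectionsMap (dsumCoeffInj E i)

/-- The abstract coproducts, of complexes and of coefficients, are compared with the explicit direct
sums by uniqueness of colimits. -/
lemma quasiIso_sigma_desc_iff (E : ι → Coeff k X) :
    QuasiIso (Sigma.desc fun i => (sectionsFunctor k X).map (Sigma.ι E i)) ↔
      QuasiIso (dsumSections E) := by
  let e : (∐ fun i => (sectionsFunctor k X).obj (E i)) ≅ dsumCpx fun i => sections (E i) :=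
    (colimit.isColimit _).coconePointUniqueUpToIso (dsumIsColimit _)
  let e' : (∐ E) ≅ dsumCoeff E :=
    (colimit.isColimit _).coconePointUniqueUpToIso (dsumCoeffIsColimit E)
  have he : ∀ i, Sigma.ι (fun i => (sectionsFunctor k X).obj (E i)) i ≫ e.hom =
      dsumInj (fun i => sections (E i)) i := fun i =>
    (colimit.isColimit _).comp_coconePointUniqueUpToIso_hom (dsumIsColimit fun i => sections (E i)) ⟨i⟩
  have he' : ∀ i, Sigma.ι E i ≫ e'.hom = dsumCoeffInj E i := fun i =>
    (colimit.isColimit _).comp_coconePointUniqueUpToIso_hom (dsumCoeffIsColimit E) ⟨i⟩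
  have key : (Sigma.desc fun i => (sectionsFunctor k X).map (Sigma.ι E i)) ≫
      (sectionsFunctor k X).map e'.hom = e.hom ≫ dsumSections E := by
    refine Sigma.hom_ext _ _ fun i => ?_
    rw [← Category.assoc, Sigma.ι_desc, ← Functor.map_comp, he']
    refine Eq.trans ?_ ((congrArg (· ≫ dsumSections E) (he i)).symm.trans (Category.assoc _ _ _))
    exact (dsumInj_desc (fun i => sectionsMap (dsumCoeffInj E i)) i).symm
  rw [← quasiIso_iff_comp_right _ ((sectionsFunctor k X).map e'.hom), key]
  exact quasiIso_iff_comp_left e.hom (dsumSections E)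

end DirectSums

/-! ### Direct sums and locally finite families of cochains. -/

section LocallyFinite

variable {k : Type u} [Field k] {X Y : SSet.{u}} {ι : Type u}

/-- Families of cochains of which only finitely many are nonzero on each simplex. -/
def LocallyFinite {E : ι → Coeff k X} {n : ℤ} (a : ∀ i, Sec (E i) n) : Prop :=
  ∀ (t : Bideg n) (σ : Spx X t.p), ∀ᶠ i in Filter.cofinite, a i t σ = 0

lemma LocallyFinite.of_eventually {E : ι → Coeff k X} {n : ℤ} {a : ∀ i, Sec (E i) n}
    (h : ∀ᶠ i in Filter.cofinite, a i = 0) : LocallyFinite a := fun t σ =>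
  h.mono fun i hi => by rw [hi]; rfl

/-- The components of a cochain with coefficients in a direct sum. -/
def Sec.coord {E : ι → Coeff k X} {n : ℤ} (α : Sec (dsumCoeff E) n) (i : ι) : Sec (E i) n :=
  α.map (dsumCoeffProj E i)

lemma Sec.coord_locallyFinite {E : ι → Coeff k X} {n : ℤ} (α : Sec (dsumCoeff E) n) :
    LocallyFinite α.coord := fun t σ => eventually_dsumCoord_eq_zero (α t σ)

lemma Sec.coord_D {E : ι → Coeff k X} {n n' : ℤ} (hn : n + 1 = n') (α : Sec (dsumCoeff E) n)
    (i : ι) : (α.D hn).coord i = (α.coord i).D hn :=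
  (Sec.map_D (dsumCoeffProj E i) hn α).symm

lemma Sec.coord_ext {E : ι → Coeff k X} {n : ℤ} {α β : Sec (dsumCoeff E) n}
    (h : ∀ i, α.coord i = β.coord i) : α = β :=
  funext fun t => funext fun σ => dsumCpx_ext fun i => congrFun (congrFun (h i) t) σ

lemma LocallyFinite.exists_coord {E : ι → Coeff k X} {n : ℤ} {a : ∀ i, Sec (E i) n}
    (ha : LocallyFinite a) : ∃ α : Sec (dsumCoeff E) n, ∀ i, α.coord i = a i := by
  choose α hα using fun (t : Bideg n) (σ : Spx X t.p) =>
    exists_dsumCoord (A := fun i => (E i).obj (smp σ)) (fun i => a i t σ) (ha t σ)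
  exact ⟨α, fun i => funext fun t => funext fun σ => hα t σ i⟩

lemma coord_dsumSections (E : ι → Coeff k X) {n : ℤ}
    (x : (dsumCpx fun i => sections (E i)).X n) (j : ι) :
    Sec.coord (((dsumSections E).f n).hom x) j = dsumCoord x j := by
  have key : dsumSections E ≫ sectionsMap (dsumCoeffProj E j) = dsumProj _ j := by
    refine dsumCpx_hom_ext fun i => ?_
    rw [dsumSections, ← Category.assoc, dsumInj_desc]
    ext n a
    refine funext fun t => funext fun σ => ?_
    by_cases hij : i = j
    · subst hij
      exact (dsumCoord_inj_same (A := fun i => (E i).obj (smp σ)) i _).trans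
        (congrFun (congrFun (dsumCoord_inj_same (A := fun i => sections (E i)) i a) t) σ).symm
    · exact (dsumCoord_inj_of_ne (A := fun i => (E i).obj (smp σ)) hij _).trans
        (congrFun (congrFun (dsumCoord_inj_of_ne (A := fun i => sections (E i)) hij a) t) σ).symm
  exact hom_apply_eq (congrArg (fun χ => χ.f n) key) x

/-- Every locally finite family of cochains, almost all of which are cocycles, is almost
everywhere the coboundary of a locally finite family. -/
def AlmostExact (E : ι → Coeff k X) : Prop :=
  ∀ ⦃n₀ n n₁ : ℤ⦄ (h₀ : n₀ + 1 = n) (h : n + 1 = n₁) (a : ∀ i, Sec (E i) n), LocallyFinite a →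
    (∀ᶠ i in Filter.cofinite, (a i).D h = 0) →
    ∃ b : ∀ i, Sec (E i) n₀, LocallyFinite b ∧ ∀ᶠ i in Filter.cofinite, (b i).D h₀ = a i

/-- A cochain with values in `⨁ E i` is a locally finite family, and it comes from `⨁ Γ(E i)` when
almost all its members are zero. The comparison map is injective, so it is a quasi-isomorphism when
locally finite families modulo almost zero ones form an acyclic complex. -/
lemma quasiIso_dsumSections_iff (E : ι → Coeff k X) :
    QuasiIso (dsumSections E) ↔ AlmostExact E := by
  rw [quasiIso_iff_elem]
  constructor
  · intro H n₀ n n₁ h₀ h a ha hda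
    obtain ⟨α, hα⟩ := ha.exists_coord
    obtain ⟨x, hx⟩ := exists_dsumCoord (A := fun i => sections (E i)) (fun i => (a i).D h) hda
    obtain ⟨y, β, -, hβ⟩ := H n₀ n n₁ h₀ h x α
      (fun l => dsumCpx_ext fun i => by
        change ((sections (E i)).d n₁ l).hom (dsumCoord x i) = 0
        rw [hx]
        exact sections_d_eq_zero _ rfl _ (Sec.D_D _ _ _) _)
      (by
        refine (Sec.coord_ext fun i => ?_).trans (sections_d_apply _ h α).symm
        rw [coord_dsumSections, hx, Sec.coord_D, hα])
    refine ⟨fun i => -(Sec.coord (E := E) β i), fun t σ => ?_, ?_⟩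
    · exact (Sec.coord_locallyFinite β t σ).mono fun i hi => neg_eq_zero.2 hi
    · filter_upwards [eventually_dsumCoord_eq_zero y] with i hi
      have e := congrArg (fun ξ : Sec (dsumCoeff E) n => ξ.coord i)
        ((sections_d_apply _ h₀ β).symm.trans hβ)
      rw [Sec.D_neg, ← Sec.coord_D h₀ β i, ← hα i]
      refine (congrArg Neg.neg e).trans ?_
      have e' : Sec.coord (((dsumSections E).f n).hom y) i = 0 :=
        (coord_dsumSections E y i).trans hi
      refine (congrArg Neg.neg (congrArg (fun z => z - α.coord i) e')).trans ?_
      rw [zero_sub, neg_neg]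
  · intro H n₀ n n₁ h₀ h x α hx hα
    have hα' : ∀ i, (Sec.coord (E := E) α i).D h = dsumCoord x i := fun i => by
      rw [← coord_dsumSections E x i, hα]
      exact (Sec.coord_D h α i).symm.trans
        (congrArg (fun ξ => Sec.coord ξ i) (sections_d_apply _ h α).symm)
    obtain ⟨b, hb, hba⟩ := H h₀ h (Sec.coord (E := E) α) (Sec.coord_locallyFinite α) (by
      filter_upwards [eventually_dsumCoord_eq_zero x] with i hi
      rw [hα', hi]
      rfl)
    obtain ⟨β, hβ⟩ := hb.exists_coord
    obtain ⟨y, hy⟩ := exists_dsumCoord (A := fun i => sections (E i))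
      (fun i => Sec.coord (E := E) α i - (b i).D h₀) (hba.mono fun i hi => sub_eq_zero.2 hi.symm)
    refine ⟨y, -β, dsumCpx_ext fun i => ?_, ?_⟩
    · refine (congrArg ((sections (E i)).d n n₁).hom (hy i)).trans ?_
      refine (sections_d_apply (E i) h _).trans ?_
      rw [Sec.D_sub, hα', Sec.D_D]
      exact sub_zero _
    · refine (sections_d_apply _ h₀ _).trans (Sec.coord_ext fun i => ?_)
      change _ = Sec.coord (((dsumSections E).f n).hom y) i - Sec.coord (E := E) α i
      rw [coord_dsumSections, hy, Sec.D_neg, sub_sub_cancel_left]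
      exact congrArg Neg.neg ((Sec.coord_D h₀ β i).trans (by rw [hβ]))

end LocallyFinite

/-! ### Gluing locally finite families, and 𝒪-compactness. -/

section LocallyFiniteGluing

variable {k : Type u} [Field k] {X Y Z F G T U V : SSet.{u}} {ι : Type u}

lemma LocallyFinite.add {E : ι → Coeff k X} {n : ℤ} {a b : ∀ i, Sec (E i) n}
    (ha : LocallyFinite a) (hb : LocallyFinite b) : LocallyFinite fun i => a i + b i := fun t σ => by
  filter_upwards [ha t σ, hb t σ] with i h h'
  exact (congrArg₂ (· + ·) h h').trans (add_zero _)

lemma LocallyFinite.sub {E : ι → Coeff k X} {n : ℤ} {a b : ∀ i, Sec (E i) n}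
    (ha : LocallyFinite a) (hb : LocallyFinite b) : LocallyFinite fun i => a i - b i := fun t σ => by
  filter_upwards [ha t σ, hb t σ] with i h h'
  exact (congrArg₂ (· - ·) h h').trans (sub_zero _)

/-- A locally finite family is a single cochain with values in the direct sum, and taking components
commutes with `D`. -/
lemma LocallyFinite.D {E : ι → Coeff k X} {n n' : ℤ} (hn : n + 1 = n') {a : ∀ i, Sec (E i) n}
    (ha : LocallyFinite a) : LocallyFinite fun i => (a i).D hn := by
  obtain ⟨α, hα⟩ := ha.exists_coord
  have h := Sec.coord_locallyFinite (α.D hn)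
  simpa only [LocallyFinite, Sec.coord_D, hα] using h

lemma LocallyFinite.pull {E : ι → Coeff k Y} {n : ℤ} {a : ∀ i, Sec (E i) n}
    (ha : LocallyFinite a) (f : X ⟶ Y) :
    LocallyFinite (E := fun i => (E i).pullback f) fun i => (a i).pull f :=
  fun t σ => ha t (f.app _ σ)

lemma LocallyFinite.restr {E : ι → Coeff k T} {i : V ⟶ T} {w : U ⟶ V} {v : U ⟶ T}
    (h : w ≫ i = v) {n : ℤ} {a : ∀ j, Sec ((E j).pullback i) n} (ha : LocallyFinite a) :
    LocallyFinite (E := fun j => (E j).pullback v) fun j => (a j).restr h :=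
  fun t σ => (ha t (w.app _ σ)).mono fun j hj => (Sec.restr_eq_zero_iff h (a j) t σ).2 hj

lemma eventually_pull_D_eq_zero {E : ι → Coeff k Y} (f : X ⟶ Y) {n n₁ : ℤ} (hn : n + 1 = n₁)
    {a : ∀ i, Sec (E i) n} (ha : ∀ᶠ i in Filter.cofinite, (a i).D hn = 0) :
    ∀ᶠ i in Filter.cofinite, ((a i).pull f).D hn = 0 :=
  ha.mono fun i hi => by
    rw [Sec.pull_D, hi]
    rfl

lemma almostExact_coprod {E : ι → Coeff k (X ⨿ Z)}
    (hX : AlmostExact fun i => (E i).pullback (coprod.inl : X ⟶ X ⨿ Z))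
    (hZ : AlmostExact fun i => (E i).pullback (coprod.inr : Z ⟶ X ⨿ Z)) : AlmostExact E := by
  intro n₀ n n₁ h₀ h a ha hda
  obtain ⟨b, hb, hba⟩ := hX h₀ h _ (ha.pull _) (eventually_pull_D_eq_zero _ h hda)
  obtain ⟨c, hc, hca⟩ := hZ h₀ h _ (ha.pull _) (eventually_pull_D_eq_zero _ h hda)
  choose e e₁ e₂ using fun i => exists_sec_coprod (E i) (b i) (c i)
  refine ⟨e, fun t σ => ?_, ?_⟩
  · rcases exists_preimage_coprod σ with ⟨x, rfl⟩ | ⟨x, rfl⟩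
    · exact (hb t x).mono fun i hi => (congrFun (congrFun (e₁ i) t) x).trans hi
    · exact (hc t x).mono fun i hi => (congrFun (congrFun (e₂ i) t) x).trans hi
  · filter_upwards [hba, hca] with i h₁ h₂
    rw [← e₁ i, Sec.pull_D] at h₁
    rw [← e₂ i, Sec.pull_D] at h₂
    funext t σ
    rcases exists_preimage_coprod σ with ⟨x, rfl⟩ | ⟨x, rfl⟩
    · exact congrFun (congrFun h₁ t) x
    · exact congrFun (congrFun h₂ t) x

/-- Locally finite families on the two ends of a cylinder extend to the cylinder. -/
lemma exists_locallyFinite_restr_extension {E : ι → Coeff k T} {i : cyl Y ⟶ T} {v₀ v₁ : Y ⟶ T}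
    (h₀ : SSet.ι₀ ≫ i = v₀) (h₁ : SSet.ι₁ ≫ i = v₁) {n : ℤ}
    {c₀ : ∀ j, Sec ((E j).pullback v₀) n} {c₁ : ∀ j, Sec ((E j).pullback v₁) n}
    (hc₀ : LocallyFinite c₀) (hc₁ : LocallyFinite c₁) :
    ∃ e : ∀ j, Sec ((E j).pullback i) n, LocallyFinite e ∧ (∀ j, (e j).restr h₀ = c₀ j) ∧
      ∀ j, (e j).restr h₁ = c₁ j := by
  choose e e₀ e₁ he using fun j => exists_restr_extension h₀ h₁ (c₀ j) (c₁ j)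
  refine ⟨e, fun t z => ?_, e₀, e₁⟩
  by_cases hz₀ : ∃ y, (SSet.ι₀ : Y ⟶ cyl Y).app _ y = z
  · obtain ⟨y, rfl⟩ := hz₀
    exact (hc₀ t y).mono fun j hj =>
      (Sec.restr_eq_zero_iff h₀ (e j) t y).1 ((congrFun (congrFun (e₀ j) t) y).trans hj)
  by_cases hz₁ : ∃ y, (SSet.ι₁ : Y ⟶ cyl Y).app _ y = z
  · obtain ⟨y, rfl⟩ := hz₁
    exact (hc₁ t y).mono fun j hj =>
      (Sec.restr_eq_zero_iff h₁ (e j) t y).1 ((congrFun (congrFun (e₁ j) t) y).trans hj)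
  exact Filter.Eventually.of_forall fun j => he j t z (not_exists.1 hz₀) (not_exists.1 hz₁)

open Classical in
-- Primitives on the initial end are extended to the cylinder. What is left vanishes on that end and
-- is contracted in one stroke as a cochain with values in the direct sum, which keeps the primitive
-- locally finite.
lemma almostExact_cyl {E : ι → Coeff k (cyl Y)} (hE : ∀ i, (E i).IsLocallyConstant)
    (hY : AlmostExact fun i => (E i).pullback (SSet.ι₀ : Y ⟶ cyl Y)) : AlmostExact E := by
  intro n₀ n n₁ h₀ h a ha hda
  obtain ⟨c, hc, hca⟩ := hY h₀ h _ (ha.pull _) (eventually_pull_D_eq_zero _ h hda)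
  obtain ⟨e, he, hec, -⟩ : ∃ e : ∀ i, Sec (E i) n₀, LocallyFinite e ∧
      (∀ i, (e i).pull SSet.ι₀ = c i) ∧ ∀ i, (e i).pull SSet.ι₁ = 0 :=
    exists_locallyFinite_restr_extension (E := E) (i := 𝟙 (cyl Y)) rfl rfl hc
      (.of_eventually (.of_forall fun _ => rfl))
  -- The hypotheses hold only for almost all indices. Setting the remainder to zero at the others
  -- makes `ρ` an exact cocycle with zero restriction to the end.
  let good : ι → Prop := fun i => (a i).D h = 0 ∧ (c i).D h₀ = (a i).pull SSet.ι₀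
  let r : ∀ i, Sec (E i) n := fun i => if good i then a i - (e i).D h₀ else 0
  have hr : LocallyFinite r := fun t σ => by
    filter_upwards [(ha.sub (he.D h₀)) t σ] with i hi
    by_cases hg : good i
    · exact (congrFun (congrFun (if_pos hg) t) σ).trans hi
    · rw [show r i = _ from if_neg hg]
      rfl
  obtain ⟨ρ, hρ⟩ := hr.exists_coord
  have hρ₀ : ρ.pull (SSet.ι₀ : Y ⟶ cyl Y) = 0 := by
    refine funext fun t => funext fun y => dsumCpx_ext fun i => ?_
    refine (congrFun (congrFun (hρ i) t) _).trans (congrFun (congrFun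
      (show (r i).pull (SSet.ι₀ : Y ⟶ cyl Y) = 0 from ?_) t) y)
    by_cases hg : good i
    · have : (a i).pull (SSet.ι₀ : Y ⟶ cyl Y) - ((e i).D h₀).pull SSet.ι₀ = 0 := by
        rw [← Sec.pull_D, hec, hg.2, sub_self]
      rw [show r i = _ from if_pos hg]
      exact this
    · rw [show r i = _ from if_neg hg]
      rfl
  have hρd : ρ.D h = 0 := by
    refine Sec.coord_ext fun i => ?_
    rw [Sec.coord_D, hρ]
    by_cases hg : good i
    · rw [show r i = _ from if_pos hg, Sec.D_sub, hg.1, Sec.D_D, sub_zero]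
      rfl
    · rw [show r i = _ from if_neg hg, Sec.D_of_zero]
      rfl
  obtain ⟨β, -, hβ⟩ := exists_primitive_of_pull_ι₀ (isLocallyConstant_dsumCoeff hE) h₀ h hρ₀ hρd
  refine ⟨fun i => e i + β.coord i, he.add β.coord_locallyFinite, ?_⟩
  filter_upwards [hda, hca] with i h₁ h₂
  rw [Sec.D_add, ← Sec.coord_D, hβ, hρ, show r i = _ from if_pos ⟨h₁, h₂⟩, add_sub_cancel]

open Classical in
-- This is Mayer–Vietoris for locally finite families: primitives on the three pieces differ on the
-- interfaces by cocycles for almost all indices. These bound families on `Y`, whose extensions to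
-- the cylinder correct the cylinder primitive so that the three can be glued.
lemma almostExact_cospanComp (f : X ⨿ Y ⟶ F) (g : Y ⨿ Z ⟶ G) {E : ι → Coeff k (cospanComp f g)}
    (hE : ∀ i, (E i).IsLocallyConstant)
    (hY : ∀ E : ι → Coeff k Y, (∀ i, (E i).IsLocallyConstant) → AlmostExact E)
    (hF : AlmostExact fun i => (E i).pullback (toCompLeft f g))
    (hG : AlmostExact fun i => (E i).pullback (toCompRight f g)) : AlmostExact E := by
  have hF₀ : (coprod.inr ≫ f) ≫ toCompLeft f g = SSet.ι₀ ≫ cylToComp f g := by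
    rw [ι₀_cylToComp, Category.assoc]
  have hG₁ : (coprod.inl ≫ g) ≫ toCompRight f g = SSet.ι₁ ≫ cylToComp f g := by
    rw [ι₁_cylToComp, Category.assoc]
  have hC : AlmostExact fun i => (E i).pullback (cylToComp f g) :=
    almostExact_cyl (fun i => (hE i).pullback _) (hY _ fun i => ((hE i).pullback _).pullback _)
  intro n₀ n n₁ h₀ h a ha hda
  obtain ⟨bF, hbF, hF⟩ := hF h₀ h _ (ha.pull _) (eventually_pull_D_eq_zero _ h hda)
  obtain ⟨bG, hbG, hG⟩ := hG h₀ h _ (ha.pull _) (eventually_pull_D_eq_zero _ h hda)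
  obtain ⟨bC, hbC, hC⟩ := hC h₀ h _ (ha.pull _) (eventually_pull_D_eq_zero _ h hda)
  have hm : n₀ - 1 + 1 = n₀ := sub_add_cancel _ _
  have ends : ∀ {V : SSet.{u}} {i : V ⟶ cospanComp f g} {w : Y ⟶ V} {v : Y ⟶ cospanComp f g}
      (hV : w ≫ i = v) (w' : Y ⟶ cyl Y) (hw' : w' ≫ cylToComp f g = v)
      {b : ∀ j, Sec ((E j).pullback i) n₀}, LocallyFinite b →
      (∀ᶠ j in Filter.cofinite, (b j).D h₀ = (a j).pull i) →
      ∃ c : ∀ j, Sec ((E j).pullback v) (n₀ - 1), LocallyFinite c ∧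
        ∀ᶠ j in Filter.cofinite, (b j).restr hV = (bC j).restr hw' + (c j).D hm := by
    intro V i w v hV w' hw' b hb hba
    obtain ⟨c, hc, hcb⟩ := hY (fun j => (E j).pullback v) (fun j => (hE j).pullback v) hm h₀
      (fun j => (b j).restr hV - (bC j).restr hw') ((hb.restr hV).sub (hbC.restr hw')) (by
        filter_upwards [hba, hC] with j h₁ h₂
        rw [Sec.D_sub, Sec.restr_D, Sec.restr_D, h₁, h₂, Sec.restr_pull, Sec.restr_pull, sub_self])
    exact ⟨c, hc, hcb.mono fun j hj => by rw [hj, add_sub_cancel]⟩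
  obtain ⟨c₀, hc₀, hF'⟩ := ends hF₀ SSet.ι₀ rfl hbF hF
  obtain ⟨c₁, hc₁, hG'⟩ := ends hG₁ SSet.ι₁ rfl hbG hG
  obtain ⟨e, he, he₀, he₁⟩ := exists_locallyFinite_restr_extension (E := E) (i := cylToComp f g)
    rfl rfl hc₀ hc₁
  have hbC' := hbC.add (he.D hm)
  -- For the finitely many indices where matching may fail the glued cochain can be taken to be
  -- zero; the first clause records this so that local finiteness can be checked piece by piece.
  have H : ∀ j, ∃ b : Sec (E j) n₀,
      ((b.pull (toCompLeft f g) = bF j ∧ b.pull (toCompRight f g) = bG j ∧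
        b.pull (cylToComp f g) = bC j + (e j).D hm) ∨ b = 0) ∧
      ((bF j).restr hF₀ = (bC j).restr rfl + (c₀ j).D hm →
        (bG j).restr hG₁ = (bC j).restr rfl + (c₁ j).D hm →
        b.pull (toCompLeft f g) = bF j ∧ b.pull (toCompRight f g) = bG j ∧
          b.pull (cylToComp f g) = bC j + (e j).D hm) := by
    intro j
    by_cases hj : (bF j).restr hF₀ = (bC j).restr rfl + (c₀ j).D hm ∧
        (bG j).restr hG₁ = (bC j).restr rfl + (c₁ j).D hm
    · obtain ⟨b, hb⟩ := exists_sec_cospanComp f g hF₀ hG₁ rfl rfl (bF j) (bG j)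
        (bC j + (e j).D hm) (by rw [hj.1, Sec.restr_add, ← Sec.restr_D, he₀])
        (by rw [hj.2, Sec.restr_add, ← Sec.restr_D, he₁])
      exact ⟨b, Or.inl hb, fun _ _ => hb⟩
    · exact ⟨0, Or.inr rfl, fun h h' => absurd ⟨h, h'⟩ hj⟩
  choose b hb hb' using H
  refine ⟨b, fun t σ => ?_, ?_⟩
  · rcases exists_preimage_cospanComp f g σ with ⟨x, rfl⟩ | ⟨x, rfl⟩ | ⟨x, rfl⟩
    · filter_upwards [hbF t x] with j hj
      rcases hb j with h | h
      · exact (congrFun (congrFun h.1 t) x).trans hj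
      · rw [h]; rfl
    · filter_upwards [hbG t x] with j hj
      rcases hb j with h | h
      · exact (congrFun (congrFun h.2.1 t) x).trans hj
      · rw [h]; rfl
    · filter_upwards [hbC' t x] with j hj
      rcases hb j with h | h
      · exact (congrFun (congrFun h.2.2 t) x).trans hj
      · rw [h]; rfl
  · filter_upwards [hF, hG, hC, hF', hG'] with j h₁ h₂ h₃ h₄ h₅
    obtain ⟨p₁, p₂, p₃⟩ := hb' j h₄ h₅
    refine sub_eq_zero.1 (sec_cospanComp_eq_zero f g (α := (b j).D h₀ - a j) ?_ ?_ ?_)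
    · change ((b j).D h₀).pull (toCompLeft f g) - (a j).pull (toCompLeft f g) = 0
      rw [← Sec.pull_D, p₁, h₁, sub_self]
    · change ((b j).D h₀).pull (toCompRight f g) - (a j).pull (toCompRight f g) = 0
      rw [← Sec.pull_D, p₂, h₂, sub_self]
    · change ((b j).D h₀).pull (cylToComp f g) - (a j).pull (cylToComp f g) = 0
      rw [← Sec.pull_D, p₃, Sec.D_add, Sec.D_D, add_zero, h₃, sub_self]

lemma isOCompact_iff (k : Type u) [Field k] (X : SSet.{u}) : IsOCompact k X ↔
    (∀ (ι : Type u) (E : ι → Coeff k X), (∀ i, (E i).IsLocallyConstant) → AlmostExact E) ∧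
      ∀ E : Coeff k X, E.IsPerfect → IsPerfectCpx (sections E) := by
  simp only [IsOCompact, quasiIso_sigma_desc_iff, quasiIso_dsumSections_iff]

lemma IsOCompact.coprod (hX : IsOCompact k X) (hZ : IsOCompact k Z) : IsOCompact k (X ⨿ Z) := by
  rw [isOCompact_iff] at *
  exact ⟨fun ι E hE => almostExact_coprod (hX.1 ι _ fun i => (hE i).pullback _)
    (hZ.1 ι _ fun i => (hE i).pullback _), isPerfectCpx_sections_coprod hX.2 hZ.2⟩

lemma IsOCompact.cospanComp (hY : IsOCompact k Y) (hF : IsOCompact k F) (hG : IsOCompact k G)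
    (f : X ⨿ Y ⟶ F) (g : Y ⨿ Z ⟶ G) : IsOCompact k (cospanComp f g) := by
  rw [isOCompact_iff] at *
  exact ⟨fun ι E hE => almostExact_cospanComp f g hE (hY.1 ι)
      (hF.1 ι _ fun i => (hE i).pullback _) (hG.1 ι _ fun i => (hE i).pullback _),
    isPerfectCpx_sections_cospanComp f g hY.2 hF.2 hG.2⟩

/-- This yields the absolute part of the relative orientation on `X ⊔ Z̄ ⟶ T`. -/
lemma FundClass.IsOrientation.disjUnion_neg {d : ℤ} {θ₁ : FundClass k X d} {θ₂ : FundClass k Y d}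
    (h₁ : θ₁.IsOrientation) (h₂ : θ₂.IsOrientation) : (θ₁.disjUnion θ₂.neg).IsOrientation :=
  ⟨h₁.1.coprod h₂.1, fun _ _ P hP =>
    (Pairing.isPerfect_iff _).1 (FundClass.isPerfect_disjUnion_neg h₁ h₂ P hP)⟩

end LocallyFiniteGluing

end OrientedCospan

end

/-! ### The theorem. -/

theorem mainTheorem5 {k : Type u} [Field k] {d : ℤ} {X Y Z F G : SSet.{u}}
    (f : X ⨿ Y ⟶ F) (g : Y ⨿ Z ⟶ G)
    (ηX : OrientedCospan.FundClass k X d) (ηY : OrientedCospan.FundClass k Y d)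
    (ηZ : OrientedCospan.FundClass k Z d)
    (hX : ηX.IsOrientation) (hY : ηY.IsOrientation) (hZ : ηZ.IsOrientation)
    (φ : OrientedCospan.BoundaryStructure f (ηX.disjUnion ηY.neg))
    (hφ : φ.IsRelativeOrientation)
    (ψ : OrientedCospan.BoundaryStructure g (ηY.disjUnion ηZ.neg))
    (hψ : ψ.IsRelativeOrientation) :
    (φ.glue ψ).IsRelativeOrientation ∧
      (OrientedCospan.IsOCompact k F → OrientedCospan.IsOCompact k G →
        OrientedCospan.IsOCompact k (OrientedCospan.cospanComp f g)) :=
  ⟨⟨hX.disjUnion_neg hZ, OrientedCospan.BoundaryStructure.isNondegenerate_glue hY hφ.2 hψ.2⟩,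
    -- 𝒪-compactness of `Y` is part of its being oriented, so only `F` and `G` need it as an
    -- assumption.
    fun hF hG => hY.1.cospanComp hF hG f g⟩
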